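/- **Setting.** Let $d\in\{1,2,3\}$, $0<\alpha\le\beta$, and let $D\subset\mathbb R^d$ be a non-empty bounded convex domain with a uniform Cartesian mesh $\mathcal T_H$ of closed cubes of edge length $H$. Let $\mathcal T_\varepsilon$, $\mathcal T_h$ be the uniform refinements of $\mathcal T_H$ with $H/\varepsilon,\ \varepsilon/h\in\{2,3,\dots\}$. $V_H\subset V_h$ denote the spaces of continuous piecewise $Q^1$ functions on $\mathcal T_H,\mathcal T_h$ that vanish on $\partial D$, with nodal bases $\Lambda_i$ and $\lambda_k$. Let $\mathfrak A_\varepsilon$ be the set of $A\in L^\infty(D)$ with $\alpha\le A\le\beta$ a.e. that are constant on every element of $\mathcal T_\varepsilon$, and $a(u,v)=\int_D A\nabla u\cdot\nabla v$. The quasi-interpolation $\mathcal I_H$ takes the $L^2$-projection of a function onto $Q^1$ on each element of $\mathcal T_H$ and then averages, at each inner node of $\mathcal T_H$, the values of the adjacent elements (the value at boundary nodes is $0$). Let $\ell\ge 1$. For $K\in\mathcal T_H$ let $\omega=\mathtt N^\ell(K)$ be the patch of $\ell$ layers of elements of $\mathcal T_H$ around $K$; we call $K$ (and $\omega$) interior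 if all elements within $\ell+1$ layers around $K$ belong to $\mathcal T_H$. Put $m_\ell=((2\ell+1)H/\varepsilon)^d$, $n_\ell=((2\ell+1)H/h-1)^d$, $N_\ell=(2\ell+2)^d$ (the numbers of elements of $\mathcal T_\varepsilon$ in $\omega$, of inner fine nodes of $\omega$, and of all coarse nodes of $\omega$). The vector $\mathbf A_{\varepsilon,\omega}\in\mathbb R^{m_\ell}$ holds the values of $A\in\mathfrak A_\varepsilon$ on the elements of $\mathcal T_\varepsilon$ in $\omega$, enumerated in the same relative order for all $\omega$. For a basis function $\Lambda_j$ of one of the $2^d$ nodes of $K$, the corrector $\mathcal Q_K^\ell(\Lambda_j|_K)$ is the element $q$ of $\mathcal W(\omega)=\{w\in V_h:\mathcal I_Hw=0,\ \operatorname{supp}w\subseteq\omega\}$ with $a(q,w)=\int_KA\nabla\Lambda_j\cdot\nabla w$ for all $w\in\mathcal W(\omega)$, and the local Petrov–Galerkin LOD matrix $\mathbf S^{\rm pg}_\omega\in\mathbb R^{N_\ell\times 2^d}$ has the entries $\int_K A\nabla\Lambda_i\cdot\nabla\Lambda_j-a(\Lambda_i,\mathcal Q_K^\ell(\Lambda_j|_K))$,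 where $i$ runs over the coarse nodes of $\omega$ and $j$ over the nodes of $K$. Let $\mathbf S=(a(\lambda_k,\lambda_l))\in\mathbb R^{n_\ell\times n_\ell}$ ($k,l$ inner fine nodes of $\omega$), $\mathbf I_\omega\in\mathbb R^{N_\ell\times n_\ell}$ with entries $(\mathcal I_H\lambda_k)(z_i)$, $\mathbf P_\omega\in\mathbb R^{n_\ell\times N_\ell}$ with entries $\Lambda_i(x_k)$, $\mathbf P_{\omega,K}\in\mathbb R^{n_\ell\times 2^d}$ with entries $\Lambda_j(x_k)$ if $x_k\in K$ and $0$ otherwise ($z_i$, $x_k$ the coarse and fine nodes), and $\mathbf Y=\mathbf I_\omega\mathbf S^{-1}\mathbf I_\omega^T$. All matrix norms are spectral norms. For $\vartheta,\delta\in(0,1)$ put $m(\vartheta,\delta)=\lceil\log(0.5\,\vartheta\delta)/\log(1-\delta)\rceil$. For $\eta>0$, numbers $0<\mathfrak V_{\inf}\le\mathfrak V_{\sup}$, $0<\widehat{\mathfrak V}_{\inf}\le\widehat{\mathfrak V}_{\sup}$, $\mathfrak v_{\rm resc}\in(0,\mathfrak V_{\sup}^{-1})$, $\widehat{\mathfrak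 v}_{\rm resc}\in(0,\widehat{\mathfrak V}_{\sup}^{-1})$, $\theta,\gamma\in(0,\eta)$ are called *admissible* if for all interior $K\in\mathcal T_H$ and all $A\in\mathfrak A_\varepsilon$: * the spectrum of $\mathbf S$ lies in $[\mathfrak V_{\inf},\mathfrak V_{\sup}]$; * the spectra of $\mathbf Y$ and of every matrix $\widehat{\mathbf Y}=\mathfrak v_{\rm resc}\mathbf I_\omega\mathbf X\mathbf I_\omega^T$ with $\mathbf X$ symmetric and $\|(\mathfrak v_{\rm resc}\mathbf S)^{-1}-\mathbf X\|_2\le\theta$ lie in $[\widehat{\mathfrak V}_{\inf},\widehat{\mathfrak V}_{\sup}]$; * $\theta<\min\{\lambda_{\min}(\mathbf Y),\ \lambda_{\min}(\mathbf Y)/(2\,\mathfrak v_{\rm resc}\|\mathbf I_\omega^T\|_2^2)\}$; * $\dfrac{\mathfrak v_{\rm resc}\|\mathbf P_{\omega,K}\|_2\|\mathbf P_\omega\|_2\|\mathbf I_\omega\|_2^4}{\widehat{\mathfrak V}_{\inf}^2}\,\theta+\|\mathbf P_{\omega,K}\|_2\|\mathbf P_\omega\|_2\|\mathbf I_\omega\|_2^2\,\gamma\le\eta$.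 Put $\delta=\mathfrak v_{\rm resc}\mathfrak V_{\inf}$ and $\widehat\delta=\widehat{\mathfrak v}_{\rm resc}\widehat{\mathfrak V}_{\inf}$. **Theorem.** There are a constant $C>0$ that depends only on $d$ and a constant $c>0$ that depends only on $d,\alpha,\beta$ such that the following holds for all $D$, $H$, $\varepsilon$, $h$ as above, all $\ell\ge1$ and all $\eta\in(0,1/4)$. (a) For all $A\in\mathfrak A_\varepsilon$, all interior $K$ and all nodes of $K$, the corrector $\mathcal Q_K^\ell(\Lambda_j|_K)$ exists and is unique. (b) There are admissible parameters such that, for all $A\in\mathfrak A_\varepsilon$ and interior $K$, each of $\mathfrak v_{\rm resc}$, $\delta$, $\widehat{\mathfrak V}_{\inf}$, $\widehat\delta$ agrees up to factors between $c^{-1}$ and $c$ with $\lambda_{\max}(\mathbf S)^{-1}$, $\lambda_{\min}(\mathbf S)\lambda_{\max}(\mathbf S)^{-1}$, $\lambda_{\min}(\mathbf Y)$, $\lambda_{\min}(\mathbf Y)\lambda_{\max}(\mathbf Y)^{-1}$, respectively. (c) For all admissible parameters there is one ReLU network $\Psi$ (affine layers $x\mapsto Wx+b$, with $t\mapsto\max\{0,t\}$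 applied componentwise after all layers but the last) with input dimension $m_\ell$ and output dimension $N_\ell2^d$ such that for all interior $K\in\mathcal T_H$, $\omega=\mathtt N^\ell(K)$, and all $A\in\mathfrak A_\varepsilon$ $$\big\|\mathbf S^{\rm pg}_\omega-\mathrm{mat}\big(\Psi(\mathbf A_{\varepsilon,\omega})\big)\big\|_2\le\eta,$$ where $\mathrm{mat}$ turns a vector of stacked columns into an $N_\ell\times2^d$ matrix. The number of layers $L(\Psi)$ and the number $M(\Psi)$ of non-zero entries of all weight matrices and bias vectors satisfy $$L(\Psi)\le C\Big[\log m(\theta,\delta)\big(\log\tfrac1\theta+\log m(\theta,\delta)+\log n_\ell\big)+\log m(\gamma,\widehat\delta)\big(\log\tfrac1\gamma+\log m(\gamma,\widehat\delta)+\log N_\ell\big)+1\Big],$$ $$M(\Psi)\le C\Big[m(\theta,\delta)\log^2(m(\theta,\delta))\,n_\ell^3\big(\log\tfrac1\theta+\log m(\theta,\delta)+\log n_\ell\big)+m(\gamma,\widehat\delta)\log^2(m(\gamma,\widehat\delta))\,N_\ell^3\big(\log\tfrac1\gamma+\log m(\gamma,\widehat\delta)+\log N_\ell\big)+(\ell H/h)^{2d}\Big].$$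 -/

import Mathlib

open MeasureTheory Set

noncomputable section

namespace LODNet

/-! ### ReLU neural networks -/

/-- A neural network with input dimension `n` and output dimension `m`: a nonempty finite sequence
of layers `(W, b)`, listed from the first layer to the last one. -/
inductive NeuralNetwork : ℕ → ℕ → Type
  | output {n m : ℕ} (W : Matrix (Fin m) (Fin n) ℝ) (b : Fin m → ℝ) : NeuralNetwork n m
  | hidden {n k m : ℕ} (W : Matrix (Fin k) (Fin n) ℝ) (b : Fin k → ℝ)
      (Ψ : NeuralNetwork k m) : NeuralNetwork n m

namespace NeuralNetwork

/-- The number of layers. -/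
def depth : {n m : ℕ} → NeuralNetwork n m → ℕ
  | _, _, output _ _ => 1
  | _, _, hidden _ _ Ψ => Ψ.depth + 1

/-- The number of non-zero entries of a weight matrix and a bias vector. -/
def layerParams {n m : ℕ} (W : Matrix (Fin m) (Fin n) ℝ) (b : Fin m → ℝ) : ℕ :=
  (∑ i, hammingNorm (W i)) + hammingNorm b

/-- The total number of non-zero parameters. -/
def numParams : {n m : ℕ} → NeuralNetwork n m → ℕ
  | _, _, output W b => layerParams W b
  | _, _, hidden W b Ψ => layerParams W b + Ψ.numParams

/-- The realization with the ReLU activation function `t ↦ max 0 t`, which acts componentwise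
after every layer except the last one. -/
def realize : {n m : ℕ} → NeuralNetwork n m → (Fin n → ℝ) → (Fin m → ℝ)
  | _, _, output W b, x => W.mulVec x + b
  | _, _, hidden W b Ψ, x => Ψ.realize (fun i => max 0 ((W.mulVec x + b) i))

end NeuralNetwork

/-! ### Matrices -/

/-- The `k × l` matrix whose columns are stacked in the vector `v`
(`finProdFinEquiv (j, i) = i + k * j`). -/
def mat {k l : ℕ} (v : Fin (l * k) → ℝ) : Matrix (Fin k) (Fin l) ℝ :=
  Matrix.of fun i j => v (finProdFinEquiv (j, i))

open scoped Matrix.Norms.L2Operator in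
/-- The spectral norm: the operator norm for the Euclidean norms. -/
def specNorm {m n : Type} [Fintype m] [Fintype n] [DecidableEq n] (M : Matrix m n ℝ) : ℝ := ‖M‖

/-- The smallest eigenvalue of a symmetric matrix. -/
def lamMin {n : Type} [Fintype n] [DecidableEq n] (M : Matrix n n ℝ) : ℝ := sInf (spectrum ℝ M)

/-- The largest eigenvalue of a symmetric matrix. -/
def lamMax {n : Type} [Fintype n] [DecidableEq n] (M : Matrix n n ℝ) : ℝ := sSup (spectrum ℝ M)

/-- The Rayleigh quotient of `M` takes values in `[a, b]`. -/
def SpectralBounds {n : Type} [Fintype n] (M : Matrix n n ℝ) (a b : ℝ) : Prop :=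
  ∀ v : n → ℝ, a * (v ⬝ᵥ v) ≤ v ⬝ᵥ M.mulVec v ∧ v ⬝ᵥ M.mulVec v ≤ b * (v ⬝ᵥ v)

/-! ### Uniform Cartesian meshes and first-order finite elements -/

/-- A uniform Cartesian mesh in `ℝ^d`: finitely many cubes of edge length `size`, each of which is
given by the integer coordinates of its lower corner relative to `origin`. -/
structure CartesianMesh (d : ℕ) where
  origin : Fin d → ℝ
  size : ℝ
  size_pos : 0 < size
  cells : Finset (Fin d → ℤ)

namespace CartesianMesh

variable {d : ℕ}

/-- The grid point with integer coordinates `z`. -/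
def node (T : CartesianMesh d) (z : Fin d → ℤ) : Fin d → ℝ :=
  fun i => T.origin i + T.size * z i

/-- The closed element with lower corner `z`. -/
def cell (T : CartesianMesh d) (z : Fin d → ℤ) : Set (Fin d → ℝ) :=
  Icc (T.node z) (T.node (z + 1))

/-- The open domain that is covered by the mesh. -/
def domain (T : CartesianMesh d) : Set (Fin d → ℝ) := interior (⋃ K ∈ T.cells, T.cell K)

/-- The uniform refinement in which each element is split into `r ^ d` cubes. -/
def refine (T : CartesianMesh d) (r : ℕ) (hr : 0 < r) : CartesianMesh d where
  origin := T.origin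
  size := T.size / r
  size_pos := div_pos T.size_pos (Nat.cast_pos.mpr hr)
  cells := T.cells.biUnion fun K =>
    Finset.univ.image fun s : Fin d → Fin r => fun i => (r : ℤ) * K i + (s i : ℤ)

/-- The nodal basis function of the grid point `z` (for coordinate degree at most one). -/
def hat (T : CartesianMesh d) (z : Fin d → ℤ) (x : Fin d → ℝ) : ℝ :=
  ∏ i, max 0 (1 - |x i - T.node z i| / T.size)

/-- The conforming space of continuous piecewise `Q¹` functions on the mesh `T` that vanish on the
boundary of (and outside) `D`. -/
def feSpace (T : CartesianMesh d) (D : Set (Fin d → ℝ)) : Submodule ℝ ((Fin d → ℝ) → ℝ) :=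
  Submodule.span ℝ (T.hat '' {z | T.node z ∈ D})

/-- The union of all mesh elements that touch `S`. -/
def nbhd (T : CartesianMesh d) (S : Set (Fin d → ℝ)) : Set (Fin d → ℝ) :=
  ⋃ K ∈ {K | K ∈ T.cells ∧ (closure S ∩ T.cell K).Nonempty}, T.cell K

/-- The patch of `ℓ` layers of elements around the element `K`. -/
def patch (T : CartesianMesh d) (ℓ : ℕ) (K : Fin d → ℤ) : Set (Fin d → ℝ) :=
  T.nbhd^[ℓ] (T.cell K)

/-- The element `K` is at least `ℓ + 1` layers of elements away from the boundary. -/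
def IsInterior (T : CartesianMesh d) (ℓ : ℕ) (K : Fin d → ℤ) : Prop :=
  ∀ z : Fin d → ℤ, (∀ i, |z i - K i| ≤ (ℓ : ℤ) + 1) → z ∈ T.cells

end CartesianMesh

variable {d : ℕ}

/-! ### The quasi-interpolation operator -/

/-- Polynomials of coordinate degree at most one. -/
def multiaffine (d : ℕ) : Submodule ℝ ((Fin d → ℝ) → ℝ) :=
  Submodule.span ℝ (range fun (s : Finset (Fin d)) (x : Fin d → ℝ) => ∏ i ∈ s, x i)

/-- `q` is the `L²(K)`-projection of `v` onto the polynomials of coordinate degree at most one. -/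
def IsElementProj (T : CartesianMesh d) (K : Fin d → ℤ) (v q : (Fin d → ℝ) → ℝ) : Prop :=
  q ∈ multiaffine d ∧ ∀ p ∈ multiaffine d, ∫ x in T.cell K, (v x - q x) * p x = 0

/-- The `L²(K)`-projection of `v`. -/
def elementProj (T : CartesianMesh d) (K : Fin d → ℤ) (v : (Fin d → ℝ) → ℝ) : (Fin d → ℝ) → ℝ :=
  Classical.epsilon (IsElementProj T K v)

open Classical in
/-- The elements of the mesh that contain the grid point `z`. -/
def cellsAt (T : CartesianMesh d) (z : Fin d → ℤ) : Finset (Fin d → ℤ) :=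
  T.cells.filter fun K => T.node z ∈ T.cell K

/-- The average at the grid point `z` of the element-wise `L²`-projections of `v`. -/
def nodalAverage (T : CartesianMesh d) (v : (Fin d → ℝ) → ℝ) (z : Fin d → ℤ) : ℝ :=
  (∑ K ∈ cellsAt T z, elementProj T K v (T.node z)) / (cellsAt T z).card

/-- The quasi-interpolation operator `I_H = E_H ∘ Π_H`: element-wise `L²`-projection, followed by
averaging at the inner nodes of the mesh (and the value zero at boundary nodes). -/
def quasiInterp (T : CartesianMesh d) (v : (Fin d → ℝ) → ℝ) : (Fin d → ℝ) → ℝ :=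
  fun x => ∑ᶠ z : {z : Fin d → ℤ // T.node z ∈ T.domain}, nodalAverage T v z * T.hat z x

/-! ### Coefficients and the bilinear form -/

/-- `∫_S A ∇u · ∇v`; finite element functions are differentiable almost everywhere and their
classical partial derivatives are their weak ones. -/
def energy (S : Set (Fin d → ℝ)) (A u v : (Fin d → ℝ) → ℝ) : ℝ :=
  ∫ x in S, A x *
    ∑ i, lineDeriv ℝ u x (Pi.single i (1 : ℝ)) * lineDeriv ℝ v x (Pi.single i (1 : ℝ))

/-- The coefficients in `L^∞(D)` with values in `[α, β]` a.e. that are constant on every element of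
the mesh `Tε` of `D`. -/
def coeffs (D : Set (Fin d → ℝ)) (Tε : CartesianMesh d) (α β : ℝ) : Set ((Fin d → ℝ) → ℝ) :=
  {A | AEStronglyMeasurable A (volume.restrict D) ∧
    (∀ᵐ x ∂(volume.restrict D), α ≤ A x ∧ A x ≤ β) ∧
    ∀ K ∈ Tε.cells, ∃ c : ℝ, ∀ᵐ x ∂(volume.restrict (Tε.cell K)), A x = c}

/-- The values of an element-wise constant coefficient on the elements of `Tε = T.refine p` in the
patch around `K`; an element is indexed by its position relative to the lower corner of the patch,
and the value is recovered as the mean over the element. -/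
def coeffVec (T : CartesianMesh d) (p : ℕ) (hp : 0 < p) (ℓ : ℕ) (K : Fin d → ℤ)
    (A : (Fin d → ℝ) → ℝ) (t : Fin d → Fin ((2 * ℓ + 1) * p)) : ℝ :=
  ⨍ x in (T.refine p hp).cell (fun i => (p : ℤ) * (K i - ℓ) + (t i : ℤ)), A x

/-! ### Correctors and local Petrov–Galerkin LOD matrices

Here `T` is the coarse mesh and `Th` the fine mesh of the domain `T.domain`. -/

/-- The functions of the fine-scale space `ker I_H ∩ V_h` with support in `ω`. -/
def fineScaleSpace (T Th : CartesianMesh d) (ω : Set (Fin d → ℝ)) : Set ((Fin d → ℝ) → ℝ) :=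
  {w | w ∈ Th.feSpace T.domain ∧ quasiInterp T w = 0 ∧ Function.support w ⊆ ω}

/-- `q` is the element corrector of `u` for the element `K` and the patch of `ℓ` layers. -/
def IsElementCorrector (T Th : CartesianMesh d) (A : (Fin d → ℝ) → ℝ) (ℓ : ℕ) (K : Fin d → ℤ)
    (u q : (Fin d → ℝ) → ℝ) : Prop :=
  q ∈ fineScaleSpace T Th (T.patch ℓ K) ∧
    ∀ w ∈ fineScaleSpace T Th (T.patch ℓ K), energy T.domain A q w = energy (T.cell K) A u w

/-- The element corrector of `u`. -/
def elementCorrector (T Th : CartesianMesh d) (A : (Fin d → ℝ) → ℝ) (ℓ : ℕ) (K : Fin d → ℤ)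
    (u : (Fin d → ℝ) → ℝ) : (Fin d → ℝ) → ℝ :=
  Classical.epsilon (IsElementCorrector T Th A ℓ K u)

/-- The coarse nodes of the patch around `K` (inner and boundary nodes). -/
def coarseNode (ℓ : ℕ) (K : Fin d → ℤ) (i : Fin d → Fin (2 * ℓ + 2)) : Fin d → ℤ :=
  fun a => K a - ℓ + (i a : ℤ)

/-- The nodes of the element `K`. -/
def elementNode (K : Fin d → ℤ) (j : Fin d → Fin 2) : Fin d → ℤ := fun a => K a + (j a : ℤ)

/-- The inner fine nodes of the patch around `K`, for a fine mesh of size `H / r`. -/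
def fineNode (r ℓ : ℕ) (K : Fin d → ℤ) (k : Fin d → Fin ((2 * ℓ + 1) * r - 1)) : Fin d → ℤ :=
  fun a => (r : ℤ) * (K a - ℓ) + 1 + (k a : ℤ)

/-- The local Petrov–Galerkin LOD matrix with the entries `a(Λ_i, (id - Q_K^ℓ)(Λ_j|_K))`, where
`a(Λ_i, Λ_j|_K)` is the integral over `K` only. -/
def pgLOD (T Th : CartesianMesh d) (A : (Fin d → ℝ) → ℝ) (ℓ : ℕ) (K : Fin d → ℤ) :
    Matrix (Fin d → Fin (2 * ℓ + 2)) (Fin d → Fin 2) ℝ :=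
  Matrix.of fun i j =>
    energy (T.cell K) A (T.hat (coarseNode ℓ K i)) (T.hat (elementNode K j)) -
      energy T.domain A (T.hat (coarseNode ℓ K i))
        (elementCorrector T Th A ℓ K (T.hat (elementNode K j)))

/-! ### The matrices of the algebraic realization on a patch

The fine mesh is `T.refine r`. -/

section Algebraic

variable (T : CartesianMesh d) (r : ℕ) (hr : 0 < r) (ℓ : ℕ) (K : Fin d → ℤ)

/-- The stiffness matrix `S` of the fine finite element functions supported in the patch. -/
def stiffness (A : (Fin d → ℝ) → ℝ) :
    Matrix (Fin d → Fin ((2 * ℓ + 1) * r - 1)) (Fin d → Fin ((2 * ℓ + 1) * r - 1)) ℝ :=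
  Matrix.of fun k l => energy T.domain A
    ((T.refine r hr).hat (fineNode r ℓ K k)) ((T.refine r hr).hat (fineNode r ℓ K l))

/-- The matrix `I_ω` of the quasi-interpolation operator on the patch. -/
def interpMat : Matrix (Fin d → Fin (2 * ℓ + 2)) (Fin d → Fin ((2 * ℓ + 1) * r - 1)) ℝ :=
  Matrix.of fun i k =>
    quasiInterp T ((T.refine r hr).hat (fineNode r ℓ K k)) (T.node (coarseNode ℓ K i))

/-- The prolongation matrix `P_ω` from the coarse functions on the patch to the fine ones. -/
def prolong : Matrix (Fin d → Fin ((2 * ℓ + 1) * r - 1)) (Fin d → Fin (2 * ℓ + 2)) ℝ :=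
  Matrix.of fun k i => T.hat (coarseNode ℓ K i) ((T.refine r hr).node (fineNode r ℓ K k))

open Classical in
/-- The prolongation matrix `P_{ω,K}` from the coarse functions on `K` to the fine ones. -/
def prolongElt : Matrix (Fin d → Fin ((2 * ℓ + 1) * r - 1)) (Fin d → Fin 2) ℝ :=
  Matrix.of fun k j =>
    if (T.refine r hr).node (fineNode r ℓ K k) ∈ T.cell K then
      T.hat (elementNode K j) ((T.refine r hr).node (fineNode r ℓ K k))
    else 0

/-- The matrix `Y = I_ω S⁻¹ I_ωᵀ`. -/
def schur (A : (Fin d → ℝ) → ℝ) : Matrix (Fin d → Fin (2 * ℓ + 2)) (Fin d → Fin (2 * ℓ + 2)) ℝ :=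
  interpMat T r hr ℓ K * (stiffness T r hr ℓ K A)⁻¹ * (interpMat T r hr ℓ K).transpose

end Algebraic

/-! ### The parameters of the complexity bounds -/

/-- `m(ϑ, δ) = ⌈log(ϑ δ / 2) / log(1 - δ)⌉`. -/
def neumannLength (ϑ δ : ℝ) : ℕ := ⌈Real.log (0.5 * ϑ * δ) / Real.log (1 - δ)⌉₊

/-- Spectral bounds, rescaling factors and tolerances. -/
structure Params where
  Vinf : ℝ
  Vsup : ℝ
  vresc : ℝ
  VinfHat : ℝ
  VsupHat : ℝ
  vrescHat : ℝ
  θ : ℝ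
  γ : ℝ

/-- `δ = v_resc V_inf`. -/
def Params.δ (P : Params) : ℝ := P.vresc * P.Vinf

/-- The analogue of `δ` for the second inversion. -/
def Params.δHat (P : Params) : ℝ := P.vrescHat * P.VinfHat

/-- The conditions on the parameters, for the class `𝒜` of coefficients, the coarse mesh `T`, the
fine mesh `T.refine r`, the oversampling parameter `ℓ` and the tolerance `η`. The bounds with a hat
have to hold for `Y = I_ω S⁻¹ I_ωᵀ` and for every `v_resc I_ω X I_ωᵀ`, where `X` is a symmetric
approximation of `(v_resc S)⁻¹` up to an error of `θ`. -/
structure Admissible (T : CartesianMesh d) (r : ℕ) (hr : 0 < r) (ℓ : ℕ)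
    (𝒜 : Set ((Fin d → ℝ) → ℝ)) (η : ℝ) (P : Params) : Prop where
  Vinf_pos : 0 < P.Vinf
  Vinf_le : P.Vinf ≤ P.Vsup
  bounds : ∀ A ∈ 𝒜, ∀ K, T.IsInterior ℓ K →
    SpectralBounds (stiffness T r hr ℓ K A) P.Vinf P.Vsup
  vresc_mem : P.vresc ∈ Ioo 0 P.Vsup⁻¹
  θ_mem : P.θ ∈ Ioo 0 η
  γ_mem : P.γ ∈ Ioo 0 η
  θ_lt : ∀ A ∈ 𝒜, ∀ K, T.IsInterior ℓ K →
    P.θ < min (lamMin (schur T r hr ℓ K A))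
      (lamMin (schur T r hr ℓ K A) /
        (2 * P.vresc * specNorm (interpMat T r hr ℓ K).transpose ^ 2))
  VinfHat_pos : 0 < P.VinfHat
  VinfHat_le : P.VinfHat ≤ P.VsupHat
  bounds_schur : ∀ A ∈ 𝒜, ∀ K, T.IsInterior ℓ K →
    SpectralBounds (schur T r hr ℓ K A) P.VinfHat P.VsupHat
  bounds_schur_approx : ∀ A ∈ 𝒜, ∀ K, T.IsInterior ℓ K →
    ∀ X : Matrix (Fin d → Fin ((2 * ℓ + 1) * r - 1)) (Fin d → Fin ((2 * ℓ + 1) * r - 1)) ℝ,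
      X.IsSymm → specNorm ((P.vresc • stiffness T r hr ℓ K A)⁻¹ - X) ≤ P.θ →
      SpectralBounds (P.vresc • (interpMat T r hr ℓ K * X * (interpMat T r hr ℓ K).transpose))
        P.VinfHat P.VsupHat
  vrescHat_mem : P.vrescHat ∈ Ioo 0 P.VsupHat⁻¹
  tolerance : ∀ K, T.IsInterior ℓ K →
    P.vresc * specNorm (prolongElt T r hr ℓ K) * specNorm (prolong T r hr ℓ K) *
          specNorm (interpMat T r hr ℓ K) ^ 4 / P.VinfHat ^ 2 * P.θ +
        specNorm (prolongElt T r hr ℓ K) * specNorm (prolong T r hr ℓ K) *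
          specNorm (interpMat T r hr ℓ K) ^ 2 * P.γ ≤ η

/-- `x` and `y` agree up to factors between `c⁻¹` and `c`. -/
def Comparable (c x y : ℝ) : Prop := x ≤ c * y ∧ y ≤ c * x

/-- `v_resc ≈ λ_max(S)⁻¹`, `δ ≈ λ_min(S) λ_max(S)⁻¹`, and the corresponding statements for
`Y = I_ω S⁻¹ I_ωᵀ`, with the constant `c`. -/
structure Sharp (T : CartesianMesh d) (r : ℕ) (hr : 0 < r) (ℓ : ℕ)
    (𝒜 : Set ((Fin d → ℝ) → ℝ)) (c : ℝ) (P : Params) : Prop where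
  vresc : ∀ A ∈ 𝒜, ∀ K, T.IsInterior ℓ K →
    Comparable c P.vresc (lamMax (stiffness T r hr ℓ K A))⁻¹
  δ : ∀ A ∈ 𝒜, ∀ K, T.IsInterior ℓ K →
    Comparable c P.δ
      (lamMin (stiffness T r hr ℓ K A) * (lamMax (stiffness T r hr ℓ K A))⁻¹)
  VinfHat : ∀ A ∈ 𝒜, ∀ K, T.IsInterior ℓ K →
    Comparable c P.VinfHat (lamMin (schur T r hr ℓ K A))
  δHat : ∀ A ∈ 𝒜, ∀ K, T.IsInterior ℓ K →
    Comparable c P.δHat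
      (lamMin (schur T r hr ℓ K A) * (lamMax (schur T r hr ℓ K A))⁻¹)

/-- `log(1/ϑ) + log m(ϑ, δ) + log n`. -/
def logFactor (ϑ δ : ℝ) (n : ℕ) : ℝ :=
  Real.log (1 / ϑ) + Real.log (neumannLength ϑ δ) + Real.log n

end LODNet

end

/-! On an interior patch the corrector problem is a linear system on ker I, where I is `interpMat`:
find x with I x = 0 and yᵀ S x = yᵀ b whenever I y = 0 (`mem_fineScaleSpace_iff`,
`isElementCorrector_iff`). Let Π be the orthogonal projection onto ker I and σ = `P.vresc`. Then x
is the fixed point of x ↦ E x + σ Π b with E = Π − σ Π S Π (`eq_projIter_mulVec_add`). Admissibility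
gives δ ≤ σ S ≤ 1 in the sense of quadratic forms, so E is symmetric with spectrum in [0, 1 − δ],
and one Neumann series yields the corrector. The inverse of Y is never approximated; this is why the
terms with θ and δ (and the summand 1) alone already bound the network, the terms with γ being mere
slack.

By translation, I and hence Π are the same for all interior elements and coefficients
(`interpMat_eq_of_isInterior`), while S, b and the other local matrices are linear in the values of
A with weights that do not depend on K (`energy_eq_sum_coeffVec_translate`). So E is affine in the
network input. A block matrix with E in the middle has powers that contain G − B(x − E ^ k x), where
G − B x is a column of the local matrix (`augmented_pow_apply`, `encMat_pow_apply`). Its power 2 ^ t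
is reached by t squarings. A ReLU network squares a matrix approximately by writing products as
differences of squares and approximating t ↦ t² by sawtooth functions with error 4 ^ (−D)
(`squareState_spec`, `NetComputes.comp_approxMatSq`). The error grows by a factor 8 per squaring, as
long as the norm of the matrix is at most 1 + 2 ^ (−t) (`iterate_approxMatSq_error`); a scaling of
the off-diagonal blocks achieves this.

It remains to see that t of order log m and D of order log(1/θ) + log m + log n are enough. For
this, everything that is lost by scaling must be polynomial in n, 1/θ and 1/δ. The tolerance
condition gives σ⁻¹ ≤ η / (θ δ²) (`Admissible.inv_vresc_le`), the Rayleigh quotient of a wide hat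
function gives n² δ³ ≤ 2 ^ 21 (`Admissible.δ_bounds`), and 1/δ ≤ 2 m (`one_le_mul_neumannLength`).

For the existence of sharp admissible parameters, all matrices are compared with those of the
coefficient one: α S₁ ≤ S ≤ β S₁, and β⁻¹ Y₁ ≤ Y ≤ α⁻¹ Y₁ since inversion reverses the order. The
matrix Y₁ is definite because Iᵀ is injective (`interpMat_transpose_injective`). -/

noncomputable section
set_option linter.unusedSectionVars false

namespace LODNet

/-! ### A calculus of ReLU networks on arbitrary finite index types -/

section NetworkCalculus

variable {ι κ τ μ : Type} [Fintype ι] [Fintype κ] [Fintype τ] [Fintype μ]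

/-- The map `f` is realized, for every enumeration of the coordinates, by a network with `L` layers
and at most `M` non-zero parameters. -/
def NetComputes (f : (ι → ℝ) → (κ → ℝ)) (L M : ℕ) : Prop :=
  ∀ (n m : ℕ) (e : ι ≃ Fin n) (e' : κ ≃ Fin m), ∃ Ψ : NeuralNetwork n m,
    (∀ x, Ψ.realize (x ∘ e.symm) = f x ∘ e'.symm) ∧ Ψ.depth = L ∧ Ψ.numParams ≤ M

/-- An affine map followed by the componentwise ReLU function. -/
def reluLayer (W : Matrix κ ι ℝ) (b : κ → ℝ) (x : ι → ℝ) : κ → ℝ :=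
  fun k => max 0 ((W.mulVec x + b) k)

/-- The number of non-zero entries of a weight matrix and a bias vector. -/
def weightCount (W : Matrix κ ι ℝ) (b : κ → ℝ) : ℕ := (∑ k, hammingNorm (W k)) + hammingNorm b

lemma hammingNorm_comp_equiv {n : ℕ} (e : ι ≃ Fin n) (v : ι → ℝ) :
    hammingNorm (v ∘ e.symm) = hammingNorm v := by
  unfold hammingNorm
  refine Finset.card_bij (fun i _ => e.symm i) ?_ ?_ ?_
  · intro i hi; simpa using hi
  · intro i _ j _ h; simpa using h
  · intro i hi; exact ⟨e i, by simpa using hi, by simp⟩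

lemma layerParams_reindex {n m : ℕ} (e : ι ≃ Fin n) (e' : κ ≃ Fin m) (W : Matrix κ ι ℝ)
    (b : κ → ℝ) :
    NeuralNetwork.layerParams (Matrix.reindex e' e W) (b ∘ e'.symm) = weightCount W b := by
  unfold NeuralNetwork.layerParams weightCount
  rw [hammingNorm_comp_equiv]
  congr 1
  rw [← e'.sum_comp]
  refine Finset.sum_congr rfl fun k _ => ?_
  rw [← hammingNorm_comp_equiv e]
  congr 1
  ext i
  simp [Matrix.reindex_apply]

lemma reindex_mulVec_comp {n m : ℕ} (e : ι ≃ Fin n) (e' : κ ≃ Fin m) (W : Matrix κ ι ℝ)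
    (x : ι → ℝ) :
    (Matrix.reindex e' e W).mulVec (x ∘ e.symm) = W.mulVec x ∘ e'.symm := by
  ext k
  simp only [Matrix.mulVec, dotProduct, Matrix.reindex_apply, Matrix.submatrix_apply,
    Function.comp_apply]
  exact e.symm.sum_comp fun i => W (e'.symm k) i * x i

lemma NetComputes.affine (W : Matrix κ ι ℝ) (b : κ → ℝ) :
    NetComputes (fun x => W.mulVec x + b) 1 (weightCount W b) := by
  intro n m e e'
  refine ⟨.output (Matrix.reindex e' e W) (b ∘ e'.symm), fun x => ?_, rfl, ?_⟩
  · rw [NeuralNetwork.realize, reindex_mulVec_comp]; rfl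
  · rw [NeuralNetwork.numParams, layerParams_reindex]

/-- Networks are assembled from the output backwards: all later constructions take a network for the
continuation `g` and put layers in front of it. -/
lemma NetComputes.comp_reluLayer {g : (κ → ℝ) → (τ → ℝ)} {L M : ℕ} (hg : NetComputes g L M)
    (W : Matrix κ ι ℝ) (b : κ → ℝ) :
    NetComputes (g ∘ reluLayer W b) (L + 1) (weightCount W b + M) := by
  intro n m e e'
  obtain ⟨Ψ, h1, h2, h3⟩ := hg _ m (Fintype.equivFin κ) e'
  refine ⟨.hidden (Matrix.reindex (Fintype.equivFin κ) e W) (b ∘ (Fintype.equivFin κ).symm) Ψ,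
    fun x => ?_, ?_, ?_⟩
  · rw [NeuralNetwork.realize, reindex_mulVec_comp, Function.comp_apply, ← h1]
    rfl
  · rw [NeuralNetwork.depth, h2]
  · rw [NeuralNetwork.numParams, layerParams_reindex]; lia

lemma NetComputes.mono {f : (ι → ℝ) → (κ → ℝ)} {L M M' : ℕ} (hf : NetComputes f L M)
    (h : M ≤ M') : NetComputes f L M' := by
  intro n m e e'
  obtain ⟨Ψ, h1, h2, h3⟩ := hf n m e e'
  exact ⟨Ψ, h1, h2, h3.trans h⟩

lemma hammingNorm_le_card (v : ι → ℝ) : hammingNorm v ≤ Fintype.card ι := Finset.card_le_univ _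

lemma weightCount_le (W : Matrix κ ι ℝ) (b : κ → ℝ) :
    weightCount W b ≤ Fintype.card κ * (Fintype.card ι + 1) := by
  unfold weightCount
  have h1 : ∑ k, hammingNorm (W k) ≤ ∑ _k : κ, Fintype.card ι :=
    Finset.sum_le_sum fun k _ => hammingNorm_le_card _
  have h2 := hammingNorm_le_card b
  simp only [Finset.sum_const, Finset.card_univ, smul_eq_mul] at h1
  lia

/-- The matrix whose row `k` has the entries `coef k t` in the columns `idx k t`. -/
def sparseMat [DecidableEq ι] (idx : κ → τ → ι) (coef : κ → τ → ℝ) : Matrix κ ι ℝ :=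
  Matrix.of fun k i => ∑ t, if idx k t = i then coef k t else 0

lemma sparseMat_mulVec [DecidableEq ι] (idx : κ → τ → ι) (coef : κ → τ → ℝ) (x : ι → ℝ) (k : κ) :
    (sparseMat idx coef).mulVec x k = ∑ t, coef k t * x (idx k t) := by
  simp only [Matrix.mulVec, dotProduct, sparseMat, Matrix.of_apply, Finset.sum_mul]
  rw [Finset.sum_comm]
  refine Finset.sum_congr rfl fun t _ => ?_
  simp [ite_mul]

/-- The non-zero entries of row `k` lie in the image of `idx k`. This keeps the cost of a matrix
square cubic: its layers have about s³ neurons, and dense layers would cost s⁶. -/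
lemma weightCount_sparseMat_le [DecidableEq ι] (idx : κ → τ → ι) (coef : κ → τ → ℝ) (b : κ → ℝ) :
    weightCount (sparseMat idx coef) b ≤ Fintype.card κ * (Fintype.card τ + 1) := by
  unfold weightCount
  have h1 : ∑ k, hammingNorm (sparseMat idx coef k) ≤ ∑ _k : κ, Fintype.card τ := by
    refine Finset.sum_le_sum fun k _ => ?_
    unfold hammingNorm
    calc _ ≤ (Finset.univ.image (idx k)).card := by
          refine Finset.card_le_card fun i hi => ?_
          simp only [Finset.mem_univ, true_and, Finset.mem_image] at hi ⊢
          by_contra! h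
          exact (Finset.mem_filter.1 hi).2 (Finset.sum_eq_zero fun t _ => if_neg (h t))
      _ ≤ _ := Finset.card_image_le
  have h2 := hammingNorm_le_card b
  simp only [Finset.sum_const, Finset.card_univ, smul_eq_mul] at h1
  lia

end NetworkCalculus

/-! ### Approximate squaring of numbers -/

/-- The initial state of the approximate computation of `u ^ 2`. -/
def squareInit (u : ℝ) : Fin 3 → ℝ := ![max 0 u, max 0 (-u), 1]

/-- One step of the approximate computation of a square; the first two entries of the state `z` add
up to a number `y`, and the last one is an accumulator. -/
def squareStep (s : ℕ) (z : Fin 3 → ℝ) : Fin 3 → ℝ :=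
  ![max 0 (2 * z 0 + 2 * z 1 - 1), max 0 (1 - 2 * z 0 - 2 * z 1),
    max 0 ((1 / 4) ^ s * z 0 + (1 / 4) ^ s * z 1 + z 2 - (1 / 4) ^ s)]

/-- `D` steps of the approximate computation of a square. -/
def squareState : ℕ → (Fin 3 → ℝ) → (Fin 3 → ℝ)
  | 0, z => z
  | D + 1, z => squareStep D (squareState D z)

/-- The approximation of `u ^ 2` after `D` steps. -/
def approxSquare (D : ℕ) (u : ℝ) : ℝ := squareState D (squareInit u) 2

lemma max_zero_add_max_zero_neg (x : ℝ) : max 0 x + max 0 (-x) = |x| := by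
  rcases le_total 0 x with h | h
  · rw [max_eq_right h, max_eq_left (by linarith), abs_of_nonneg h, add_zero]
  · rw [max_eq_left h, max_eq_right (by linarith), abs_of_nonpos h, zero_add]

lemma max_zero_sub_max_zero_neg (x : ℝ) : max 0 x - max 0 (-x) = x := by
  rcases le_total 0 x with h | h
  · rw [max_eq_right h, max_eq_left (by linarith), sub_zero]
  · rw [max_eq_left h, max_eq_right (by linarith)]; ring

/-- The mechanism is 1 − y² = (1 − y) + (1 − |2y − 1|²) / 4. Removing 4⁻ˢ (1 − y) from the
accumulator turns its excess 4⁻ˢ (1 − y²) over u² into the same expression for s + 1 and |2y − 1|.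
The accumulator never falls below u² ≥ 0, so the ReLU leaves it unchanged. -/
lemma squareState_spec {u : ℝ} (hu : |u| ≤ 1) (D : ℕ) :
    0 ≤ squareState D (squareInit u) 0 + squareState D (squareInit u) 1 ∧
      squareState D (squareInit u) 0 + squareState D (squareInit u) 1 ≤ 1 ∧
      squareState D (squareInit u) 2 = u ^ 2 +
        (1 / 4) ^ D * (1 - (squareState D (squareInit u) 0 + squareState D (squareInit u) 1) ^ 2) := by
  induction D with
  | zero =>
    have h := max_zero_add_max_zero_neg u
    simp only [squareState, squareInit, Matrix.cons_val_zero, Matrix.cons_val_one, Matrix.cons_val]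
    rw [h, sq_abs]
    exact ⟨abs_nonneg _, hu, by ring⟩
  | succ D ih =>
    simp only [squareState]
    set z := squareState D (squareInit u)
    obtain ⟨h0, h1, h2⟩ := ih
    have hy : squareStep D z 0 + squareStep D z 1 = |2 * (z 0 + z 1) - 1| := by
      rw [← max_zero_add_max_zero_neg]
      simp only [squareStep, Matrix.cons_val_zero, Matrix.cons_val_one]
      congr 2 <;> ring
    have hp : (0 : ℝ) < (1 / 4) ^ D := by positivity
    rw [hy, sq_abs]
    refine ⟨abs_nonneg _, abs_le.2 ⟨by linarith, by linarith⟩, ?_⟩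
    have hz : (1 / 4 : ℝ) ^ D * z 0 + (1 / 4) ^ D * z 1 + z 2 - (1 / 4) ^ D =
        u ^ 2 + (1 / 4) ^ (D + 1) * (1 - (2 * (z 0 + z 1) - 1) ^ 2) := by
      rw [h2]; ring
    simp only [squareStep, Matrix.cons_val]
    rw [hz, max_eq_right]
    have : 0 ≤ 1 - (2 * (z 0 + z 1) - 1) ^ 2 := by nlinarith
    positivity

lemma approxSquare_mem {u : ℝ} (hu : |u| ≤ 1) (D : ℕ) :
    u ^ 2 ≤ approxSquare D u ∧ approxSquare D u ≤ u ^ 2 + (1 / 4) ^ D := by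
  obtain ⟨h0, h1, h2⟩ := squareState_spec hu D
  have hp : (0 : ℝ) < (1 / 4) ^ D := by positivity
  unfold approxSquare
  rw [h2]
  set y := squareState D (squareInit u) 0 + squareState D (squareInit u) 1
  have hy : y ^ 2 ≤ 1 := by nlinarith
  constructor <;> nlinarith [sq_nonneg y]

/-- The approximation of a product of two numbers in `[-4, 4]`. -/
def approxMul (D : ℕ) (x y : ℝ) : ℝ :=
  16 * (approxSquare D ((x + y) / 8) - approxSquare D ((x - y) / 8))

/-- Both squares are approximated from above, so in the difference their errors do not add up.
Division by 8 brings x ± y into [−1, 1], and 16 = 8² / 4. -/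
lemma approxMul_error {x y : ℝ} (hx : |x| ≤ 4) (hy : |y| ≤ 4) (D : ℕ) :
    |approxMul D x y - x * y| ≤ 16 * (1 / 4) ^ D := by
  rw [abs_le] at hx hy
  have h1 : |(x + y) / 8| ≤ 1 := abs_le.2 ⟨by linarith, by linarith⟩
  have h2 : |(x - y) / 8| ≤ 1 := abs_le.2 ⟨by linarith, by linarith⟩
  have h3 := approxSquare_mem h1 D
  have h4 := approxSquare_mem h2 D
  have h5 : x * y = 16 * (((x + y) / 8) ^ 2 - ((x - y) / 8) ^ 2) := by ring
  rw [h5, abs_le]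
  unfold approxMul
  constructor <;> linarith [h3.1, h3.2, h4.1, h4.2]

/-! ### Networks that square matrices -/

section MatrixSquaring

variable {ι κ τ : Type} [Fintype ι] [Fintype κ] [Fintype τ]
  [DecidableEq ι] [DecidableEq κ] [DecidableEq τ]

/-- The approximate square of a matrix. -/
def approxMatSq (D : ℕ) (T : Matrix ι ι ℝ) : Matrix ι ι ℝ :=
  Matrix.of fun i l => ∑ j, approxMul D (T i j) (T j l)

lemma approxMatSq_error {T : Matrix ι ι ℝ} (hT : ∀ i j, |T i j| ≤ 4) (D : ℕ) (i l : ι) :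
    |approxMatSq D T i l - (T * T) i l| ≤ Fintype.card ι * (16 * (1 / 4) ^ D) := by
  rw [Matrix.mul_apply, approxMatSq, Matrix.of_apply, ← Finset.sum_sub_distrib]
  refine (Finset.abs_sum_le_sum_abs _ _).trans ?_
  refine (Finset.sum_le_sum fun j _ => approxMul_error (hT i j) (hT j l) D).trans ?_
  simp

/-- The sign `1` or `-1`. -/
def boolSign (b : Bool) : ℝ := if b then 1 else -1

/-- The positive and negative parts of the entries of a matrix. -/
def encodeMat (T : Matrix ι ι ℝ) : (ι × ι) × Bool → ℝ :=
  fun k => max 0 (boolSign k.2 * T k.1.1 k.1.2)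

lemma encodeMat_sub (T : Matrix ι ι ℝ) (i j : ι) :
    encodeMat T ((i, j), true) - encodeMat T ((i, j), false) = T i j := by
  simpa [encodeMat, boolSign] using max_zero_sub_max_zero_neg (T i j)

/-- A step of the approximate squaring of many numbers. -/
def squareStepMat (s : ℕ) : Matrix (κ × Fin 3) (κ × Fin 3) ℝ :=
  sparseMat (τ := Fin 3) (fun k c => (k.1, c)) fun k => ![![2, 2, 0], ![-2, -2, 0],
    ![(1 / 4) ^ s, (1 / 4) ^ s, 1]] k.2

/-- The bias of a step of the approximate squaring of many numbers. -/
def squareStepBias (s : ℕ) : κ × Fin 3 → ℝ := fun k => ![-1, 1, -(1 / 4) ^ s] k.2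

lemma reluLayer_squareStep (s : ℕ) (Z : κ → Fin 3 → ℝ) :
    reluLayer (squareStepMat s) (squareStepBias s) (fun k : κ × Fin 3 => Z k.1 k.2) =
      fun k => squareStep s (Z k.1) k.2 := by
  ext ⟨k, c⟩
  simp only [reluLayer, Pi.add_apply, squareStepMat, sparseMat_mulVec, squareStepBias,
    squareStep, Fin.sum_univ_three]
  fin_cases c
  · simp; congr 1
  · simp; congr 1; ring
  · simp; congr 1

lemma NetComputes.comp_squareState {g : (κ × Fin 3 → ℝ) → (τ → ℝ)} {L M : ℕ}
    (hg : NetComputes g L M) (D : ℕ) :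
    ∃ f : (κ × Fin 3 → ℝ) → (τ → ℝ), NetComputes f (L + D) (Fintype.card κ * 12 * D + M) ∧
      ∀ Z : κ → Fin 3 → ℝ, f (fun k => Z k.1 k.2) = g fun k => squareState D (Z k.1) k.2 := by
  induction D generalizing g L M with
  | zero => exact ⟨g, by simpa using hg, fun Z => rfl⟩
  | succ D ih =>
    obtain ⟨f, hf, hf'⟩ := ih (hg.comp_reluLayer (squareStepMat D) (squareStepBias D))
    refine ⟨f, ?_, fun Z => ?_⟩
    · rw [show L + (D + 1) = L + 1 + D by ring]
      refine hf.mono ?_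
      have := weightCount_sparseMat_le (τ := Fin 3) (fun (k : κ × Fin 3) c => (k.1, c))
        (fun k => ![![2, 2, 0], ![-2, -2, 0], ![(1 / 4) ^ D, (1 / 4) ^ D, 1]] k.2)
        (squareStepBias D)
      simp only [Fintype.card_prod, Fintype.card_fin] at this
      unfold squareStepMat
      lia
    · rw [hf' Z, Function.comp_apply, reluLayer_squareStep D fun k => squareState D (Z k)]
      rfl

/-- The weights that prepare the scalar multiplications of a matrix square. -/
def mulInMat : Matrix (((ι × ι × ι) × Bool) × Fin 3) ((ι × ι) × Bool) ℝ :=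
  sparseMat (τ := Bool × Bool)
    (fun k t => (if t.1 then (k.1.1.1, k.1.1.2.1) else (k.1.1.2.1, k.1.1.2.2), t.2))
    fun k t => ![1, -1, 0] k.2 * ((if t.1 then 1 else boolSign k.1.2) * boolSign t.2 / 8)

/-- The bias that prepares the scalar multiplications of a matrix square. -/
def mulInBias : ((ι × ι × ι) × Bool) × Fin 3 → ℝ := fun k => ![0, 0, 1] k.2

/-- Each triple `(i, j, l)` prepares two squarings, of (T i j ± T j l) / 8, the sign being the
Boolean index. The bias starts the accumulators at 1. -/
lemma reluLayer_mulIn (T : Matrix ι ι ℝ) :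
    reluLayer mulInMat mulInBias (encodeMat T) = fun k => squareInit
      ((T k.1.1.1 k.1.1.2.1 + boolSign k.1.2 * T k.1.1.2.1 k.1.1.2.2) / 8) k.2 := by
  ext ⟨⟨⟨i, j, l⟩, s⟩, c⟩
  simp only [reluLayer, Pi.add_apply, mulInMat, sparseMat_mulVec, mulInBias, squareInit,
    Fintype.sum_prod_type, Fintype.univ_bool, Finset.mem_singleton, Bool.true_eq_false,
    not_false_eq_true, Finset.sum_insert, Finset.sum_singleton, if_true, Bool.false_eq_true,
    if_false]
  rw [← encodeMat_sub T i j, ← encodeMat_sub T j l]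
  fin_cases c
  · cases s <;> simp [boolSign] <;> congr 1 <;> ring
  · cases s <;> simp [boolSign] <;> congr 1 <;> ring
  · simp

/-- The weights that sum up the products for a matrix square. -/
def mulOutMat : Matrix ((ι × ι) × Bool) (((ι × ι × ι) × Bool) × Fin 3) ℝ :=
  sparseMat (τ := ι × Bool) (fun k t => (((k.1.1, t.1, k.1.2), t.2), 2))
    fun k t => boolSign k.2 * (16 * boolSign t.2)

lemma reluLayer_mulOut (D : ℕ) (T : Matrix ι ι ℝ) :
    reluLayer mulOutMat 0 (fun k : ((ι × ι × ι) × Bool) × Fin 3 => squareState D (squareInit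
      ((T k.1.1.1 k.1.1.2.1 + boolSign k.1.2 * T k.1.1.2.1 k.1.1.2.2) / 8)) k.2) =
      encodeMat (approxMatSq D T) := by
  ext ⟨⟨i, l⟩, b⟩
  simp only [reluLayer, Pi.add_apply, mulOutMat, sparseMat_mulVec, encodeMat, approxMatSq,
    Fintype.sum_prod_type, Fintype.univ_bool, Finset.mem_singleton, Bool.true_eq_false,
    not_false_eq_true, Finset.sum_insert, Finset.sum_singleton, Pi.zero_apply, add_zero,
    Matrix.of_apply, Finset.mul_sum]
  congr 1
  refine Finset.sum_congr rfl fun j _ => ?_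
  simp only [approxMul, approxSquare, boolSign, if_true, Bool.false_eq_true, if_false, one_mul,
    neg_one_mul, ← sub_eq_add_neg]
  ring

/-- With s = card ι there are 2 s³ numbers to square, each with 12 weights per step, which gives 24
D s³. The first layer costs 30 s³ and the last one at most 6 s³. -/
lemma NetComputes.comp_approxMatSq {g : ((ι × ι) × Bool → ℝ) → (τ → ℝ)} {L M : ℕ}
    (hg : NetComputes g L M) (D : ℕ) :
    ∃ f : ((ι × ι) × Bool → ℝ) → (τ → ℝ),
      NetComputes f (L + (D + 2)) (Fintype.card ι ^ 3 * (24 * D + 38) + M) ∧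
      ∀ T : Matrix ι ι ℝ, f (encodeMat T) = g (encodeMat (approxMatSq D T)) := by
  obtain ⟨f, hf, hf'⟩ := (hg.comp_reluLayer mulOutMat 0).comp_squareState D
  refine ⟨f ∘ reluLayer mulInMat mulInBias, ?_, fun T => ?_⟩
  · rw [show L + (D + 2) = L + 1 + D + 1 by ring]
    refine (hf.comp_reluLayer mulInMat mulInBias).mono ?_
    have h1 : weightCount (mulInMat (ι := ι)) mulInBias ≤ _ := weightCount_sparseMat_le _ _ _
    have h2 : weightCount (mulOutMat (ι := ι)) 0 ≤ _ := weightCount_sparseMat_le _ _ _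
    simp only [Fintype.card_prod, Fintype.card_fin, Fintype.card_bool] at h1 h2 ⊢
    set s := Fintype.card ι
    have h3 : s * s ≤ s * (s * s) := by
      rcases Nat.eq_zero_or_pos s with h | h
      · simp [h]
      · exact Nat.le_mul_of_pos_left _ h
    nlinarith
  · rw [Function.comp_apply, reluLayer_mulIn, ← reluLayer_mulOut]
    exact hf' fun k => squareInit
      ((T k.1.1 k.1.2.1 + boolSign k.2 * T k.1.2.1 k.1.2.2) / 8)

lemma NetComputes.comp_iterate_approxMatSq {g : ((ι × ι) × Bool → ℝ) → (τ → ℝ)} {L M : ℕ}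
    (hg : NetComputes g L M) (D t : ℕ) :
    ∃ f : ((ι × ι) × Bool → ℝ) → (τ → ℝ),
      NetComputes f (L + t * (D + 2)) (t * (Fintype.card ι ^ 3 * (24 * D + 38)) + M) ∧
      ∀ T : Matrix ι ι ℝ, f (encodeMat T) = g (encodeMat ((approxMatSq D)^[t] T)) := by
  induction t with
  | zero => exact ⟨g, by simpa using hg, fun T => rfl⟩
  | succ t ih =>
    obtain ⟨f, hf, hf'⟩ := ih
    obtain ⟨f₁, h1, h2⟩ := hf.comp_approxMatSq D
    refine ⟨f₁, ?_, fun T => ?_⟩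
    · rw [show L + (t + 1) * (D + 2) = L + t * (D + 2) + (D + 2) by ring]
      exact h1.mono (by lia)
    · rw [h2, hf', Function.iterate_succ_apply]

/-- A network that evaluates scaled entries of an iterated approximate square of a matrix which
depends on the input in an affine way. -/
lemma netComputes_iterate_approxMatSq {μ : Type} [Fintype μ] [DecidableEq μ]
    (W : Matrix (ι × ι) μ ℝ) (b : ι × ι → ℝ) (c : ℝ) (pos : κ → ι × ι) (D t : ℕ) :
    NetComputes (fun (a : μ → ℝ) k => c *
        (approxMatSq D)^[t] (Matrix.of fun i j => (W.mulVec a + b) (i, j)) (pos k).1 (pos k).2)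
      (t * (D + 2) + 2)
      (Fintype.card ι ^ 2 * 2 * (Fintype.card μ + 1) +
        (t * (Fintype.card ι ^ 3 * (24 * D + 38)) + Fintype.card κ * 3)) := by
  obtain ⟨f, hf, hf'⟩ := (NetComputes.affine (sparseMat (τ := Bool)
    (fun (k : κ) s => (pos k, s)) fun _ s => c * boolSign s) 0).comp_iterate_approxMatSq D t
  have hc := weightCount_sparseMat_le (τ := Bool) (fun (k : κ) s => (pos k, s))
    (fun _ s => c * boolSign s) 0
  have key := hf.comp_reluLayer (Matrix.of fun (k : (ι × ι) × Bool) x => boolSign k.2 * W k.1 x)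
    fun k => boolSign k.2 * b k.1
  have hd := weightCount_le (Matrix.of fun (k : (ι × ι) × Bool) x => boolSign k.2 * W k.1 x)
    fun k => boolSign k.2 * b k.1
  have hL : t * (D + 2) + 2 = 1 + t * (D + 2) + 1 := by ring
  rw [hL]
  simp only [Fintype.card_prod, Fintype.card_bool] at hc hd
  convert key.mono (M' := Fintype.card ι ^ 2 * 2 * (Fintype.card μ + 1) +
        (t * (Fintype.card ι ^ 3 * (24 * D + 38)) + Fintype.card κ * 3)) (by
      rw [sq]; lia) using 1
  ext a k
  have henc : reluLayer (Matrix.of fun (k : (ι × ι) × Bool) x => boolSign k.2 * W k.1 x)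
      (fun k => boolSign k.2 * b k.1) a =
      encodeMat (Matrix.of fun i j => (W.mulVec a + b) (i, j)) := by
    ext ⟨⟨i, j⟩, s⟩
    simp only [reluLayer, encodeMat, Pi.add_apply, Matrix.mulVec, dotProduct, Matrix.of_apply,
      mul_add, Finset.mul_sum, mul_assoc]
  rw [Function.comp_apply, henc, hf']
  have hsub := encodeMat_sub
    ((approxMatSq D)^[t] (Matrix.of fun i j => (W.mulVec a + b) (i, j))) (pos k).1 (pos k).2
  generalize (approxMatSq D)^[t] (Matrix.of fun i j => (W.mulVec a + b) (i, j)) = T at hsub ⊢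
  simp only [Pi.add_apply, sparseMat_mulVec, Fintype.univ_bool, Finset.mem_singleton,
    Bool.true_eq_false, not_false_eq_true, Finset.sum_insert, Finset.sum_singleton,
    Pi.zero_apply, add_zero, boolSign, if_true, Bool.false_eq_true, if_false]
  linear_combination (-c) * hsub

end MatrixSquaring

/-! ### The spectral norm -/

section SpecNorm

open scoped Matrix.Norms.L2Operator

variable {m n l : Type} [Fintype m] [Fintype n] [Fintype l] [DecidableEq m] [DecidableEq n]
  [DecidableEq l]

lemma norm_toLp_sq (v : n → ℝ) : ‖WithLp.toLp 2 v‖ ^ 2 = v ⬝ᵥ v := by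
  rw [EuclideanSpace.real_norm_sq_eq]
  simp [dotProduct, sq]

lemma dotProduct_self_nonneg' (v : n → ℝ) : 0 ≤ v ⬝ᵥ v := by
  rw [← norm_toLp_sq]; positivity

lemma dotProduct_self_pos {v : n → ℝ} (hv : v ≠ 0) : 0 < v ⬝ᵥ v :=
  lt_of_le_of_ne (dotProduct_self_nonneg' v) fun h => hv (dotProduct_self_eq_zero.1 h.symm)

lemma dotProduct_mul_dotProduct_le (u v : n → ℝ) : (u ⬝ᵥ v) ^ 2 ≤ (u ⬝ᵥ u) * (v ⬝ᵥ v) := by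
  simpa [dotProduct, sq] using Finset.sum_mul_sq_le_sq_mul_sq Finset.univ u v

lemma specNorm_nonneg (M : Matrix m n ℝ) : 0 ≤ specNorm M := norm_nonneg M

lemma specNorm_add_le (M M' : Matrix m n ℝ) : specNorm (M + M') ≤ specNorm M + specNorm M' :=
  norm_add_le M M'

lemma dotProduct_mulVec_self_le (M : Matrix m n ℝ) (v : n → ℝ) :
    M.mulVec v ⬝ᵥ M.mulVec v ≤ specNorm M ^ 2 * (v ⬝ᵥ v) := by
  have h := Matrix.l2_opNorm_mulVec M (WithLp.toLp 2 v)
  rw [← norm_toLp_sq, ← norm_toLp_sq, ← mul_pow]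
  exact pow_le_pow_left₀ (norm_nonneg _) h 2

lemma specNorm_le_of_forall {M : Matrix m n ℝ} {c : ℝ} (hc : 0 ≤ c)
    (h : ∀ v, M.mulVec v ⬝ᵥ M.mulVec v ≤ c ^ 2 * (v ⬝ᵥ v)) : specNorm M ≤ c := by
  unfold specNorm
  rw [Matrix.l2_opNorm_def]
  refine ContinuousLinearMap.opNorm_le_bound _ hc fun v => ?_
  refine le_of_sq_le_sq ?_ (by positivity)
  rw [mul_pow]
  have := h v.ofLp
  rw [← norm_toLp_sq, ← norm_toLp_sq] at this
  exact this

lemma specNorm_le_of_entry_le {M : Matrix m n ℝ} {c : ℝ} (hc : 0 ≤ c) (h : ∀ i j, |M i j| ≤ c)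
    {s : ℝ} (hm : Fintype.card m ≤ s) (hn : Fintype.card n ≤ s) : specNorm M ≤ s * c := by
  have hs : 0 ≤ s := (Nat.cast_nonneg _).trans hm
  refine specNorm_le_of_forall (by positivity) fun v => ?_
  have hrow : ∀ i, M.mulVec v i * M.mulVec v i ≤ s * c ^ 2 * (v ⬝ᵥ v) := fun i => by
    have h1 : (M.mulVec v i) ^ 2 ≤ (M i ⬝ᵥ M i) * (v ⬝ᵥ v) := dotProduct_mul_dotProduct_le (M i) v
    have h2 : M i ⬝ᵥ M i ≤ s * c ^ 2 := by
      calc M i ⬝ᵥ M i ≤ ∑ _j : n, c ^ 2 := Finset.sum_le_sum fun j _ => by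
            have := pow_le_pow_left₀ (abs_nonneg _) (h i j) 2
            rw [sq_abs] at this; linarith [sq (M i j)]
        _ = Fintype.card n * c ^ 2 := by simp
        _ ≤ _ := by gcongr
    have h3 := dotProduct_self_nonneg' v
    nlinarith [mul_le_mul_of_nonneg_right h2 h3]
  calc M.mulVec v ⬝ᵥ M.mulVec v ≤ ∑ _i : m, s * c ^ 2 * (v ⬝ᵥ v) :=
        Finset.sum_le_sum fun i _ => hrow i
    _ = Fintype.card m * (s * c ^ 2 * (v ⬝ᵥ v)) := by simp
    _ ≤ s * (s * c ^ 2 * (v ⬝ᵥ v)) := by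
        have := dotProduct_self_nonneg' v
        gcongr
    _ = _ := by ring

lemma abs_entry_le_specNorm (M : Matrix m n ℝ) (i : m) (j : n) : |M i j| ≤ specNorm M := by
  refine abs_le_of_sq_le_sq ?_ (specNorm_nonneg M)
  have h := dotProduct_mulVec_self_le M (Pi.single j 1)
  simp only [Matrix.mulVec_single_one, dotProduct_single, Pi.single_eq_same, mul_one] at h
  refine le_trans ?_ h
  rw [sq]
  exact Finset.single_le_sum (f := fun i => M.col j i * M.col j i)
    (fun i _ => mul_self_nonneg _) (Finset.mem_univ i)

lemma specNorm_transpose (M : Matrix m n ℝ) : specNorm M.transpose = specNorm M := by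
  rw [← Matrix.conjTranspose_eq_transpose_of_trivial]
  exact Matrix.l2_opNorm_conjTranspose M

/-- The Cauchy–Schwarz inequality for a positive semidefinite symmetric matrix. -/
lemma bilin_sq_le {E : Matrix n n ℝ} (hs : E.IsSymm) (h0 : ∀ v, 0 ≤ v ⬝ᵥ E.mulVec v)
    (u v : n → ℝ) :
    (u ⬝ᵥ E.mulVec v) ^ 2 ≤ (u ⬝ᵥ E.mulVec u) * (v ⬝ᵥ E.mulVec v) := by
  have hsym : v ⬝ᵥ E.mulVec u = u ⬝ᵥ E.mulVec v := by
    rw [Matrix.dotProduct_mulVec, ← Matrix.mulVec_transpose, hs.eq, dotProduct_comm]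
  have key : ∀ t : ℝ, 0 ≤ (v ⬝ᵥ E.mulVec v) * (t * t) + 2 * (u ⬝ᵥ E.mulVec v) * t +
      u ⬝ᵥ E.mulVec u := fun t => by
    have := h0 (u + t • v)
    simp only [Matrix.mulVec_add, Matrix.mulVec_smul, dotProduct_add, add_dotProduct,
      smul_dotProduct, dotProduct_smul, hsym, smul_eq_mul] at this
    linarith
  have := discrim_le_zero key
  unfold discrim at this
  nlinarith

/-- With w = E v, the Cauchy–Schwarz inequality for the form E gives |w|⁴ ≤ c |w|² · c |v|². -/
lemma specNorm_le_of_bilin_le {E : Matrix n n ℝ} {c : ℝ} (hc : 0 ≤ c) (hs : E.IsSymm)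
    (h0 : ∀ v, 0 ≤ v ⬝ᵥ E.mulVec v) (h1 : ∀ v, v ⬝ᵥ E.mulVec v ≤ c * (v ⬝ᵥ v)) :
    specNorm E ≤ c := by
  refine specNorm_le_of_forall hc fun v => ?_
  set w := E.mulVec v with hw
  have h := bilin_sq_le hs h0 w v
  rw [← hw] at h
  have h2 := h1 w
  have h3 := h1 v
  rw [← hw] at h3
  have hw0 := dotProduct_self_nonneg' w
  have hv0 := dotProduct_self_nonneg' v
  have h4 : (w ⬝ᵥ w) ^ 2 ≤ (c * (w ⬝ᵥ w)) * (c * (v ⬝ᵥ v)) :=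
    h.trans (mul_le_mul h2 h3 (h0 v) (by positivity))
  rcases hw0.eq_or_lt with h5 | h5
  · rw [← h5]; positivity
  · have : (w ⬝ᵥ w) * (w ⬝ᵥ w) ≤ (w ⬝ᵥ w) * (c ^ 2 * (v ⬝ᵥ v)) := by nlinarith
    exact le_of_mul_le_mul_left this h5

lemma specNorm_pow_le (E : Matrix n n ℝ) {c : ℝ} (h : specNorm E ≤ c) (v : n → ℝ) (k : ℕ) :
    (E ^ k).mulVec v ⬝ᵥ (E ^ k).mulVec v ≤ (c ^ k) ^ 2 * (v ⬝ᵥ v) := by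
  have hc : 0 ≤ c := (specNorm_nonneg E).trans h
  have hv := dotProduct_self_nonneg' v
  induction k with
  | zero => simp
  | succ k ih =>
    rw [pow_succ', ← Matrix.mulVec_mulVec]
    refine (dotProduct_mulVec_self_le _ _).trans ?_
    calc specNorm E ^ 2 * _ ≤ c ^ 2 * ((c ^ k) ^ 2 * (v ⬝ᵥ v)) := by
          refine mul_le_mul (pow_le_pow_left₀ (specNorm_nonneg E) h 2) ih
            (dotProduct_self_nonneg' _) (by positivity)
      _ = _ := by ring

end SpecNorm

/-! ### Iterated approximate squaring -/

section IteratedSquaring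

open scoped Matrix.Norms.L2Operator

variable {ι : Type} [Fintype ι] [DecidableEq ι]

lemma one_add_inv_two_pow_pow_le {t k : ℕ} (hk : k ≤ t) :
    (1 + (1 / 2 : ℝ) ^ t) ^ (2 ^ k) ≤ 3 := by
  have h0 : (0 : ℝ) ≤ (1 / 2) ^ t := by positivity
  calc (1 + (1 / 2 : ℝ) ^ t) ^ (2 ^ k) ≤ (1 + (1 / 2 : ℝ) ^ t) ^ (2 ^ t) :=
        pow_le_pow_right₀ (by linarith) (Nat.pow_le_pow_right (by norm_num) hk)
    _ ≤ (Real.exp ((1 / 2) ^ t)) ^ (2 ^ t) := by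
        gcongr
        linarith [Real.add_one_le_exp ((1 / 2 : ℝ) ^ t)]
    _ = Real.exp 1 := by
        rw [← Real.exp_nat_mul]
        congr 1
        push_cast
        rw [← mul_pow]; norm_num
    _ ≤ 3 := by linarith [Real.exp_one_lt_d9]

/-- Let S be the iterate and P the exact power, ‖P‖ ≤ 3. If ‖S − P‖ ≤ 1, then ‖S‖ ≤ 4, so the
entries stay in the range of `approxMul`. From S² − P² = (S − P) S + P (S − P) the error grows by a
factor 7, and the inexact products add at most μ, which makes the factor 8. -/
lemma iterate_approxMatSq_error {T : Matrix ι ι ℝ} {t D : ℕ} {s : ℝ}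
    (hs : Fintype.card ι ≤ s)
    (hT : specNorm T ≤ 1 + (1 / 2) ^ t) (hμ : 8 ^ t * (s ^ 2 * (16 * (1 / 4) ^ D)) ≤ 1)
    {k : ℕ} (hk : k ≤ t) :
    specNorm ((approxMatSq D)^[k] T - T ^ 2 ^ k) ≤ 8 ^ k * (s ^ 2 * (16 * (1 / 4) ^ D)) := by
  have hs0 : 0 ≤ s := (Nat.cast_nonneg _).trans hs
  set μ := s ^ 2 * (16 * (1 / 4) ^ D) with hμdef
  have hμ0 : 0 ≤ μ := by positivity
  unfold specNorm at *
  have hpow : ∀ j ≤ t, ‖T ^ 2 ^ j‖ ≤ 3 := fun j hj => by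
    refine le_trans ?_ (one_add_inv_two_pow_pow_le hj)
    exact (norm_pow_le' T (by positivity)).trans (pow_le_pow_left₀ (norm_nonneg _) hT _)
  induction k with
  | zero => simpa using hμ0
  | succ k ih =>
    have ihk := ih (by lia)
    have hTk := hpow k (by lia)
    rw [Function.iterate_succ_apply']
    set S := (approxMatSq D)^[k] T
    set P := T ^ 2 ^ k
    have h8 : (8 : ℝ) ^ k * μ ≤ 1 := by
      refine le_trans ?_ hμ
      gcongr <;> [norm_num; lia]
    have hS : ‖S‖ ≤ 4 := by
      have : S = P + (S - P) := by abel
      rw [this]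
      refine (norm_add_le _ _).trans ?_
      linarith
    have hent : ∀ i j, |S i j| ≤ 4 := fun i j => (abs_entry_le_specNorm S i j).trans hS
    have h1 : ‖approxMatSq D S - S * S‖ ≤ μ := by
      have := specNorm_le_of_entry_le (M := approxMatSq D S - S * S) (c := s * (16 * (1 / 4) ^ D))
        (by positivity) (fun i j => by
          rw [Matrix.sub_apply]
          refine (approxMatSq_error hent D i j).trans ?_
          gcongr) hs hs
      rw [hμdef, sq, mul_assoc]
      exact this
    have h2 : ‖S * S - P * P‖ ≤ 7 * (8 ^ k * μ) := by
      have : S * S - P * P = (S - P) * S + P * (S - P) := by noncomm_ring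
      rw [this]
      refine (norm_add_le _ _).trans ?_
      have a1 := norm_mul_le (S - P) S
      have a2 := norm_mul_le P (S - P)
      nlinarith [norm_nonneg (S - P), norm_nonneg S, norm_nonneg P]
    have h3 : T ^ 2 ^ (k + 1) = P * P := by
      rw [pow_succ, pow_mul, sq]
    rw [h3]
    have : approxMatSq D S - P * P = (approxMatSq D S - S * S) + (S * S - P * P) := by abel
    rw [this]
    refine (norm_add_le _ _).trans ?_
    have : (1 : ℝ) ≤ 8 ^ k := one_le_pow₀ (by norm_num)
    have : (8 : ℝ) ^ (k + 1) * μ = 8 * (8 ^ k * μ) := by ring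
    nlinarith

end IteratedSquaring

/-! ### A matrix whose powers contain Neumann series -/

section Augmented

variable {N n J : Type} [Fintype N] [Fintype n] [Fintype J] [DecidableEq N] [DecidableEq n]
  [DecidableEq J]

/-- A block matrix whose `k`-th power contains the block `D + B (1 + E + ⋯ + E ^ (k - 2)) C`. -/
def augmented (B : Matrix N n ℝ) (D : Matrix N J ℝ) (E : Matrix n n ℝ) (C : Matrix n J ℝ) :
    Matrix (N ⊕ (n ⊕ J)) (N ⊕ (n ⊕ J)) ℝ :=
  Matrix.fromBlocks 0 (Matrix.fromCols B D) 0 (Matrix.fromBlocks E C 0 1)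

lemma augmented_mulVec (B : Matrix N n ℝ) (D : Matrix N J ℝ) (E : Matrix n n ℝ)
    (C : Matrix n J ℝ) (u : N → ℝ) (v : n → ℝ) (w : J → ℝ) :
    (augmented B D E C).mulVec (Sum.elim u (Sum.elim v w)) =
      Sum.elim (B.mulVec v + D.mulVec w) (Sum.elim (E.mulVec v + C.mulVec w) w) := by
  simp [augmented, Matrix.fromBlocks_mulVec, Matrix.fromCols_mulVec]

/-- Follow the unit vector `j` of the last block. Column `j` of C is x − E x, so the partial sums of
the Neumann series telescope to x − E ^ k x. The top block lags one step behind the middle one,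
whence the exponents `k + 1` and `k`. -/
lemma augmented_pow_apply {B : Matrix N n ℝ} {D : Matrix N J ℝ} {E : Matrix n n ℝ}
    {C : Matrix n J ℝ} {j : J} {x : n → ℝ} (hx : x = E.mulVec x + C.col j) (k : ℕ) (i : N) :
    (augmented B D E C ^ (k + 1)) (.inl i) (.inr (.inr j)) =
      D i j + B.mulVec x i - B.mulVec ((E ^ k).mulVec x) i := by
  have key : ∀ k : ℕ, (augmented B D E C ^ (k + 1)).mulVec
      (Sum.elim 0 (Sum.elim 0 (Pi.single j 1))) =
      Sum.elim (D.col j + B.mulVec x - B.mulVec ((E ^ k).mulVec x))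
        (Sum.elim (x - (E ^ (k + 1)).mulVec x) (Pi.single j 1)) := by
    intro k
    have hC : C.col j = x - E.mulVec x := eq_sub_of_add_eq' hx.symm
    induction k with
    | zero =>
      rw [zero_add, pow_one, augmented_mulVec]
      simp [hC]
    | succ k ih =>
      rw [pow_succ', ← Matrix.mulVec_mulVec, ih, augmented_mulVec]
      congr 1
      · simp only [Matrix.mulVec_sub, Matrix.mulVec_single_one]
        abel
      · congr 1
        rw [pow_succ' E (k + 1), ← Matrix.mulVec_mulVec, Matrix.mulVec_sub,
          Matrix.mulVec_single_one, hC]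
        abel
  have := congrFun (key k) (.inl i)
  have hs : (Sum.elim 0 (Sum.elim 0 (Pi.single j 1)) : N ⊕ (n ⊕ J) → ℝ) =
      Pi.single (.inr (.inr j)) 1 := by
    ext (a | a | a) <;> simp [Pi.single_apply]
  rw [hs, Matrix.mulVec_single_one] at this
  simpa using this

/-- The block diagonal part diag(0, E, 1) has norm at most one; the other blocks form a perturbation
with small entries. -/
lemma specNorm_augmented_le {B : Matrix N n ℝ} {D : Matrix N J ℝ} {E : Matrix n n ℝ}
    {C : Matrix n J ℝ} (hs : E.IsSymm) (h0 : ∀ v, 0 ≤ v ⬝ᵥ E.mulVec v)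
    (h1 : ∀ v, v ⬝ᵥ E.mulVec v ≤ v ⬝ᵥ v) {c s : ℝ} (hc : 0 ≤ c) (hB : ∀ i j, |B i j| ≤ c)
    (hD : ∀ i j, |D i j| ≤ c) (hC : ∀ i j, |C i j| ≤ c)
    (hcard : Fintype.card (N ⊕ (n ⊕ J)) ≤ s) :
    specNorm (augmented B D E C) ≤ 1 + s * c := by
  have hsplit : augmented B D E C = augmented 0 0 E 0 +
      Matrix.fromBlocks 0 (Matrix.fromCols B D) 0 (Matrix.fromBlocks 0 C 0 0) := by
    unfold augmented
    rw [Matrix.fromBlocks_add, Matrix.fromBlocks_add]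
    simp
  rw [hsplit]
  refine (specNorm_add_le _ _).trans (add_le_add ?_ ?_)
  · refine specNorm_le_of_bilin_le zero_le_one ?_ ?_ ?_
    · unfold augmented
      refine Matrix.IsSymm.fromBlocks Matrix.isSymm_zero (by simp) ?_
      exact Matrix.IsSymm.fromBlocks hs (by simp) Matrix.isSymm_one
    all_goals
      intro v
      obtain ⟨u, v, w, rfl⟩ : ∃ a b c, v = Sum.elim a (Sum.elim b c) :=
        ⟨v ∘ .inl, v ∘ .inr ∘ .inl, v ∘ .inr ∘ .inr, by ext (a | a | a) <;> rfl⟩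
      rw [augmented_mulVec]
      simp only [Matrix.zero_mulVec, add_zero, sumElim_dotProduct_sumElim, dotProduct_zero]
      have a1 := h0 v
      have a2 := h1 v
      have a3 := dotProduct_self_nonneg' u
      have a4 := dotProduct_self_nonneg' w
      linarith
  · refine specNorm_le_of_entry_le hc ?_ hcard hcard
    rintro (i | i | i) (j | j | j) <;> simp [hc, hB, hC, hD]

end Augmented

/-! ### Hat functions -/

section Hats

variable {d : ℕ}

/-- The hat function on the real line. -/
def tent (t : ℝ) : ℝ := max 0 (1 - |t|)

lemma tent_nonneg (t : ℝ) : 0 ≤ tent t := le_max_left _ _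

lemma tent_le_one (t : ℝ) : tent t ≤ 1 := max_le zero_le_one (by linarith [abs_nonneg t])

lemma tent_of_abs_le {t : ℝ} (h : |t| ≤ 1) : tent t = 1 - |t| := max_eq_right (by linarith)

lemma tent_of_one_le_abs {t : ℝ} (h : 1 ≤ |t|) : tent t = 0 := max_eq_left (by linarith)

lemma tent_neg (t : ℝ) : tent (-t) = tent t := by simp [tent]

lemma tent_pos_iff {t : ℝ} : 0 < tent t ↔ |t| < 1 := by
  unfold tent; rw [lt_max_iff]; constructor
  · rintro (h | h) <;> linarith
  · intro h; right; linarith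

lemma tent_lipschitz (s t : ℝ) : |tent s - tent t| ≤ |s - t| := by
  unfold tent
  refine (abs_max_sub_max_le_max _ _ _ _).trans ?_
  refine max_le (by simp) ?_
  rw [show 1 - |s| - (1 - |t|) = |t| - |s| by ring, abs_sub_comm s t]
  exact abs_abs_sub_abs_le_abs_sub t s

@[fun_prop]
lemma continuous_tent : Continuous tent := by unfold tent; fun_prop

/-- The hat function around the origin for a mesh of size one. -/
def refHat (u : Fin d → ℝ) : ℝ := ∏ i, tent (u i)

lemma abs_prod_sub_prod_le {ι : Type} (s : Finset ι) (f g : ι → ℝ)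
    (hf : ∀ i, |f i| ≤ 1) (hg : ∀ i, |g i| ≤ 1) :
    |∏ i ∈ s, f i - ∏ i ∈ s, g i| ≤ ∑ i ∈ s, |f i - g i| := by
  classical
  induction s using Finset.induction_on with
  | empty => simp
  | insert a s ha ih =>
    rw [Finset.prod_insert ha, Finset.prod_insert ha, Finset.sum_insert ha]
    have h1 : |∏ i ∈ s, g i| ≤ 1 := by
      rw [Finset.abs_prod]
      exact Finset.prod_le_one (fun _ _ => abs_nonneg _) fun i _ => hg i
    have h2 : f a * ∏ i ∈ s, f i - g a * ∏ i ∈ s, g i =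
        (f a - g a) * ∏ i ∈ s, g i + f a * (∏ i ∈ s, f i - ∏ i ∈ s, g i) := by ring
    rw [h2]
    refine (abs_add_le _ _).trans (add_le_add ?_ ?_)
    · rw [abs_mul]; exact mul_le_of_le_one_right (abs_nonneg _) h1
    · rw [abs_mul]
      exact (mul_le_of_le_one_left (abs_nonneg _) (hf a)).trans ih

/-- Lipschitz continuity with an unspecified constant. -/
def IsLip (u : (Fin d → ℝ) → ℝ) : Prop := ∃ C : NNReal, LipschitzWith C u

lemma IsLip.continuous {u : (Fin d → ℝ) → ℝ} (h : IsLip u) : Continuous u :=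
  h.choose_spec.continuous

lemma IsLip.of_abs_le {u : (Fin d → ℝ) → ℝ} {C : ℝ} (hC : 0 ≤ C)
    (h : ∀ x y, |u x - u y| ≤ C * ‖x - y‖) : IsLip u :=
  ⟨⟨C, hC⟩, LipschitzWith.of_dist_le_mul fun x y => by
    rw [Real.dist_eq, dist_eq_norm]; exact h x y⟩

lemma IsLip.sum_smul {ι : Type} {s : Finset ι} {u : ι → (Fin d → ℝ) → ℝ} (c : ι → ℝ)
    (h : ∀ i ∈ s, IsLip (u i)) : IsLip (∑ i ∈ s, c i • u i) := by
  classical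
  induction s using Finset.induction_on with
  | empty => exact ⟨0, LipschitzWith.const 0⟩
  | insert a s ha ih =>
    rw [Finset.sum_insert ha]
    obtain ⟨C₁, h₁⟩ := h a (Finset.mem_insert_self a s)
    obtain ⟨C₂, h₂⟩ := ih fun i hi => h i (Finset.mem_insert_of_mem hi)
    refine ⟨_, LipschitzWith.add (Kf := ‖c a‖₊ * C₁) ?_ h₂⟩
    exact (lipschitzWith_smul (c a)).comp h₁

lemma IsLip.refHat_scale (y : Fin d → ℝ) (s : ℝ) :
    IsLip fun x : Fin d → ℝ => refHat fun i => (x i - y i) / s := by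
  refine IsLip.of_abs_le (C := d * |s|⁻¹) (by positivity) fun x x' => ?_
  have h1 : ∀ t, |tent t| ≤ 1 := fun t => abs_le.2 ⟨by linarith [tent_nonneg t], tent_le_one t⟩
  refine (abs_prod_sub_prod_le _ _ _ (fun _ => h1 _) (fun _ => h1 _)).trans ?_
  calc _ ≤ ∑ _i : Fin d, |s|⁻¹ * ‖x - x'‖ := Finset.sum_le_sum fun i _ => by
        refine (tent_lipschitz _ _).trans ?_
        rw [show (x i - y i) / s - (x' i - y i) / s = s⁻¹ * (x i - x' i) by ring, abs_mul, abs_inv]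
        gcongr
        exact norm_le_pi_norm (x - x') i
    _ = _ := by simp [mul_assoc]

namespace CartesianMesh

variable (T : CartesianMesh d)

lemma hat_eq_prod (z : Fin d → ℤ) (x : Fin d → ℝ) :
    T.hat z x = ∏ i, tent ((x i - T.node z i) / T.size) := by
  unfold hat tent
  simp [abs_div, abs_of_pos T.size_pos]

lemma hat_eq_refHat (z : Fin d → ℤ) :
    T.hat z = fun x => refHat fun i => (x i - T.node z i) / T.size := by
  ext x; rw [hat_eq_prod]; rfl

lemma isLip_hat (z : Fin d → ℤ) : IsLip (T.hat z) := by
  rw [hat_eq_refHat]; exact IsLip.refHat_scale _ _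

lemma hat_nonneg (z : Fin d → ℤ) (x : Fin d → ℝ) : 0 ≤ T.hat z x := by
  rw [hat_eq_prod]; exact Finset.prod_nonneg fun _ _ => tent_nonneg _

lemma hat_ne_zero_iff (z : Fin d → ℤ) (x : Fin d → ℝ) :
    T.hat z x ≠ 0 ↔ ∀ i, |x i - T.node z i| < T.size := by
  rw [hat_eq_prod, Finset.prod_ne_zero_iff]
  refine ⟨fun h i => ?_, fun h i _ => ?_⟩
  · have := (tent_nonneg _).lt_of_ne' (h i (Finset.mem_univ i))
    rwa [tent_pos_iff, abs_div, abs_of_pos T.size_pos, div_lt_one T.size_pos] at this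
  · refine (tent_pos_iff.2 ?_).ne'
    rw [abs_div, abs_of_pos T.size_pos, div_lt_one T.size_pos]
    exact h i

lemma node_add (z s : Fin d → ℤ) :
    T.node (z + s) = T.node z + fun i => T.size * (s i : ℝ) := by
  ext i; simp [node]; ring

lemma hat_add (z s : Fin d → ℤ) (x : Fin d → ℝ) :
    T.hat (z + s) (x + fun i => T.size * (s i : ℝ)) = T.hat z x := by
  rw [hat_eq_prod, hat_eq_prod, node_add]
  simp

lemma hat_node (z z' : Fin d → ℤ) : T.hat z (T.node z') = if z = z' then 1 else 0 := by
  split_ifs with h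
  · subst h; rw [hat_eq_prod]; simp [tent]
  · by_contra h0
    rw [← ne_eq, hat_ne_zero_iff] at h0
    refine h (funext fun i => ?_)
    have h1 := h0 i
    have h2 : T.node z' i - T.node z i = T.size * ((z' i - z i : ℤ) : ℝ) := by
      simp [node]; ring
    rw [h2, abs_mul, abs_of_pos T.size_pos] at h1
    have h3 : |((z' i - z i : ℤ) : ℝ)| < 1 := by
      by_contra! h4; nlinarith [T.size_pos]
    have h5 : |z' i - z i| < 1 := by exact_mod_cast h3
    have := Int.abs_lt_one_iff.1 h5
    lia

lemma mem_cell_iff (z : Fin d → ℤ) (x : Fin d → ℝ) :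
    x ∈ T.cell z ↔ ∀ i, T.node z i ≤ x i ∧ x i ≤ T.node z i + T.size := by
  simp only [cell, mem_Icc, Pi.le_def, node_add, ← forall_and]
  simp [node]

lemma measurableSet_cell (z : Fin d → ℤ) : MeasurableSet (T.cell z) := measurableSet_Icc

lemma node_mem_cell_iff (z K : Fin d → ℤ) :
    T.node z ∈ T.cell K ↔ ∀ i, K i ≤ z i ∧ z i ≤ K i + 1 := by
  rw [mem_cell_iff]
  refine forall_congr' fun i => ?_
  have hs := T.size_pos
  simp only [node]
  constructor
  · rintro ⟨h1, h2⟩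
    have h3 : (K i : ℝ) ≤ z i := by
      have : T.size * (K i : ℝ) ≤ T.size * z i := by linarith
      exact le_of_mul_le_mul_left this hs
    have h4 : (z i : ℝ) ≤ K i + 1 := by
      have : T.size * (z i : ℝ) ≤ T.size * (K i + 1) := by linarith
      exact le_of_mul_le_mul_left this hs
    exact ⟨by exact_mod_cast h3, by exact_mod_cast h4⟩
  · rintro ⟨h1, h2⟩
    have h3 : (K i : ℝ) ≤ z i := by exact_mod_cast h1
    have h4 : (z i : ℝ) ≤ K i + 1 := by exact_mod_cast h2
    constructor <;> nlinarith

lemma hasCompactSupport_hat (z : Fin d → ℤ) : HasCompactSupport (T.hat z) := by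
  refine HasCompactSupport.of_support_subset_isCompact (K := Metric.closedBall (T.node z) T.size)
    (isCompact_closedBall _ _) fun x hx => ?_
  rw [Metric.mem_closedBall, dist_pi_le_iff T.size_pos.le]
  exact fun i => ((T.hat_ne_zero_iff z x).1 hx i).le

end CartesianMesh

/-! ### Interpolation of a hat function on a finer grid -/

/-- Only the two integers next to x contribute, with the weights of linear interpolation. -/
lemma sum_mul_tent_sub {S : Finset ℤ} (g : ℤ → ℝ) (x : ℝ) (hS : ∀ k ∉ S, g k = 0) :
    ∑ k ∈ S, g k * tent (x - k) = g ⌊x⌋ * (1 - Int.fract x) + g (⌊x⌋ + 1) * Int.fract x := by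
  have h1 : ∑ k ∈ S, g k * tent (x - k) = ∑ k ∈ S ∪ {⌊x⌋, ⌊x⌋ + 1}, g k * tent (x - k) :=
    Finset.sum_subset Finset.subset_union_left fun k _ hk => by rw [hS k hk, zero_mul]
  have h2 : ∑ k ∈ ({⌊x⌋, ⌊x⌋ + 1} : Finset ℤ), g k * tent (x - k) =
      ∑ k ∈ S ∪ {⌊x⌋, ⌊x⌋ + 1}, g k * tent (x - k) := by
    refine Finset.sum_subset Finset.subset_union_right fun k _ hk => ?_
    rw [tent_of_one_le_abs, mul_zero]
    simp only [Finset.mem_insert, Finset.mem_singleton, not_or] at hk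
    have h3 := Int.floor_le x
    have h4 := Int.lt_floor_add_one x
    rw [le_abs]
    rcases lt_or_gt_of_ne hk.1 with h | h
    · left
      have : (k : ℝ) + 1 ≤ ⌊x⌋ := by exact_mod_cast h
      linarith
    · right
      have h5 : ⌊x⌋ + 2 ≤ k := by have := hk.2; lia
      have : (⌊x⌋ : ℝ) + 2 ≤ k := by exact_mod_cast h5
      linarith
  have h0 := Int.fract_nonneg x
  have h5 := Int.fract_lt_one x
  rw [h1, ← h2, Finset.sum_pair (by lia)]
  have h6 : x - (⌊x⌋ : ℝ) = Int.fract x := rfl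
  have h7 : x - ((⌊x⌋ + 1 : ℤ) : ℝ) = Int.fract x - 1 := by push_cast; rw [← h6]; ring
  rw [h6, h7, tent_of_abs_le (by rw [abs_of_nonneg h0]; exact h5.le), abs_of_nonneg h0,
    tent_of_abs_le (by rw [abs_of_nonpos (by linarith)]; linarith),
    abs_of_nonpos (by linarith)]
  ring

/-- A hat of width s is linear between integers, so it equals its interpolant. The grid points k + 1
− s run from 1 − s upwards and reach s − 1 because m ≥ 2 s − 1; those beyond s − 1 carry the weight
zero. -/
lemma tent_div_eq_sum {s m : ℕ} (hs : 1 ≤ s) (hm : 2 * s ≤ m + 1) (x : ℝ) :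
    tent (x / s) = ∑ k : Fin m, tent (((k : ℕ) + 1 - s : ℝ) / s) * tent (x - ((k : ℕ) + 1 - s)) := by
  have hs0 : (0 : ℝ) < s := by exact_mod_cast hs
  set g : ℤ → ℝ := fun k => tent (k / s) with hg
  have hg0 : ∀ k : ℤ, (s : ℤ) ≤ |k| → g k = 0 := fun k hk => by
    refine tent_of_one_le_abs ?_
    rw [abs_div, abs_of_pos hs0, one_le_div hs0]
    have : ((s : ℤ) : ℝ) ≤ ((|k| : ℤ) : ℝ) := by exact_mod_cast hk
    simpa using this
  have hinj : Function.Injective fun k : Fin m => ((k : ℕ) : ℤ) + 1 - s := fun a b h => by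
    ext; simpa using h
  have hsum := sum_mul_tent_sub (S := Finset.univ.image fun k : Fin m => ((k : ℕ) : ℤ) + 1 - s)
    g x fun k hk => by
      refine hg0 k ?_
      by_contra! h
      rw [abs_lt] at h
      refine hk (Finset.mem_image.2 ⟨⟨(k + s - 1).toNat, by lia⟩, Finset.mem_univ _, ?_⟩)
      simp only
      lia
  rw [Finset.sum_image fun a _ b _ h => hinj h] at hsum
  have hR : ∑ k : Fin m, tent (((k : ℕ) + 1 - s : ℝ) / s) * tent (x - ((k : ℕ) + 1 - s)) =
      ∑ k : Fin m, g (((k : ℕ) : ℤ) + 1 - s) * tent (x - ((((k : ℕ) : ℤ) + 1 - s : ℤ) : ℝ)) := by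
    simp [hg]
  rw [hR, hsum]
  have hx1 := Int.floor_le x
  have hx2 := Int.lt_floor_add_one x
  have hxf : x = ⌊x⌋ + Int.fract x := (Int.floor_add_fract x).symm
  have hf0 := Int.fract_nonneg x
  have hf1 := Int.fract_lt_one x
  generalize ⌊x⌋ = j at *
  generalize Int.fract x = f at *
  rcases le_or_gt (s : ℤ) j with h | h
  · rw [hg0 j (by rw [le_abs]; lia), hg0 (j + 1) (by rw [le_abs]; lia), tent_of_one_le_abs]
    · ring
    · rw [abs_div, abs_of_pos hs0, one_le_div hs0, le_abs]
      left
      have : (s : ℝ) ≤ j := by exact_mod_cast h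
      linarith
  rcases lt_or_ge j (-s : ℤ) with h' | h'
  · rw [hg0 j (by rw [le_abs]; lia), hg0 (j + 1) (by rw [le_abs]; lia), tent_of_one_le_abs]
    · ring
    · rw [abs_div, abs_of_pos hs0, one_le_div hs0, le_abs]
      right
      have : (j : ℝ) + 1 ≤ -s := by exact_mod_cast h'
      linarith
  have hj1 : (j : ℝ) + 1 ≤ s := by exact_mod_cast h
  have hj2 : -(s : ℝ) ≤ j := by exact_mod_cast h'
  have habs : ∀ y : ℝ, |y| ≤ s → tent (y / s) = 1 - |y| / s := fun y hy => by
    rw [tent_of_abs_le, abs_div, abs_of_pos hs0]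
    rwa [abs_div, abs_of_pos hs0, div_le_one hs0]
  simp only [hg]
  rw [habs x (abs_le.2 ⟨by linarith, by linarith⟩), habs j (abs_le.2 ⟨by linarith, by linarith⟩),
    habs _ (by push_cast; exact abs_le.2 ⟨by linarith, by linarith⟩)]
  rcases le_or_gt 0 j with h0 | h0
  · have h1 : (0 : ℝ) ≤ j := by exact_mod_cast h0
    push_cast
    rw [abs_of_nonneg (by linarith : 0 ≤ x), abs_of_nonneg h1,
      abs_of_nonneg (by linarith : (0 : ℝ) ≤ j + 1), hxf]
    field_simp
    ring
  · have h1 : (j : ℝ) + 1 ≤ 0 := by exact_mod_cast h0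
    push_cast
    rw [abs_of_nonpos (by linarith : x ≤ 0), abs_of_nonpos (by linarith : (j : ℝ) ≤ 0),
      abs_of_nonpos h1, hxf]
    field_simp
    ring

lemma refHat_div_eq_sum {s m : ℕ} (hs : 1 ≤ s) (hm : 2 * s ≤ m + 1) (u : Fin d → ℝ) :
    refHat (fun i => u i / s) = ∑ k : Fin d → Fin m,
      (∏ i, tent ((((k i : ℕ) : ℝ) + 1 - s) / s)) *
        refHat fun i => u i - (((k i : ℕ) : ℝ) + 1 - s) := by
  unfold refHat
  rw [Finset.prod_congr rfl fun i _ => tent_div_eq_sum hs hm (u i)]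
  simp only [← Finset.prod_mul_distrib]
  rw [Finset.prod_univ_sum, Fintype.piFinset_univ]

/-- The ascending half of the hat, with the values (k + 1) / s, is enough. -/
lemma sum_tent_sq_ge {s m : ℕ} (hs : 1 ≤ s) (hm : 2 * s ≤ m + 1) :
    (s : ℝ) / 3 ≤ ∑ k : Fin m, tent ((((k : ℕ) : ℝ) + 1 - s) / s) ^ 2 := by
  have hs0 : (0 : ℝ) < s := by exact_mod_cast hs
  have hsm : s ≤ m := by lia
  calc (s : ℝ) / 3 ≤ ∑ k ∈ Finset.range s, (((k : ℝ) + 1) / s) ^ 2 := by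
        have : ∀ n : ℕ, (n : ℝ) ^ 3 / 3 ≤ ∑ k ∈ Finset.range n, ((k : ℝ) + 1) ^ 2 := fun n => by
          induction n with
          | zero => simp
          | succ n ih =>
            rw [Finset.sum_range_succ]; push_cast
            have : (0 : ℝ) ≤ n := Nat.cast_nonneg n
            nlinarith
        simp only [div_pow, ← Finset.sum_div]
        rw [le_div_iff₀ (by positivity)]
        refine le_trans (le_of_eq ?_) (this s)
        ring
    _ = ∑ k ∈ Finset.range s, tent (((k : ℝ) + 1 - s) / s) ^ 2 := by
        refine Finset.sum_congr rfl fun k hk => ?_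
        have hk' : (k : ℝ) + 1 ≤ s := by exact_mod_cast Finset.mem_range.1 hk
        have hk0 : (0 : ℝ) ≤ k := Nat.cast_nonneg k
        have h1 : |((k : ℝ) + 1 - s) / s| = 1 - ((k : ℝ) + 1) / s := by
          rw [abs_div, abs_of_pos hs0, abs_of_nonpos (by linarith)]
          field_simp; ring
        have h2 : 0 ≤ ((k : ℝ) + 1) / s := by positivity
        rw [tent_of_abs_le (by rw [h1]; linarith), h1]
        ring
    _ ≤ ∑ k ∈ Finset.range m, tent (((k : ℝ) + 1 - s) / s) ^ 2 :=
        Finset.sum_le_sum_of_subset_of_nonneg (Finset.range_mono hsm) fun _ _ _ => sq_nonneg _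
    _ = _ := (Fin.sum_univ_eq_sum_range (fun k : ℕ => tent (((k : ℝ) + 1 - s) / s) ^ 2) m).symm

end Hats

/-! ### The energy of Lipschitz functions -/

section Energy

variable {d : ℕ}

/-- The product of the gradients of `u` and `v`. -/
def gradDot (u v : (Fin d → ℝ) → ℝ) (x : Fin d → ℝ) : ℝ :=
  ∑ i, lineDeriv ℝ u x (Pi.single i (1 : ℝ)) * lineDeriv ℝ v x (Pi.single i (1 : ℝ))

lemma energy_eq (S : Set (Fin d → ℝ)) (A u v : (Fin d → ℝ) → ℝ) :
    energy S A u v = ∫ x in S, A x * gradDot u v x := rfl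

lemma gradDot_comm (u v : (Fin d → ℝ) → ℝ) (x : Fin d → ℝ) : gradDot u v x = gradDot v u x :=
  Finset.sum_congr rfl fun _ _ => mul_comm _ _

lemma gradDot_self_nonneg (u : (Fin d → ℝ) → ℝ) (x : Fin d → ℝ) : 0 ≤ gradDot u u x :=
  Finset.sum_nonneg fun _ _ => mul_self_nonneg _

lemma abs_gradDot_le (u v : (Fin d → ℝ) → ℝ) (x : Fin d → ℝ) :
    |gradDot u v x| ≤ (gradDot u u x + gradDot v v x) / 2 := by
  unfold gradDot
  refine (Finset.abs_sum_le_sum_abs _ _).trans ?_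
  rw [← Finset.sum_add_distrib, Finset.sum_div]
  refine Finset.sum_le_sum fun i _ => ?_
  rw [abs_le]
  constructor <;> nlinarith [sq_nonneg (lineDeriv ℝ u x (Pi.single i (1 : ℝ)) +
    lineDeriv ℝ v x (Pi.single i (1 : ℝ))), sq_nonneg (lineDeriv ℝ u x (Pi.single i (1 : ℝ)) -
    lineDeriv ℝ v x (Pi.single i (1 : ℝ)))]

lemma energy_comm (S : Set (Fin d → ℝ)) (A u v : (Fin d → ℝ) → ℝ) :
    energy S A u v = energy S A v u := by
  simp only [energy_eq, gradDot_comm u v]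

lemma IsLip.measurable_gradDot {u v : (Fin d → ℝ) → ℝ} (hu : IsLip u) (hv : IsLip v) :
    Measurable (gradDot u v) :=
  Finset.measurable_sum _ fun _ _ =>
    (measurable_lineDeriv hu.continuous).mul (measurable_lineDeriv hv.continuous)

lemma IsLip.gradDot_bdd {u v : (Fin d → ℝ) → ℝ} (hu : IsLip u) (hv : IsLip v) :
    ∃ b : ℝ, 0 ≤ b ∧ ∀ x, |gradDot u v x| ≤ b := by
  obtain ⟨C, hC⟩ := hu
  obtain ⟨C', hC'⟩ := hv
  refine ⟨∑ i : Fin d, (C * ‖(Pi.single i (1 : ℝ) : Fin d → ℝ)‖) *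
    (C' * ‖(Pi.single i (1 : ℝ) : Fin d → ℝ)‖), by positivity, fun x => ?_⟩
  refine (Finset.abs_sum_le_sum_abs _ _).trans (Finset.sum_le_sum fun i _ => ?_)
  rw [abs_mul]
  exact mul_le_mul (norm_lineDeriv_le_of_lipschitz ℝ hC) (norm_lineDeriv_le_of_lipschitz ℝ hC')
    (abs_nonneg _) (by positivity)

/-- The set `S` has finite volume, and `A` is measurable and essentially bounded on it. -/
def BddCoeff (S : Set (Fin d → ℝ)) (A : (Fin d → ℝ) → ℝ) : Prop :=
  volume S ≠ ⊤ ∧ AEStronglyMeasurable A (volume.restrict S) ∧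
    ∃ b : ℝ, ∀ᵐ x ∂(volume.restrict S), |A x| ≤ b

lemma BddCoeff.mono {S S' : Set (Fin d → ℝ)} {A : (Fin d → ℝ) → ℝ} (h : BddCoeff S A)
    (hS : S' ⊆ S) : BddCoeff S' A := by
  obtain ⟨h1, h2, b, h3⟩ := h
  exact ⟨measure_ne_top_of_subset hS h1, h2.mono_set hS, b, ae_restrict_of_ae_restrict_of_subset hS h3⟩

lemma bddCoeff_const {S : Set (Fin d → ℝ)} (h : volume S ≠ ⊤) (c : ℝ) :
    BddCoeff S fun _ => c :=
  ⟨h, aestronglyMeasurable_const, |c|, .of_forall fun _ => le_rfl⟩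

lemma BddCoeff.integrable {S : Set (Fin d → ℝ)} {A u v : (Fin d → ℝ) → ℝ} (h : BddCoeff S A)
    (hu : IsLip u) (hv : IsLip v) : IntegrableOn (fun x => A x * gradDot u v x) S := by
  obtain ⟨h1, h2, b, h3⟩ := h
  obtain ⟨b', hb', h4⟩ := hu.gradDot_bdd hv
  have : IsFiniteMeasure (volume.restrict S) := isFiniteMeasure_restrict.2 h1
  refine Integrable.of_bound (C := b * b') (h2.mul (hu.measurable_gradDot hv).aestronglyMeasurable) ?_
  filter_upwards [h3] with x hx
  rw [norm_mul]
  exact mul_le_mul hx (h4 x) (norm_nonneg _) ((abs_nonneg _).trans hx)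

/-- `lineDeriv` is linear only where the summands are differentiable; for Lipschitz functions this
excludes a null set (the kinks). -/
lemma ae_lineDeriv_sum_smul {ι : Type} (s : Finset ι) (c : ι → ℝ) {u : ι → (Fin d → ℝ) → ℝ}
    (hu : ∀ k, IsLip (u k)) (v : Fin d → ℝ) :
    ∀ᵐ x ∂(volume : Measure (Fin d → ℝ)), lineDeriv ℝ (∑ k ∈ s, c k • u k) x v =
      ∑ k ∈ s, c k * lineDeriv ℝ (u k) x v := by
  have h : ∀ᵐ x ∂(volume : Measure (Fin d → ℝ)), ∀ k ∈ s, LineDifferentiableAt ℝ (u k) x v :=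
    (Filter.eventually_all_finset s).2 fun k _ =>
      (hu k).choose_spec.ae_lineDifferentiableAt (μ := volume) v
  filter_upwards [h] with x hx
  refine HasLineDerivAt.lineDeriv ?_
  unfold HasLineDerivAt
  have := HasDerivAt.fun_sum fun k hk => ((hx k hk).hasLineDerivAt).const_mul (c k)
  convert this using 1
  ext t
  simp

lemma ae_gradDot_sum_smul {ι : Type} (s : Finset ι) (c : ι → ℝ) {u : ι → (Fin d → ℝ) → ℝ}
    (hu : ∀ k, IsLip (u k)) (v : (Fin d → ℝ) → ℝ) :
    ∀ᵐ x ∂(volume : Measure (Fin d → ℝ)), gradDot (∑ k ∈ s, c k • u k) v x =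
      ∑ k ∈ s, c k * gradDot (u k) v x := by
  filter_upwards [(ae_all_iff.2 fun i => ae_lineDeriv_sum_smul s c hu (Pi.single i (1 : ℝ)))]
    with x hx
  unfold gradDot
  simp only [hx, Finset.mul_sum, Finset.sum_mul]
  rw [Finset.sum_comm]
  simp only [mul_assoc]

lemma BddCoeff.energy_sum_left {S : Set (Fin d → ℝ)} {A : (Fin d → ℝ) → ℝ} (h : BddCoeff S A)
    {ι : Type} (s : Finset ι) (c : ι → ℝ) {u : ι → (Fin d → ℝ) → ℝ} (hu : ∀ k, IsLip (u k))
    {v : (Fin d → ℝ) → ℝ} (hv : IsLip v) :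
    energy S A (∑ k ∈ s, c k • u k) v = ∑ k ∈ s, c k * energy S A (u k) v := by
  simp only [energy_eq]
  rw [integral_congr_ae (g := fun x => ∑ k ∈ s, c k * (A x * gradDot (u k) v x))]
  · rw [integral_finsetSum _ fun k _ => (h.integrable (hu k) hv).const_mul (c k)]
    simp only [integral_const_mul]
  · filter_upwards [ae_restrict_of_ae (ae_gradDot_sum_smul s c hu v)] with x hx
    rw [hx, Finset.mul_sum]
    exact Finset.sum_congr rfl fun k _ => by ring

lemma BddCoeff.energy_sum_right {S : Set (Fin d → ℝ)} {A : (Fin d → ℝ) → ℝ} (h : BddCoeff S A)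
    {ι : Type} (s : Finset ι) (c : ι → ℝ) {u : ι → (Fin d → ℝ) → ℝ} (hu : ∀ k, IsLip (u k))
    {v : (Fin d → ℝ) → ℝ} (hv : IsLip v) :
    energy S A v (∑ k ∈ s, c k • u k) = ∑ k ∈ s, c k * energy S A v (u k) := by
  rw [energy_comm, h.energy_sum_left s c hu hv]
  simp only [energy_comm S A v]

lemma energy_mono_coeff {S : Set (Fin d → ℝ)} {A B u : (Fin d → ℝ) → ℝ} (hA : BddCoeff S A)
    (hB : BddCoeff S B) (hu : IsLip u) (h : ∀ᵐ x ∂(volume.restrict S), A x ≤ B x) :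
    energy S A u u ≤ energy S B u u := by
  refine integral_mono_ae (hA.integrable hu hu) (hB.integrable hu hu) ?_
  filter_upwards [h] with x hx
  exact mul_le_mul_of_nonneg_right hx (gradDot_self_nonneg u x)

lemma energy_const (S : Set (Fin d → ℝ)) (c : ℝ) (u v : (Fin d → ℝ) → ℝ) :
    energy S (fun _ => c) u v = c * energy S (fun _ => 1) u v := by
  simp only [energy_eq, one_mul, integral_const_mul]

lemma energy_self_nonneg {S : Set (Fin d → ℝ)} {A u : (Fin d → ℝ) → ℝ}
    (h : ∀ᵐ x ∂(volume.restrict S), 0 ≤ A x) : 0 ≤ energy S A u u :=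
  integral_nonneg_of_ae (by
    filter_upwards [h] with x hx
    exact mul_nonneg hx (gradDot_self_nonneg u x))

lemma gradDot_eq_zero_of_eventuallyEq {u v : (Fin d → ℝ) → ℝ} {x : Fin d → ℝ}
    (h : u =ᶠ[nhds x] 0) : gradDot u v x = 0 := by
  refine Finset.sum_eq_zero fun i _ => ?_
  rw [h.lineDeriv_eq]
  have : lineDeriv ℝ (0 : (Fin d → ℝ) → ℝ) x (Pi.single i (1 : ℝ)) = 0 := by
    simp [lineDeriv]
  rw [this, zero_mul]

lemma gradDot_eq_zero_of_notMem {u v : (Fin d → ℝ) → ℝ} {S : Set (Fin d → ℝ)} (hS : IsClosed S)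
    (hu : ∀ x ∉ S, u x = 0) {x : Fin d → ℝ} (hx : x ∉ S) : gradDot u v x = 0 := by
  refine gradDot_eq_zero_of_eventuallyEq ?_
  filter_upwards [hS.isOpen_compl.mem_nhds hx] with y hy using hu y hy

lemma energy_eq_of_subset {S S' : Set (Fin d → ℝ)} {A u v : (Fin d → ℝ) → ℝ} (hS : IsClosed S)
    (hSS' : S ⊆ S') (hS' : MeasurableSet S') (hu : ∀ x ∉ S, u x = 0) :
    energy S' A u v = energy S A u v := by
  rw [energy_eq, energy_eq]
  refine setIntegral_eq_of_subset_of_forall_sdiff_eq_zero hS' hSS' fun x hx => ?_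
  rw [gradDot_eq_zero_of_notMem hS hu hx.2, mul_zero]

lemma integrable_gradDot_self {u : (Fin d → ℝ) → ℝ} (hu : IsLip u) (hc : HasCompactSupport u) :
    Integrable (gradDot u u) := by
  have h1 : IntegrableOn (gradDot u u) (tsupport u) := by
    have := (bddCoeff_const hc.isCompact.measure_lt_top.ne 1).integrable hu hu
    simpa only [one_mul] using this
  refine (integrableOn_iff_integrable_of_support_subset fun x hx => ?_).1 h1
  by_contra h
  exact hx (gradDot_eq_zero_of_notMem (isClosed_tsupport u)
    (fun y hy => image_eq_zero_of_notMem_tsupport hy) h)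

/-- The Dirichlet energy on the whole space. -/
def dirichlet (u : (Fin d → ℝ) → ℝ) : ℝ := ∫ x, gradDot u u x

lemma energy_one_le_dirichlet {u : (Fin d → ℝ) → ℝ} (hu : IsLip u) (hc : HasCompactSupport u)
    (S : Set (Fin d → ℝ)) : energy S (fun _ => 1) u u ≤ dirichlet u := by
  simp only [energy_eq, one_mul]
  exact setIntegral_le_integral (integrable_gradDot_self hu hc)
    (.of_forall fun x => gradDot_self_nonneg u x)

lemma abs_energy_le {S : Set (Fin d → ℝ)} {A u v : (Fin d → ℝ) → ℝ} (hA : BddCoeff S A)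
    (hu : IsLip u) (hv : IsLip v) {β : ℝ} (hβ : 0 ≤ β)
    (h : ∀ᵐ x ∂(volume.restrict S), 0 ≤ A x ∧ A x ≤ β)
    (hcu : HasCompactSupport u) (hcv : HasCompactSupport v) :
    |energy S A u v| ≤ β * ((dirichlet u + dirichlet v) / 2) := by
  rw [energy_eq]
  refine (norm_integral_le_integral_norm (fun x => A x * gradDot u v x)).trans ?_
  have hβS := bddCoeff_const hA.1 (d := d) β
  have h1 : ∫ x in S, ‖A x * gradDot u v x‖ ≤
      ∫ x in S, (β * gradDot u u x + β * gradDot v v x) / 2 := by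
    refine integral_mono_ae (hA.integrable hu hv).norm
      (((hβS.integrable hu hu).add (hβS.integrable hv hv)).div_const 2) ?_
    filter_upwards [h] with x hx
    rw [norm_mul, Real.norm_eq_abs, Real.norm_eq_abs, abs_of_nonneg hx.1]
    have h2 := abs_gradDot_le u v x
    calc A x * |gradDot u v x| ≤ β * ((gradDot u u x + gradDot v v x) / 2) :=
          mul_le_mul hx.2 h2 (abs_nonneg _) hβ
      _ = _ := by ring
  refine h1.trans ?_
  rw [integral_div, integral_add (hβS.integrable hu hu) (hβS.integrable hv hv)]
  have h2 := energy_const S β u u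
  have h3 := energy_const S β v v
  rw [energy_eq] at h2 h3
  rw [h2, h3]
  have h4 := energy_one_le_dirichlet hu hcu S
  have h5 := energy_one_le_dirichlet hv hcv S
  nlinarith

lemma lineDeriv_comp_add {u u' : (Fin d → ℝ) → ℝ} {τ : Fin d → ℝ} (hu : ∀ x, u' (x + τ) = u x)
    (x v : Fin d → ℝ) : lineDeriv ℝ u' (x + τ) v = lineDeriv ℝ u x v := by
  unfold lineDeriv
  congr 1
  ext t
  rw [← hu]; congr 1; abel

lemma setIntegral_translate {f f' : (Fin d → ℝ) → ℝ} {S S' : Set (Fin d → ℝ)} {τ : Fin d → ℝ}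
    (hf : ∀ x, f' (x + τ) = f x) (hS : ∀ x, x + τ ∈ S' ↔ x ∈ S) (hm : MeasurableSet S)
    (hm' : MeasurableSet S') : ∫ x in S', f' x = ∫ x in S, f x := by
  classical
  rw [← integral_indicator hm, ← integral_indicator hm', ← integral_add_right_eq_self _ τ]
  congr 1
  ext x
  simp only [indicator_apply, hf, hS]

lemma energy_translate {u u' v v' : (Fin d → ℝ) → ℝ} {S S' : Set (Fin d → ℝ)} {τ : Fin d → ℝ}
    (hu : ∀ x, u' (x + τ) = u x) (hv : ∀ x, v' (x + τ) = v x) (hS : ∀ x, x + τ ∈ S' ↔ x ∈ S)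
    (hm : MeasurableSet S) (hm' : MeasurableSet S') :
    energy S' (fun _ => 1) u' v' = energy S (fun _ => 1) u v := by
  simp only [energy_eq]
  refine setIntegral_translate (fun x => ?_) hS hm hm'
  simp only [gradDot, lineDeriv_comp_add hu, lineDeriv_comp_add hv]

lemma lineDeriv_comp_scale (u : (Fin d → ℝ) → ℝ) (y : Fin d → ℝ) {s : ℝ} (hs : s ≠ 0)
    (x v : Fin d → ℝ) :
    lineDeriv ℝ (fun x => u fun i => (x i - y i) / s) x v =
      s⁻¹ * lineDeriv ℝ u (fun i => (x i - y i) / s) v := by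
  have h : (fun t : ℝ => (fun x => u fun i => (x i - y i) / s) (x + t • v)) =
      fun t : ℝ => (fun r : ℝ => u ((fun i => (x i - y i) / s) + r • v)) (s⁻¹ * t) := by
    ext t
    simp only
    congr 1
    ext i
    simp only [Pi.add_apply, Pi.smul_apply, smul_eq_mul]
    field_simp
    ring
  unfold lineDeriv
  rw [h]
  have := deriv_comp_mul_left s⁻¹ (fun r : ℝ => u ((fun i => (x i - y i) / s) + r • v)) 0
  rw [this]
  simp

lemma dirichlet_scale (u : (Fin d → ℝ) → ℝ) (y : Fin d → ℝ) {s : ℝ} (hs : 0 < s) :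
    dirichlet (fun x => u fun i => (x i - y i) / s) = s ^ d * (s⁻¹) ^ 2 * dirichlet u := by
  unfold dirichlet
  have h1 : ∀ x, gradDot (fun x => u fun i => (x i - y i) / s) (fun x => u fun i => (x i - y i) / s) x
      = (s⁻¹) ^ 2 * gradDot u u (s⁻¹ • (x - y)) := fun x => by
    have h2 : (s⁻¹ • (x - y)) = fun i => (x i - y i) / s := by
      ext i; simp [div_eq_inv_mul]
    simp only [gradDot, lineDeriv_comp_scale u y hs.ne', h2, Finset.mul_sum]
    exact Finset.sum_congr rfl fun i _ => by ring
  simp only [h1, integral_const_mul]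
  rw [integral_sub_right_eq_self (fun x => gradDot u u (s⁻¹ • x)) y,
    Measure.integral_comp_smul]
  simp only [Module.finrank_fintype_fun_eq_card, Fintype.card_fin, smul_eq_mul]
  rw [inv_pow s d, inv_inv, abs_of_pos (by positivity)]
  ring

/-- A compactly supported Lipschitz function whose gradient vanishes is zero. -/
lemma eq_zero_of_gradDot_eq_zero (hd : 1 ≤ d) {w : (Fin d → ℝ) → ℝ} (hw : IsLip w)
    (hc : HasCompactSupport w)
    (h : ∀ᵐ x ∂(volume : Measure (Fin d → ℝ)), gradDot w w x = 0) : w = 0 := by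
  let i₀ : Fin d := ⟨0, hd⟩
  set e : Fin d → ℝ := Pi.single i₀ 1 with he
  obtain ⟨C, hC⟩ := hw
  have hcont := hC.continuous
  obtain ⟨b, hb⟩ := hcont.bounded_above_of_compact_support hc
  have hb0 : 0 ≤ b := (norm_nonneg _).trans (hb 0)
  obtain ⟨C₁, hC₁⟩ : IsLip fun x => w x * w x := by
    refine IsLip.of_abs_le (C := 2 * b * C) (by positivity) fun x y => ?_
    rw [show w x * w x - w y * w y = (w x + w y) * (w x - w y) by ring, abs_mul]
    have h1 : |w x + w y| ≤ 2 * b := by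
      have h1 := hb x
      have h2 := hb y
      rw [Real.norm_eq_abs] at h1 h2
      exact (abs_add_le _ _).trans (by linarith)
    have h2 : |w x - w y| ≤ C * ‖x - y‖ := by
      have := hC.dist_le_mul x y
      rwa [Real.dist_eq, dist_eq_norm] at this
    calc _ ≤ (2 * b) * (C * ‖x - y‖) := mul_le_mul h1 h2 (abs_nonneg _) (by positivity)
      _ = _ := by ring
  -- Integration by parts of w² against the coordinate x₀, whose derivative is 1: ∫ w² = −∫ ∂₀(w²)
  -- x₀ = 0. The function w² is Lipschitz since w is bounded.
  have hcoord : LipschitzWith 1 fun x : Fin d → ℝ => x i₀ := LipschitzWith.eval i₀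
  have hparts := hcoord.integral_lineDeriv_mul_eq (μ := volume) hC₁ hc.mul_left e
  have hcoord1 : ∀ x : Fin d → ℝ, lineDeriv ℝ (fun x : Fin d → ℝ => x i₀) x e = 1 := fun x => by
    refine HasLineDerivAt.lineDeriv ?_
    unfold HasLineDerivAt
    simp only [he, Pi.add_apply, Pi.smul_apply, Pi.single_eq_same, smul_eq_mul, mul_one]
    simpa using (hasDerivAt_id (0 : ℝ)).const_add (x i₀)
  have hzero : ∀ᵐ x ∂(volume : Measure (Fin d → ℝ)),
      lineDeriv ℝ (fun x => w x * w x) x (-e) * x i₀ = 0 := by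
    filter_upwards [h, hC.ae_lineDifferentiableAt (μ := volume) e] with x hx hdx
    have h1 : lineDeriv ℝ w x e = 0 := by
      have := (Finset.sum_eq_zero_iff_of_nonneg fun i _ => mul_self_nonneg _).1 hx i₀
        (Finset.mem_univ _)
      exact mul_self_eq_zero.1 this
    have h2 : lineDeriv ℝ (fun x => w x * w x) x e = 0 := by
      refine HasLineDerivAt.lineDeriv ?_
      have h3 := hdx.hasLineDerivAt
      rw [h1] at h3
      unfold HasLineDerivAt at h3 ⊢
      simpa using h3.fun_mul h3
    rw [lineDeriv_neg, h2]; simp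
  rw [integral_congr_ae hzero] at hparts
  simp only [hcoord1, one_mul, integral_zero] at hparts
  have hint : Integrable fun x => w x * w x :=
    (hcont.mul hcont).integrable_of_hasCompactSupport hc.mul_left
  have h0 := (integral_eq_zero_iff_of_nonneg (fun x => mul_self_nonneg (w x)) hint).1 hparts
  have h1 := Continuous.ae_eq_iff_eq volume (hcont.mul hcont) continuous_zero |>.1 h0
  ext x
  exact mul_self_eq_zero.1 (congrFun h1 x)

end Energy

/-! ### Polynomials of coordinate degree at most one -/

section Multiaffine

variable {d : ℕ}

lemma monomial_mem_multiaffine (s : Finset (Fin d)) :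
    (fun x : Fin d → ℝ => ∏ i ∈ s, x i) ∈ multiaffine d :=
  Submodule.subset_span ⟨s, rfl⟩

/-- Induction over the monomials that span the polynomials of coordinate degree at most one. -/
lemma multiaffine_induction {P : ((Fin d → ℝ) → ℝ) → Prop}
    (hm : ∀ s : Finset (Fin d), P fun x => ∏ i ∈ s, x i) (h0 : P 0)
    (hadd : ∀ p ∈ multiaffine d, ∀ q ∈ multiaffine d, P p → P q → P (p + q))
    (hsmul : ∀ (c : ℝ), ∀ p ∈ multiaffine d, P p → P (c • p)) {p : (Fin d → ℝ) → ℝ}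
    (hp : p ∈ multiaffine d) : P p := by
  induction hp using Submodule.span_induction with
  | mem x hx => obtain ⟨s, rfl⟩ := hx; exact hm s
  | zero => exact h0
  | add x y hx hy h1 h2 => exact hadd x hx y hy h1 h2
  | smul c x hx h => exact hsmul c x hx h

lemma continuous_of_mem_multiaffine {p : (Fin d → ℝ) → ℝ} (hp : p ∈ multiaffine d) :
    Continuous p := by
  refine multiaffine_induction (fun s => ?_) continuous_zero (fun p _ q _ h1 h2 => h1.add h2)
    (fun c p _ h => h.const_smul c) hp
  fun_prop

lemma prod_affine_mem_multiaffine (a b : Fin d → ℝ) :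
    (fun x : Fin d → ℝ => ∏ i, (a i * x i + b i)) ∈ multiaffine d := by
  have : (fun x : Fin d → ℝ => ∏ i, (a i * x i + b i)) =
      ∑ t ∈ (Finset.univ : Finset (Fin d)).powerset,
        ((∏ i ∈ t, a i) * ∏ i ∈ Finset.univ \ t, b i) • fun x : Fin d → ℝ => ∏ i ∈ t, x i := by
    ext x
    rw [Finset.prod_add, Finset.sum_apply]
    refine Finset.sum_congr rfl fun t _ => ?_
    rw [Finset.prod_mul_distrib, Pi.smul_apply, smul_eq_mul]
    ring
  rw [this]
  exact Submodule.sum_mem _ fun t _ => Submodule.smul_mem _ _ (monomial_mem_multiaffine t)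

lemma comp_add_mem_multiaffine {p : (Fin d → ℝ) → ℝ} (hp : p ∈ multiaffine d) (τ : Fin d → ℝ) :
    (fun x => p (x + τ)) ∈ multiaffine d := by
  classical
  refine multiaffine_induction (P := fun p => (fun x => p (x + τ)) ∈ multiaffine d) (fun s => ?_)
    (Submodule.zero_mem _) (fun p _ q _ h1 h2 => Submodule.add_mem _ h1 h2)
    (fun c p _ h => Submodule.smul_mem _ c h) hp
  convert prod_affine_mem_multiaffine (fun i => if i ∈ s then 1 else 0)
    (fun i => if i ∈ s then τ i else 1) using 1
  ext x
  rw [← Finset.prod_subset (Finset.subset_univ s) fun i _ hi => by simp [hi]]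
  exact Finset.prod_congr rfl fun i hi => by simp [hi]

/-- The linear polynomials for interpolation at two points. -/
def lagrangeTwo (a b : ℝ) (j : Fin 2) (t : ℝ) : ℝ :=
  if j = 0 then (t - b) / (a - b) else (t - a) / (b - a)

/-- A polynomial of coordinate degree at most one is determined by its values at the corners of a
box. -/
lemma eq_sum_lagrange {p : (Fin d → ℝ) → ℝ} (hp : p ∈ multiaffine d) {a b : Fin d → ℝ}
    (hab : ∀ i, a i ≠ b i) (x : Fin d → ℝ) :
    p x = ∑ v : Fin d → Fin 2,
      p (fun i => if v i = 0 then a i else b i) * ∏ i, lagrangeTwo (a i) (b i) (v i) (x i) := by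
  classical
  refine multiaffine_induction (P := fun p => p x = ∑ v : Fin d → Fin 2,
      p (fun i => if v i = 0 then a i else b i) * ∏ i, lagrangeTwo (a i) (b i) (v i) (x i))
    (fun s => ?_) (by simp) (fun p _ q _ h1 h2 => ?_) (fun c p _ h => ?_) hp
  · set f : Fin d → ℝ → ℝ := fun i t => if i ∈ s then t else 1 with hf
    have hprod : ∀ y : Fin d → ℝ, ∏ i ∈ s, y i = ∏ i, f i (y i) := fun y => by
      rw [← Finset.prod_subset (Finset.subset_univ s) fun i _ hi => by simp [hf, hi]]
      exact Finset.prod_congr rfl fun i hi => by simp [hf, hi]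
    simp only [hprod, ← Finset.prod_mul_distrib]
    rw [← Fintype.piFinset_univ, ← Finset.prod_univ_sum (fun _ => Finset.univ)
      (fun i j => f i (if j = 0 then a i else b i) * lagrangeTwo (a i) (b i) j (x i))]
    refine Finset.prod_congr rfl fun i _ => ?_
    have h1 := sub_ne_zero.2 (hab i)
    have h2 := sub_ne_zero.2 (hab i).symm
    rw [Fin.sum_univ_two]
    simp only [hf, lagrangeTwo]
    split_ifs <;> simp_all
    · field_simp
      rw [← neg_sub (a i) (b i)]
      field_simp
      ring
    · rw [← neg_sub (a i) (b i)]
      field_simp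
      ring
  · simp only [Pi.add_apply, h1, h2, add_mul, Finset.sum_add_distrib]
  · simp only [Pi.smul_apply, smul_eq_mul, h, Finset.mul_sum, mul_assoc]

lemma eq_zero_of_corners {p : (Fin d → ℝ) → ℝ} (hp : p ∈ multiaffine d) {a b : Fin d → ℝ}
    (hab : ∀ i, a i ≠ b i) (h : ∀ x : Fin d → ℝ, (∀ i, x i = a i ∨ x i = b i) → p x = 0) :
    p = 0 := by
  ext x
  rw [eq_sum_lagrange hp hab x]
  refine Finset.sum_eq_zero fun v _ => ?_
  rw [h _ fun i => ?_, zero_mul]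
  by_cases hv : v i = 0 <;> simp [hv]

end Multiaffine

/-! ### The element-wise projection -/

section ElementProj

variable {d : ℕ} (T : CartesianMesh d) (K : Fin d → ℤ)

lemma integrableOn_cell {f : (Fin d → ℝ) → ℝ} (hf : Continuous f) :
    IntegrableOn f (T.cell K) :=
  hf.continuousOn.integrableOn_compact isCompact_Icc

lemma integrableOn_cell_mul {f g : (Fin d → ℝ) → ℝ} (hf : Continuous f) (hg : Continuous g) :
    IntegrableOn (fun x => f x * g x) (T.cell K) :=
  integrableOn_cell T K (hf.mul hg)

lemma eq_zero_of_integral_sq_eq_zero {q : (Fin d → ℝ) → ℝ} (hq : q ∈ multiaffine d)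
    (h : ∫ x in T.cell K, q x * q x = 0) : q = 0 := by
  have hc := continuous_of_mem_multiaffine hq
  have h1 := (integral_eq_zero_iff_of_nonneg (fun x => mul_self_nonneg (q x))
    (integrableOn_cell T K (hc.mul hc))).1 h
  set U : Set (Fin d → ℝ) := univ.pi fun i => Ioo (T.node K i) (T.node K i + T.size) with hU
  have hUo : IsOpen U := isOpen_set_pi finite_univ fun i _ => isOpen_Ioo
  have hUK : U ⊆ T.cell K := fun x hx => (T.mem_cell_iff K x).2 fun i =>
    ⟨(hx i trivial).1.le, (hx i trivial).2.le⟩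
  have h2 := Measure.eqOn_open_of_ae_eq (ae_restrict_of_ae_restrict_of_subset hUK h1) hUo
    (hc.mul hc).continuousOn continuousOn_const
  have hs := T.size_pos
  -- Vanishing on the open element includes the corners of a smaller box inside; the offsets 1/3 and
  -- 1/2 are arbitrary.
  refine eq_zero_of_corners hq (a := fun i => T.node K i + T.size / 3)
    (b := fun i => T.node K i + T.size / 2) (fun i => by simp; linarith) fun x hx => ?_
  refine mul_self_eq_zero.1 (h2 (x := x) fun i _ => ?_)
  rcases hx i with h | h <;> rw [h] <;> constructor <;> linarith

/-- Linear functionals on the polynomials of coordinate degree at most one are represented by such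
polynomials with respect to the `L²`-product on an element. -/
lemma exists_riesz_multiaffine (φ : multiaffine d →ₗ[ℝ] ℝ) :
    ∃ ψ : multiaffine d, ∀ p : multiaffine d,
      ∫ x in T.cell K, (ψ : (Fin d → ℝ) → ℝ) x * (p : (Fin d → ℝ) → ℝ) x = φ p := by
  have : FiniteDimensional ℝ (multiaffine d) := FiniteDimensional.span_of_finite ℝ (finite_range _)
  have hint : ∀ p q : multiaffine d, IntegrableOn
      (fun x => (p : (Fin d → ℝ) → ℝ) x * (q : (Fin d → ℝ) → ℝ) x) (T.cell K) := fun p q =>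
    integrableOn_cell T K ((continuous_of_mem_multiaffine p.2).mul
      (continuous_of_mem_multiaffine q.2))
  let B : multiaffine d →ₗ[ℝ] multiaffine d →ₗ[ℝ] ℝ := LinearMap.mk₂ ℝ
    (fun p q => ∫ x in T.cell K, (p : (Fin d → ℝ) → ℝ) x * (q : (Fin d → ℝ) → ℝ) x)
    (fun p p' q => by
      rw [← integral_add (hint p q) (hint p' q)]
      simp only [Submodule.coe_add, Pi.add_apply, add_mul])
    (fun c p q => by
      rw [smul_eq_mul, ← integral_const_mul]
      simp only [Submodule.coe_smul, Pi.smul_apply, smul_eq_mul, mul_assoc])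
    (fun p q q' => by
      rw [← integral_add (hint p q) (hint p q')]
      simp only [Submodule.coe_add, Pi.add_apply, mul_add])
    (fun c p q => by
      rw [smul_eq_mul, ← integral_const_mul]
      simp only [Submodule.coe_smul, Pi.smul_apply, smul_eq_mul, mul_left_comm])
  have hinj : Function.Injective B := by
    rw [injective_iff_map_eq_zero]
    intro q hq
    have := congrArg (fun f : multiaffine d →ₗ[ℝ] ℝ => f q) hq
    exact Subtype.ext (eq_zero_of_integral_sq_eq_zero T K q.2 this)
  have hsurj : Function.Surjective B :=
    (LinearMap.injective_iff_surjective_of_finrank_eq_finrank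
      (Subspace.dual_finrank_eq (K := ℝ) (V := multiaffine d)).symm).1 hinj
  obtain ⟨ψ, hψ⟩ := hsurj φ
  exact ⟨ψ, fun p => by rw [← hψ]; rfl⟩

variable {T K}

lemma IsElementProj.unique {v q q' : (Fin d → ℝ) → ℝ} (hv : Continuous v)
    (h : IsElementProj T K v q) (h' : IsElementProj T K v q') : q = q' := by
  have hm : q - q' ∈ multiaffine d := Submodule.sub_mem _ h.1 h'.1
  refine sub_eq_zero.1 (eq_zero_of_integral_sq_eq_zero T K hm ?_)
  have hc := continuous_of_mem_multiaffine h.1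
  have hc' := continuous_of_mem_multiaffine h'.1
  have h1 := h.2 _ hm
  have h2 := h'.2 _ hm
  have hcm : Continuous (q - q') := hc.sub hc'
  have h3 : ∀ x, (q - q') x * (q - q') x =
      (v x - q' x) * (q - q') x - (v x - q x) * (q - q') x := fun x => by
    simp only [Pi.sub_apply]; ring
  simp only [h3]
  rw [integral_sub (integrableOn_cell_mul T K (f := fun x => v x - q' x) (by fun_prop) hcm)
    (integrableOn_cell_mul T K (f := fun x => v x - q x) (by fun_prop) hcm), h1, h2, sub_zero]

lemma exists_isElementProj {v : (Fin d → ℝ) → ℝ} (hv : Continuous v) :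
    ∃ q, IsElementProj T K v q := by
  obtain ⟨ψ, hψ⟩ := exists_riesz_multiaffine T K
    { toFun := fun p => ∫ x in T.cell K, v x * (p : (Fin d → ℝ) → ℝ) x
      map_add' := fun p q => by
        rw [← integral_add (integrableOn_cell_mul T K hv (continuous_of_mem_multiaffine p.2))
          (integrableOn_cell_mul T K hv (continuous_of_mem_multiaffine q.2))]
        simp only [Submodule.coe_add, Pi.add_apply, mul_add]
      map_smul' := fun c p => by
        rw [smul_eq_mul, ← integral_const_mul]
        simp only [Submodule.coe_smul, Pi.smul_apply, smul_eq_mul, mul_left_comm,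
          RingHom.id_apply] }
  refine ⟨ψ, ψ.2, fun p hp => ?_⟩
  have hc := continuous_of_mem_multiaffine ψ.2
  have hcp := continuous_of_mem_multiaffine hp
  have h1 := hψ ⟨p, hp⟩
  simp only [sub_mul]
  rw [integral_sub (integrableOn_cell_mul T K hv hcp) (integrableOn_cell_mul T K hc hcp), h1]
  exact sub_self _

lemma isElementProj_elementProj {v : (Fin d → ℝ) → ℝ} (hv : Continuous v) :
    IsElementProj T K v (elementProj T K v) :=
  Classical.epsilon_spec (exists_isElementProj hv)

lemma IsElementProj.elementProj_eq {v q : (Fin d → ℝ) → ℝ} (hv : Continuous v)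
    (h : IsElementProj T K v q) : elementProj T K v = q :=
  (isElementProj_elementProj hv).unique hv h

lemma elementProj_eq_zero {v : (Fin d → ℝ) → ℝ} (hv : Continuous v)
    (h : ∀ x ∈ T.cell K, v x = 0) : elementProj T K v = 0 := by
  refine IsElementProj.elementProj_eq hv ⟨Submodule.zero_mem _, fun p _ => ?_⟩
  refine setIntegral_eq_zero_of_forall_eq_zero fun x hx => ?_
  rw [h x hx]; simp

lemma elementProj_sum_smul {ι : Type} (s : Finset ι) (c : ι → ℝ) {u : ι → (Fin d → ℝ) → ℝ}
    (hu : ∀ k, Continuous (u k)) :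
    elementProj T K (∑ k ∈ s, c k • u k) = ∑ k ∈ s, c k • elementProj T K (u k) := by
  have hcont : Continuous (∑ k ∈ s, c k • u k) := by
    convert continuous_finsetSum s fun k _ => (hu k).const_smul (c k) using 1
    ext x; simp
  refine IsElementProj.elementProj_eq hcont ⟨?_, fun p hp => ?_⟩
  · exact Submodule.sum_mem _ fun k _ =>
      Submodule.smul_mem _ _ (isElementProj_elementProj (hu k)).1
  · have h1 : ∀ x, ((∑ k ∈ s, c k • u k) x - (∑ k ∈ s, c k • elementProj T K (u k)) x) * p x =
        ∑ k ∈ s, c k * ((u k x - elementProj T K (u k) x) * p x) := fun x => by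
      simp only [Finset.sum_apply, Pi.smul_apply, smul_eq_mul]
      rw [← Finset.sum_sub_distrib, Finset.sum_mul]
      exact Finset.sum_congr rfl fun k _ => by ring
    simp only [h1]
    rw [integral_finsetSum]
    · refine Finset.sum_eq_zero fun k _ => ?_
      rw [integral_const_mul, (isElementProj_elementProj (hu k)).2 p hp, mul_zero]
    · intro k _
      exact (integrableOn_cell T K (((hu k).sub (continuous_of_mem_multiaffine
        (isElementProj_elementProj (hu k)).1)).mul (continuous_of_mem_multiaffine hp))).const_mul _

lemma CartesianMesh.add_mem_cell_iff (T : CartesianMesh d) (K s : Fin d → ℤ) (x : Fin d → ℝ) :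
    (x + fun i => T.size * (s i : ℝ)) ∈ T.cell (K + s) ↔ x ∈ T.cell K := by
  simp only [T.mem_cell_iff, T.node_add, Pi.add_apply]
  refine forall_congr' fun i => ?_
  constructor <;> rintro ⟨h1, h2⟩ <;> constructor <;> linarith

lemma elementProj_translate {v v' : (Fin d → ℝ) → ℝ} (hv : Continuous v) (hv' : Continuous v')
    {s : Fin d → ℤ} (h : ∀ x, v' (x + fun i => T.size * (s i : ℝ)) = v x) (x : Fin d → ℝ) :
    elementProj T (K + s) v' (x + fun i => T.size * (s i : ℝ)) = elementProj T K v x := by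
  set τ : Fin d → ℝ := fun i => T.size * (s i : ℝ) with hτ
  have hq := isElementProj_elementProj (T := T) (K := K) hv
  have : IsElementProj T (K + s) v' fun y => elementProj T K v (y + -τ) := by
    refine ⟨comp_add_mem_multiaffine hq.1 (-τ), fun p hp => ?_⟩
    rw [← hq.2 _ (comp_add_mem_multiaffine hp τ)]
    refine setIntegral_translate (τ := τ) (fun x => ?_) (fun x => T.add_mem_cell_iff K s x)
      (T.measurableSet_cell _) (T.measurableSet_cell _)
    simp only [h, add_neg_cancel_right]
  rw [this.elementProj_eq hv']
  simp only [add_neg_cancel_right]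

/-! ### The quasi-interpolation operator -/

lemma nodalAverage_sum_smul {ι : Type} (s : Finset ι) (c : ι → ℝ) {u : ι → (Fin d → ℝ) → ℝ}
    (hu : ∀ k, Continuous (u k)) (z : Fin d → ℤ) :
    nodalAverage T (∑ k ∈ s, c k • u k) z = ∑ k ∈ s, c k * nodalAverage T (u k) z := by
  unfold nodalAverage
  simp only [elementProj_sum_smul s c hu, Finset.sum_apply, Pi.smul_apply, smul_eq_mul]
  rw [Finset.sum_comm, Finset.sum_div]
  exact Finset.sum_congr rfl fun k _ => by rw [← Finset.mul_sum, mul_div_assoc]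

lemma quasiInterp_node {z : Fin d → ℤ} (hz : T.node z ∈ T.domain) (v : (Fin d → ℝ) → ℝ) :
    quasiInterp T v (T.node z) = nodalAverage T v z := by
  unfold quasiInterp
  rw [finsum_eq_single _ ⟨z, hz⟩]
  · simp [T.hat_node]
  · intro z' hz'
    rw [T.hat_node, if_neg, mul_zero]
    exact fun h => hz' (Subtype.ext h)

lemma quasiInterp_eq_zero_iff (v : (Fin d → ℝ) → ℝ) :
    quasiInterp T v = 0 ↔ ∀ z, T.node z ∈ T.domain → nodalAverage T v z = 0 := by
  constructor
  · intro h z hz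
    rw [← quasiInterp_node hz, h]; rfl
  · intro h
    ext x
    unfold quasiInterp
    rw [Pi.zero_apply]
    convert finsum_zero with z
    rw [h z z.2, zero_mul]

/-! ### Moments of hat functions -/

lemma hasCompactSupport_tent_scale (c : ℝ) {h : ℝ} (hh : 0 < h) :
    HasCompactSupport fun t : ℝ => tent ((t - c) / h) := by
  refine HasCompactSupport.of_support_subset_isCompact (K := Metric.closedBall c h)
    (isCompact_closedBall _ _) fun t ht => ?_
  have := (tent_nonneg _).lt_of_ne' ht
  rw [tent_pos_iff, abs_div, abs_of_pos hh, div_lt_one hh] at this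
  rw [Metric.mem_closedBall, Real.dist_eq]; exact this.le

lemma integral_tent_scale_pos (c : ℝ) {h : ℝ} (hh : 0 < h) :
    0 < ∫ t : ℝ, tent ((t - c) / h) := by
  refine Continuous.integral_pos_of_hasCompactSupport_nonneg_nonzero (x := c) (by fun_prop)
    (hasCompactSupport_tent_scale c hh) (fun t => tent_nonneg _) ?_
  simp [tent]

/-- The hat is even about c, hence orthogonal to t − c. -/
lemma integral_tent_scale_mul (c : ℝ) {h : ℝ} (hh : 0 < h) :
    ∫ t : ℝ, tent ((t - c) / h) * t = c * ∫ t : ℝ, tent ((t - c) / h) := by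
  have hc := hasCompactSupport_tent_scale c hh
  have hcont : Continuous fun t : ℝ => tent ((t - c) / h) := by fun_prop
  have hodd : ∫ t : ℝ, tent ((t - c) / h) * (t - c) = 0 := by
    rw [integral_sub_right_eq_self (fun t => tent (t / h) * t) c]
    have h1 := integral_neg_eq_self (fun t : ℝ => tent (t / h) * t) volume
    simp only [neg_div, tent_neg, mul_neg, integral_neg] at h1
    linarith
  rw [← integral_const_mul, ← sub_eq_zero, ← integral_sub, ← hodd]
  · congr 1; ext t; ring
  · exact (hcont.mul continuous_id).integrable_of_hasCompactSupport hc.mul_right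
  · exact (hcont.integrable_of_hasCompactSupport hc).const_mul c

/-- Hat functions integrate polynomials of coordinate degree at most one like a point mass. -/
lemma exists_integral_hat_mul (T : CartesianMesh d) (z : Fin d → ℤ) :
    ∃ m : ℝ, 0 < m ∧ ∀ p ∈ multiaffine d, ∫ x, T.hat z x * p x = m * p (T.node z) := by
  classical
  refine ⟨∏ i, ∫ t : ℝ, tent ((t - T.node z i) / T.size),
    Finset.prod_pos fun i _ => integral_tent_scale_pos _ T.size_pos, fun p hp => ?_⟩
  have hint : ∀ q ∈ multiaffine d, Integrable fun x => T.hat z x * q x := fun q hq =>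
    ((T.isLip_hat z).continuous.mul
      (continuous_of_mem_multiaffine hq)).integrable_of_hasCompactSupport
      (T.hasCompactSupport_hat z).mul_right
  refine multiaffine_induction (P := fun p => ∫ x, T.hat z x * p x =
    (∏ i, ∫ t : ℝ, tent ((t - T.node z i) / T.size)) * p (T.node z)) (fun s => ?_) (by simp)
    (fun p hp q hq h1 h2 => ?_) (fun c p hp h => ?_) hp
  · set f : Fin d → ℝ → ℝ := fun i t => tent ((t - T.node z i) / T.size) * if i ∈ s then t else 1
    have h1 : ∀ x, T.hat z x * ∏ i ∈ s, x i = ∏ i, f i (x i) := fun x => by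
      rw [T.hat_eq_prod, Finset.prod_mul_distrib]
      congr 1
      rw [← Finset.prod_subset (Finset.subset_univ s) fun i _ hi => by simp [hi]]
      exact Finset.prod_congr rfl fun i hi => by simp [hi]
    simp only [h1]
    have h2 : ∏ i ∈ s, T.node z i = ∏ i, if i ∈ s then T.node z i else 1 := by
      rw [Finset.prod_ite_mem, Finset.univ_inter]
    rw [integral_fintype_prod_volume_eq_prod, h2, ← Finset.prod_mul_distrib]
    refine Finset.prod_congr rfl fun i _ => ?_
    simp only [f]
    split_ifs
    · rw [integral_tent_scale_mul _ T.size_pos, mul_comm]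
    · simp only [mul_one]
  · simp only [Pi.add_apply, mul_add]
    rw [integral_add (hint p hp) (hint q hq), h1, h2]
  · simp only [Pi.smul_apply, smul_eq_mul]
    rw [mul_left_comm, ← h, ← integral_const_mul]
    simp only [mul_left_comm]

end ElementProj

/-! ### The geometry of patches -/

section Patches

variable {d : ℕ}

namespace CartesianMesh

variable (T : CartesianMesh d)

/-- The closed cube of `j` layers of elements around the element `K`. -/
def box (K : Fin d → ℤ) (j : ℕ) : Set (Fin d → ℝ) :=
  {x | ∀ i, T.node K i - j * T.size ≤ x i ∧ x i ≤ T.node K i + (j + 1) * T.size}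

lemma node_apply (z : Fin d → ℤ) (i : Fin d) : T.node z i = T.origin i + T.size * z i := rfl

lemma box_zero (K : Fin d → ℤ) : T.box K 0 = T.cell K := by
  ext x; rw [mem_cell_iff]; simp [box]

lemma box_eq_Icc (K : Fin d → ℤ) (j : ℕ) : T.box K j =
    Icc (fun i => T.node K i - j * T.size) (fun i => T.node K i + (j + 1) * T.size) := by
  ext x; simp [box, Pi.le_def, forall_and]

lemma isClosed_box (K : Fin d → ℤ) (j : ℕ) : IsClosed (T.box K j) := by
  rw [box_eq_Icc]; exact isClosed_Icc

lemma isCompact_box (K : Fin d → ℤ) (j : ℕ) : IsCompact (T.box K j) := by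
  rw [box_eq_Icc]; exact isCompact_Icc

/-- On the upper faces of the region the floor of the coordinates would leave the range of indices.
It is cut off at `b`, and the closed cell still contains the point. -/
lemma exists_cell_of_mem {a b : Fin d → ℤ} (hab : ∀ i, a i ≤ b i) {x : Fin d → ℝ}
    (hx : ∀ i, T.node a i ≤ x i ∧ x i ≤ T.node b i + T.size) :
    ∃ z, (∀ i, a i ≤ z i ∧ z i ≤ b i) ∧ x ∈ T.cell z := by
  have hs := T.size_pos
  refine ⟨fun i => min ⌊(x i - T.origin i) / T.size⌋ (b i), fun i => ⟨le_min ?_ (hab i),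
    min_le_right _ _⟩, (T.mem_cell_iff _ _).2 fun i => ?_⟩
  · rw [Int.le_floor, le_div_iff₀ hs]
    have := (hx i).1
    rw [node_apply] at this
    linarith
  · have h1 := Int.floor_le ((x i - T.origin i) / T.size)
    have h2 := Int.lt_floor_add_one ((x i - T.origin i) / T.size)
    have h3 := (hx i).2
    rw [node_apply] at h3
    rw [le_div_iff₀ hs] at h1
    rw [div_lt_iff₀ hs] at h2
    simp only [node_apply]
    rcases min_cases ⌊(x i - T.origin i) / T.size⌋ (b i) with ⟨h, _⟩ | ⟨h, h4⟩ <;> rw [h]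
    · constructor <;> linarith
    · refine ⟨?_, by linarith⟩
      have h5 : (b i : ℝ) ≤ ⌊(x i - T.origin i) / T.size⌋ := by exact_mod_cast h4.le
      nlinarith

lemma nbhd_box {K : Fin d → ℤ} {j : ℕ}
    (h : ∀ z : Fin d → ℤ, (∀ i, |z i - K i| ≤ (j : ℤ) + 1) → z ∈ T.cells) :
    T.nbhd (T.box K j) = T.box K (j + 1) := by
  have hs := T.size_pos
  ext x
  simp only [nbhd, (T.isClosed_box K j).closure_eq, mem_iUnion, mem_ofPred_eq, exists_prop]
  constructor
  · rintro ⟨z, ⟨_, y, hy, hyz⟩, hx⟩ i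
    rw [mem_cell_iff] at hx hyz
    have h1 := hy i
    have h2 := hyz i
    have h3 := hx i
    simp only [node_apply] at h1 h2 h3 ⊢
    have h4 : (z i : ℝ) ≤ K i + (j + 1) := by
      refine le_of_mul_le_mul_left ?_ hs
      linarith
    have h5 : (K i : ℝ) - j ≤ z i + 1 := by
      refine le_of_mul_le_mul_left ?_ hs
      linarith
    push_cast
    constructor <;> nlinarith
  · intro hx
    have hab : ∀ i, K i - (j + 1) ≤ K i + (j + 1) := fun i => by lia
    obtain ⟨z, hz, hxz⟩ := T.exists_cell_of_mem (a := fun i => K i - (j + 1))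
      (b := fun i => K i + (j + 1)) hab (x := x) fun i => by
        have := hx i
        simp only [node_apply] at this ⊢
        push_cast at this ⊢
        constructor <;> nlinarith
    -- A common point of the cell and the old box: coordinatewise the larger of their two lower
    -- ends.
    refine ⟨z, ⟨h z fun i => abs_le.2 ⟨by have := hz i; lia, by have := hz i; lia⟩,
      fun i => max (T.node z i) (T.node K i - j * T.size), fun i => ⟨le_max_right _ _, ?_⟩,
      (T.mem_cell_iff _ _).2 fun i => ⟨le_max_left _ _, ?_⟩⟩, hxz⟩
    · have h1 : (z i : ℝ) ≤ K i + (j + 1) := by exact_mod_cast (hz i).2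
      refine max_le ?_ ?_
      · simp only [node_apply]; nlinarith
      · have : (0 : ℝ) ≤ j := Nat.cast_nonneg j
        nlinarith
    · have h1 : (K i : ℝ) - (j + 1) ≤ z i := by exact_mod_cast (hz i).1
      refine max_le (by linarith) ?_
      simp only [node_apply]; nlinarith

variable {T} {ℓ : ℕ} {K : Fin d → ℤ}

lemma IsInterior.patch_eq (hK : T.IsInterior ℓ K) : T.patch ℓ K = T.box K ℓ := by
  have : ∀ j ≤ ℓ, T.nbhd^[j] (T.cell K) = T.box K j := by
    intro j hj
    induction j with
    | zero => rw [box_zero]; rfl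
    | succ j ih =>
      rw [Function.iterate_succ_apply', ih (by lia)]
      refine T.nbhd_box fun z hz => hK z fun i => (hz i).trans ?_
      have : (j : ℤ) + 1 ≤ ℓ := by exact_mod_cast hj
      lia
  exact this ℓ le_rfl

/-- Here the additional layer in `IsInterior` is used: an open cube around the closed patch is
covered by elements. In particular the coarse nodes on the boundary of the patch are inner nodes of
the mesh. -/
lemma IsInterior.box_subset_domain (hK : T.IsInterior ℓ K) : T.box K ℓ ⊆ T.domain := by
  have hs := T.size_pos
  set U : Set (Fin d → ℝ) := univ.pi fun i =>
    Ioo (T.node K i - (ℓ + 1) * T.size) (T.node K i + (ℓ + 2) * T.size) with hU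
  have hUo : IsOpen U := isOpen_set_pi finite_univ fun i _ => isOpen_Ioo
  have hsub : U ⊆ ⋃ K ∈ T.cells, T.cell K := fun x hx => by
    obtain ⟨z, hz, hxz⟩ := T.exists_cell_of_mem (a := fun i => K i - (ℓ + 1))
      (b := fun i => K i + (ℓ + 1)) (fun i => by lia) (x := x) fun i => by
        have := hx i trivial
        simp only [node_apply, mem_Ioo] at this ⊢
        push_cast
        constructor <;> nlinarith
    exact mem_biUnion (hK z fun i => abs_le.2 ⟨by have := hz i; lia, by have := hz i; lia⟩) hxz
  refine Subset.trans ?_ (interior_maximal hsub hUo)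
  intro x hx i _
  have := hx i
  constructor <;> linarith

lemma volume_domain_ne_top (T : CartesianMesh d) : volume T.domain ≠ ⊤ := by
  refine measure_ne_top_of_subset interior_subset ?_
  exact (T.cells.isCompact_biUnion fun K _ => isCompact_Icc).measure_lt_top.ne

lemma isOpen_domain (T : CartesianMesh d) : IsOpen T.domain := isOpen_interior

end CartesianMesh

/-! ### Fine functions on a patch -/

section FineFunctions

variable {T : CartesianMesh d} {r : ℕ} {hr : 0 < r} {ℓ : ℕ} {K : Fin d → ℤ}

/-- The enumeration of the inner fine nodes of a patch. -/
abbrev FineIdx (d r ℓ : ℕ) : Type := Fin d → Fin ((2 * ℓ + 1) * r - 1)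

variable (T r hr ℓ K) in
/-- The fine nodal basis functions of a patch. -/
def fineHat (k : FineIdx d r ℓ) : (Fin d → ℝ) → ℝ := (T.refine r hr).hat (fineNode r ℓ K k)

variable (T r hr ℓ K) in
/-- The fine finite element function on a patch with given nodal values. -/
def fineFun (x : FineIdx d r ℓ → ℝ) : (Fin d → ℝ) → ℝ := ∑ k, x k • fineHat T r hr ℓ K k

lemma isLip_fineHat (k : FineIdx d r ℓ) : IsLip (fineHat T r hr ℓ K k) := CartesianMesh.isLip_hat _ _

lemma isLip_fineFun (x : FineIdx d r ℓ → ℝ) : IsLip (fineFun T r hr ℓ K x) :=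
  IsLip.sum_smul x fun k _ => isLip_fineHat k

lemma refine_node_apply (z : Fin d → ℤ) (i : Fin d) :
    (T.refine r hr).node z i = T.origin i + T.size / r * z i := rfl

lemma fineNode_injective : Function.Injective (fineNode r ℓ K (d := d)) := fun a b h => by
  ext i
  have := congrFun h i
  simp only [fineNode] at this
  lia

lemma exists_fineNode_eq_iff (z : Fin d → ℤ) : (∃ k, fineNode r ℓ K k = z) ↔
    ∀ i, T.node K i - ℓ * T.size < (T.refine r hr).node z i ∧
      (T.refine r hr).node z i < T.node K i + (ℓ + 1) * T.size := by
  have hs := T.size_pos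
  have hr0 : (0 : ℝ) < r := by exact_mod_cast hr
  have key : ∀ i, (T.node K i - ℓ * T.size < (T.refine r hr).node z i ∧
      (T.refine r hr).node z i < T.node K i + (ℓ + 1) * T.size) ↔
      (r : ℤ) * (K i - ℓ) < z i ∧ z i < r * (K i + ℓ + 1) := fun i => by
    rw [refine_node_apply, CartesianMesh.node_apply]
    have e1 : T.size / r * z i = (T.size / r) * (z i : ℝ) := rfl
    have hq : 0 < T.size / r := by positivity
    have e2 : T.size = T.size / r * r := by field_simp
    have h1 : T.origin i + T.size * K i - ℓ * T.size < T.origin i + T.size / r * z i ↔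
        ((r : ℝ) * (K i - ℓ)) < z i := by
      rw [← mul_lt_mul_iff_right₀ hq (b := (r : ℝ) * (K i - ℓ))]
      have : T.size / r * (r * ((K i : ℝ) - ℓ)) = T.size * K i - ℓ * T.size := by
        field_simp
      rw [this]
      constructor <;> intro h <;> linarith
    have h2 : T.origin i + T.size / r * z i < T.origin i + T.size * K i + (ℓ + 1) * T.size ↔
        (z i : ℝ) < r * (K i + ℓ + 1) := by
      rw [← mul_lt_mul_iff_right₀ hq (b := (z i : ℝ))]
      have : T.size / r * (r * ((K i : ℝ) + ℓ + 1)) = T.size * K i + (ℓ + 1) * T.size := by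
        field_simp; ring
      rw [this]
      constructor <;> intro h <;> linarith
    rw [h1, h2]
    norm_cast
  simp only [key]
  constructor
  · rintro ⟨k, rfl⟩ i
    have hk := (k i).2
    simp only [fineNode]
    zify [show 1 ≤ (2 * ℓ + 1) * r from Nat.mul_pos (by lia) hr] at hk
    constructor
    · lia
    · nlinarith
  · intro h
    have hlt : ∀ i, (z i - (r * (K i - ℓ) + 1)).toNat < (2 * ℓ + 1) * r - 1 := fun i => by
      have h1 := (h i).1
      have h2 := (h i).2
      zify [show 1 ≤ (2 * ℓ + 1) * r from Nat.mul_pos (by lia) hr]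
      rw [Int.toNat_of_nonneg (by lia)]
      nlinarith
    refine ⟨fun i => ⟨(z i - (r * (K i - ℓ) + 1)).toNat, hlt i⟩, funext fun i => ?_⟩
    simp only [fineNode]
    rw [Int.toNat_of_nonneg (by have := (h i).1; lia)]
    ring

lemma fineNode_mem_box (k : FineIdx d r ℓ) :
    (T.refine r hr).node (fineNode r ℓ K k) ∈ T.box K ℓ := fun i =>
  ⟨((exists_fineNode_eq_iff _).1 ⟨k, rfl⟩ i).1.le, ((exists_fineNode_eq_iff _).1 ⟨k, rfl⟩ i).2.le⟩

/-- A fine hat function of a patch vanishes outside the open patch. -/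
lemma fineHat_eq_zero (k : FineIdx d r ℓ) {x : Fin d → ℝ} {i : Fin d}
    (hx : x i ≤ T.node K i - ℓ * T.size ∨ T.node K i + (ℓ + 1) * T.size ≤ x i) :
    fineHat T r hr ℓ K k x = 0 := by
  by_contra h0
  have h1 := abs_lt.1 (((T.refine r hr).hat_ne_zero_iff _ _).1 h0 i)
  have hs := T.size_pos
  have hr0 : (0 : ℝ) < r := by exact_mod_cast hr
  have hq : 0 < T.size / r := by positivity
  have hsz : (T.refine r hr).size = T.size / r := rfl
  rw [hsz, refine_node_apply] at h1
  have hk := (k i).2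
  simp only [fineNode] at h1
  rw [CartesianMesh.node_apply] at hx
  have hk2 : ((k i : ℕ) : ℝ) + 2 ≤ (2 * ℓ + 1) * r := by
    have : (k i : ℕ) + 2 ≤ (2 * ℓ + 1) * r := by lia
    exact_mod_cast this
  have hk0 : (0 : ℝ) ≤ ((k i : ℕ) : ℝ) := Nat.cast_nonneg _
  push_cast at h1
  have e1 : T.size / r * (r * ((K i : ℝ) - ℓ) + 1 + (k i : ℕ)) =
      T.size * K i - ℓ * T.size + T.size / r * (1 + (k i : ℕ)) := by
    field_simp; ring
  rw [e1] at h1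
  rcases hx with hx | hx
  · nlinarith
  · have e2 : T.size / r * ((2 * ℓ + 1) * r) = (2 * ℓ + 1) * T.size := by field_simp
    nlinarith

lemma fineHat_eq_zero_of_notMem (k : FineIdx d r ℓ) {x : Fin d → ℝ} (hx : x ∉ T.box K ℓ) :
    fineHat T r hr ℓ K k x = 0 := by
  simp only [CartesianMesh.box, mem_ofPred_eq, not_forall, not_and_or, not_le] at hx
  obtain ⟨i, hi | hi⟩ := hx
  · exact fineHat_eq_zero k (.inl hi.le)
  · exact fineHat_eq_zero k (.inr hi.le)

lemma fineFun_apply (x : FineIdx d r ℓ → ℝ) (y : Fin d → ℝ) :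
    fineFun T r hr ℓ K x y = ∑ k, x k * fineHat T r hr ℓ K k y := by
  simp [fineFun]

lemma fineFun_eq_zero (x : FineIdx d r ℓ → ℝ) {y : Fin d → ℝ} {i : Fin d}
    (hy : y i ≤ T.node K i - ℓ * T.size ∨ T.node K i + (ℓ + 1) * T.size ≤ y i) :
    fineFun T r hr ℓ K x y = 0 := by
  rw [fineFun_apply]
  exact Finset.sum_eq_zero fun k _ => by rw [fineHat_eq_zero k hy, mul_zero]

lemma fineFun_eq_zero_of_notMem (x : FineIdx d r ℓ → ℝ) {y : Fin d → ℝ} (hy : y ∉ T.box K ℓ) :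
    fineFun T r hr ℓ K x y = 0 := by
  rw [fineFun_apply]
  exact Finset.sum_eq_zero fun k _ => by rw [fineHat_eq_zero_of_notMem k hy, mul_zero]

lemma hasCompactSupport_fineFun (x : FineIdx d r ℓ → ℝ) :
    HasCompactSupport (fineFun T r hr ℓ K x) :=
  HasCompactSupport.of_support_subset_isCompact (T.isCompact_box K ℓ) fun y hy => by
    by_contra h
    exact hy (fineFun_eq_zero_of_notMem x h)

lemma fineFun_node (x : FineIdx d r ℓ → ℝ) (k : FineIdx d r ℓ) :
    fineFun T r hr ℓ K x ((T.refine r hr).node (fineNode r ℓ K k)) = x k := by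
  rw [fineFun_apply]
  simp only [fineHat, CartesianMesh.hat_node, fineNode_injective.eq_iff]
  simp

lemma fineFun_mem_feSpace (hK : T.IsInterior ℓ K) (x : FineIdx d r ℓ → ℝ) :
    fineFun T r hr ℓ K x ∈ (T.refine r hr).feSpace T.domain :=
  Submodule.sum_mem _ fun k _ => Submodule.smul_mem _ _ (Submodule.subset_span
    ⟨_, hK.box_subset_domain (fineNode_mem_box k), rfl⟩)

/-- On the boundary of the box the support condition says nothing. But a step from y in the
direction ±e_i leaves the box at once, and w is continuous. -/
lemma eq_zero_of_support_subset_box {w : (Fin d → ℝ) → ℝ} (hw : Continuous w)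
    (hs : Function.support w ⊆ T.box K ℓ) {y : Fin d → ℝ} {i : Fin d}
    (hy : y i ≤ T.node K i - ℓ * T.size ∨ T.node K i + (ℓ + 1) * T.size ≤ y i) : w y = 0 := by
  have hz : ∀ y ∉ T.box K ℓ, w y = 0 := fun y hy => by
    by_contra h; exact hy (hs h)
  set c : ℝ := if y i ≤ T.node K i - ℓ * T.size then -1 else 1 with hc
  have hlim : Filter.Tendsto (fun t : ℝ => w (y + t • Pi.single i c)) (nhdsWithin 0 (Ioi 0))
      (nhds (w y)) := by
    have : Continuous fun t : ℝ => w (y + t • Pi.single i c) := by fun_prop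
    have := this.tendsto 0
    simp only [zero_smul, add_zero] at this
    exact this.mono_left nhdsWithin_le_nhds
  refine tendsto_nhds_unique hlim (tendsto_const_nhds.congr' ?_)
  filter_upwards [self_mem_nhdsWithin] with t ht
  have ht' : 0 < t := ht
  refine (hz _ fun hmem => ?_).symm
  have h1 := hmem i
  simp only [Pi.add_apply, Pi.smul_apply, Pi.single_eq_same, smul_eq_mul, hc] at h1
  split_ifs at h1 with h
  · linarith
  · rcases hy with hy | hy
    · exact h hy
    · linarith

/-- A fine finite element function with support in a patch is a combination of the fine hat
functions of the patch. -/
lemma exists_eq_fineFun {w : (Fin d → ℝ) → ℝ} (hw : w ∈ (T.refine r hr).feSpace T.domain)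
    (hs : Function.support w ⊆ T.box K ℓ) : ∃ x, w = fineFun T r hr ℓ K x := by
  classical
  obtain ⟨c, -, rfl⟩ := (Finsupp.mem_span_image_iff_linearCombination ℝ).1 hw
  set w := Finsupp.linearCombination ℝ (T.refine r hr).hat c with hwdef
  have hsum : ∀ y, w y = ∑ z ∈ c.support, c z * (T.refine r hr).hat z y := fun y => by
    rw [hwdef, Finsupp.linearCombination_apply, Finsupp.sum, Finset.sum_apply]
    simp
  have hval : ∀ z, w ((T.refine r hr).node z) = c z := fun z => by
    rw [hsum]
    simp only [CartesianMesh.hat_node, mul_ite, mul_one, mul_zero, Finset.sum_ite_eq',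
      Finsupp.mem_support_iff]
    split_ifs with h
    · rfl
    · exact (not_not.1 h).symm
  have hcont : Continuous w := by
    have : w = ∑ z ∈ c.support, c z • (T.refine r hr).hat z := by
      ext y; rw [hsum]; simp
    rw [this]
    exact (IsLip.sum_smul _ fun z _ => CartesianMesh.isLip_hat _ z).continuous
  refine ⟨fun k => c (fineNode r ℓ K k), funext fun y => ?_⟩
  have himg : ∑ k, c (fineNode r ℓ K k) * fineHat T r hr ℓ K k y =
      ∑ z ∈ Finset.univ.image (fineNode r ℓ K (d := d)), c z * (T.refine r hr).hat z y := by
    rw [Finset.sum_image fun a _ b _ h => fineNode_injective h]; rfl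
  rw [fineFun_apply, himg, hsum]
  symm
  refine Finset.sum_subset_zero_on_sdiff ?_ ?_ ?_ |>.symm
  -- The coefficient of a node is the nodal value of w, which is zero outside the open patch.
  · intro z hz
    have hz0 : c z ≠ 0 := Finsupp.mem_support_iff.1 hz
    by_contra hcon
    refine hz0 ?_
    rw [← hval]
    have : ¬ ∃ k, fineNode r ℓ K k = z := fun ⟨k, hk⟩ =>
      hcon (Finset.mem_image.2 ⟨k, Finset.mem_univ k, hk⟩)
    rw [exists_fineNode_eq_iff (T := T) (hr := hr)] at this
    simp only [not_forall, not_and_or, not_lt] at this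
    obtain ⟨i, hi⟩ := this
    exact eq_zero_of_support_subset_box hcont hs hi
  · intro z hz
    rw [Finsupp.notMem_support_iff.1 (Finset.mem_sdiff.1 hz).2, zero_mul]
  · exact fun _ _ => rfl

/-! ### The kernel of the quasi-interpolation -/

lemma coarseNode_mem_box (i : Fin d → Fin (2 * ℓ + 2)) :
    T.node (coarseNode ℓ K i) ∈ T.box K ℓ := fun a => by
  have hs := T.size_pos
  have hi : ((i a : ℕ) : ℝ) ≤ 2 * ℓ + 1 := by
    have : (i a : ℕ) ≤ 2 * ℓ + 1 := by lia
    exact_mod_cast this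
  have h0 : (0 : ℝ) ≤ ((i a : ℕ) : ℝ) := Nat.cast_nonneg _
  simp only [CartesianMesh.node_apply, coarseNode]
  push_cast
  constructor <;> nlinarith

lemma mem_cellsAt {z K' : Fin d → ℤ} :
    K' ∈ cellsAt T z ↔ K' ∈ T.cells ∧ ∀ i, K' i ≤ z i ∧ z i ≤ K' i + 1 := by
  classical
  unfold cellsAt
  rw [Finset.mem_filter, T.node_mem_cell_iff]

/-- All elements at such a node lie outside the open patch, where the function vanishes. So coarse
nodes away from the patch impose no condition on a fine function of the patch. -/
lemma nodalAverage_fineFun_eq_zero (x : FineIdx d r ℓ → ℝ) {z : Fin d → ℤ}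
    (hz : ∀ i : Fin d → Fin (2 * ℓ + 2), coarseNode ℓ K i ≠ z) :
    nodalAverage T (fineFun T r hr ℓ K x) z = 0 := by
  have hs := T.size_pos
  obtain ⟨a, ha⟩ : ∃ a, z a < K a - ℓ ∨ K a + ℓ + 1 < z a := by
    by_contra! h
    refine hz (fun a => ⟨(z a - (K a - ℓ)).toNat, ?_⟩) (funext fun a => ?_)
    · have := h a; lia
    · simp only [coarseNode]
      have := h a; lia
  unfold nodalAverage
  rw [Finset.sum_eq_zero fun K' hK' => ?_, zero_div]
  have h1 := (mem_cellsAt.1 hK').2 a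
  rw [elementProj_eq_zero (isLip_fineFun x).continuous fun y hy => ?_]
  · rfl
  · refine fineFun_eq_zero x (i := a) ?_
    have h2 := (T.mem_cell_iff _ _).1 hy a
    simp only [CartesianMesh.node_apply] at h2 ⊢
    rcases ha with ha | ha
    · left
      have : (K' a : ℝ) + 1 ≤ K a - ℓ := by
        have : K' a + 1 ≤ K a - ℓ := by lia
        exact_mod_cast this
      nlinarith
    · right
      have : (K a : ℝ) + ℓ + 1 ≤ K' a := by
        have : K a + ℓ + 1 ≤ K' a := by lia
        exact_mod_cast this
      nlinarith

lemma interpMat_mulVec (hK : T.IsInterior ℓ K) (x : FineIdx d r ℓ → ℝ)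
    (i : Fin d → Fin (2 * ℓ + 2)) :
    (interpMat T r hr ℓ K).mulVec x i =
      nodalAverage T (fineFun T r hr ℓ K x) (coarseNode ℓ K i) := by
  unfold fineFun
  rw [nodalAverage_sum_smul _ _ fun k => (isLip_fineHat k).continuous]
  simp only [Matrix.mulVec, dotProduct, interpMat, Matrix.of_apply]
  refine Finset.sum_congr rfl fun k _ => ?_
  rw [quasiInterp_node (hK.box_subset_domain (coarseNode_mem_box i)), mul_comm]
  rfl

/-- The fine-scale space becomes the kernel of a matrix. Its rows include the nodes on the boundary
of the patch, where the quasi-interpolant of a function supported in the patch need not vanish. -/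
lemma mem_fineScaleSpace_iff (hK : T.IsInterior ℓ K) (w : (Fin d → ℝ) → ℝ) :
    w ∈ fineScaleSpace T (T.refine r hr) (T.patch ℓ K) ↔
      ∃ x, w = fineFun T r hr ℓ K x ∧ (interpMat T r hr ℓ K).mulVec x = 0 := by
  unfold fineScaleSpace
  rw [mem_ofPred_eq, hK.patch_eq]
  constructor
  · rintro ⟨h1, h2, h3⟩
    obtain ⟨x, rfl⟩ := exists_eq_fineFun h1 h3
    refine ⟨x, rfl, funext fun i => ?_⟩
    rw [interpMat_mulVec hK]
    exact (quasiInterp_eq_zero_iff _).1 h2 _ (hK.box_subset_domain (coarseNode_mem_box i))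
  · rintro ⟨x, rfl, hx⟩
    refine ⟨fineFun_mem_feSpace hK x, (quasiInterp_eq_zero_iff _).2 fun z _ => ?_, fun y hy => ?_⟩
    · by_cases hz : ∃ i : Fin d → Fin (2 * ℓ + 2), coarseNode ℓ K i = z
      · obtain ⟨i, rfl⟩ := hz
        rw [← interpMat_mulVec hK, hx]; rfl
      · exact nodalAverage_fineFun_eq_zero x fun i hi => hz ⟨i, hi⟩
    · by_contra h
      exact hy (fineFun_eq_zero_of_notMem x h)

end FineFunctions

end Patches

section PatchMatrices

variable {d : ℕ} {T : CartesianMesh d} {r : ℕ} {hr : 0 < r} {ℓ : ℕ} {K : Fin d → ℤ}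

/-! ### The stiffness matrix of a patch -/

lemma dotProduct_stiffness {A : (Fin d → ℝ) → ℝ} (hA : BddCoeff T.domain A)
    (x y : FineIdx d r ℓ → ℝ) :
    x ⬝ᵥ (stiffness T r hr ℓ K A).mulVec y =
      energy T.domain A (fineFun T r hr ℓ K x) (fineFun T r hr ℓ K y) := by
  conv_rhs => rw [fineFun, hA.energy_sum_left _ _ (fun k => isLip_fineHat k) (isLip_fineFun y)]
  simp only [dotProduct, Matrix.mulVec]
  refine Finset.sum_congr rfl fun k _ => ?_
  rw [fineFun, hA.energy_sum_right _ _ (fun k => isLip_fineHat k) (isLip_fineHat k)]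
  congr 1
  exact Finset.sum_congr rfl fun l _ => mul_comm _ _

lemma stiffness_isSymm (A : (Fin d → ℝ) → ℝ) : (stiffness T r hr ℓ K A).IsSymm := by
  ext k l
  exact energy_comm _ _ _ _

lemma energy_fineFun_pos (hd : 1 ≤ d) (hK : T.IsInterior ℓ K) {A : (Fin d → ℝ) → ℝ}
    (hA : BddCoeff T.domain A) {α : ℝ} (hα : 0 < α)
    (h : ∀ᵐ x ∂(volume.restrict T.domain), α ≤ A x) {x : FineIdx d r ℓ → ℝ} (hx : x ≠ 0) :
    0 < energy T.domain A (fineFun T r hr ℓ K x) (fineFun T r hr ℓ K x) := by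
  set w := fineFun T r hr ℓ K x with hw
  have hwl : IsLip w := isLip_fineFun x
  have h1 := energy_mono_coeff (bddCoeff_const hA.1 α) hA hwl h
  rw [energy_const] at h1
  have h2 : 0 ≤ energy T.domain (fun _ => 1) w w :=
    energy_self_nonneg (.of_forall fun _ => zero_le_one)
  refine lt_of_lt_of_le (mul_pos hα (h2.lt_of_ne' fun h0 => hx ?_)) h1
  simp only [energy_eq, one_mul] at h0
  have hint : IntegrableOn (gradDot w w) T.domain := by
    simpa only [one_mul] using (bddCoeff_const hA.1 1).integrable hwl hwl
  have h3 := (setIntegral_eq_zero_iff_of_nonneg_ae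
    (.of_forall fun x => gradDot_self_nonneg w x) hint).1 h0
  have h4 : ∀ᵐ x ∂(volume : Measure (Fin d → ℝ)), gradDot w w x = 0 := by
    have h5 := (ae_restrict_iff' T.isOpen_domain.measurableSet).1 h3
    filter_upwards [h5] with y hy
    by_cases hyD : y ∈ T.domain
    · exact hy hyD
    · exact gradDot_eq_zero_of_notMem (T.isClosed_box K ℓ)
        (fun z hz => fineFun_eq_zero_of_notMem x hz) fun h => hyD (hK.box_subset_domain h)
  -- The gradient vanishes almost everywhere on the domain, and outside the patch anyway.
  have h6 : w = 0 := eq_zero_of_gradDot_eq_zero hd hwl (hasCompactSupport_fineFun x) h4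
  ext k
  rw [← fineFun_node (T := T) (hr := hr) (K := K) x k, ← hw, h6]
  rfl

/-! ### The coefficient class -/

lemma mem_coeffs_const {D : Set (Fin d → ℝ)} {Tε : CartesianMesh d} {α β c : ℝ} (h1 : α ≤ c)
    (h2 : c ≤ β) : (fun _ => c) ∈ coeffs D Tε α β :=
  ⟨aestronglyMeasurable_const, .of_forall fun _ => ⟨h1, h2⟩, fun _ _ => ⟨c, .of_forall fun _ => rfl⟩⟩

lemma bddCoeff_of_mem_coeffs {Tε : CartesianMesh d} {α β : ℝ} {A : (Fin d → ℝ) → ℝ}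
    (hα : 0 < α) (hA : A ∈ coeffs T.domain Tε α β) : BddCoeff T.domain A := by
  refine ⟨T.volume_domain_ne_top, hA.1, β, ?_⟩
  filter_upwards [hA.2.1] with x hx
  rw [abs_of_pos (hα.trans_le hx.1)]; exact hx.2

/-! ### Correctors -/

/-- Lax–Milgram in finite dimension: a definite form on the kernel is an injective map into the dual
space, hence bijective. No symmetry is needed. -/
lemma exists_constrained_solution {n m : Type} [Fintype n] [Fintype m] {S : Matrix n n ℝ}
    (hS : ∀ x, x ≠ 0 → 0 < x ⬝ᵥ S.mulVec x) (I : Matrix m n ℝ) (b : n → ℝ) :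
    ∃ x, I.mulVec x = 0 ∧ ∀ y, I.mulVec y = 0 → y ⬝ᵥ S.mulVec x = y ⬝ᵥ b := by
  let V := LinearMap.ker I.mulVecLin
  let B : V →ₗ[ℝ] V →ₗ[ℝ] ℝ := LinearMap.mk₂ ℝ
    (fun x y => (y : n → ℝ) ⬝ᵥ S.mulVec (x : n → ℝ))
    (fun x x' y => by simp [Matrix.mulVec_add, dotProduct_add])
    (fun c x y => by simp [Matrix.mulVec_smul])
    (fun x y y' => by simp [add_dotProduct])
    (fun c x y => by simp)
  have hinj : Function.Injective B := by
    rw [injective_iff_map_eq_zero]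
    intro x hx
    have h := congrArg (fun f : V →ₗ[ℝ] ℝ => f x) hx
    by_contra hne
    exact (hS x fun h0 => hne (Subtype.ext h0)).ne' h
  have hsurj : Function.Surjective B :=
    (LinearMap.injective_iff_surjective_of_finrank_eq_finrank
      (Subspace.dual_finrank_eq (K := ℝ) (V := V)).symm).1 hinj
  obtain ⟨x, hx⟩ := hsurj
    { toFun := fun y => (y : n → ℝ) ⬝ᵥ b
      map_add' := fun y y' => by simp [add_dotProduct]
      map_smul' := fun c y => by simp }
  refine ⟨x, x.2, fun y hy => ?_⟩
  exact congrArg (fun f : V →ₗ[ℝ] ℝ => f ⟨y, hy⟩) hx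

variable (T r hr ℓ K) in
/-- The right-hand side of the corrector problem. -/
def loadVec (A u : (Fin d → ℝ) → ℝ) (k : FineIdx d r ℓ) : ℝ :=
  energy (T.cell K) A u (fineHat T r hr ℓ K k)

lemma CartesianMesh.cell_subset_box (T : CartesianMesh d) (K : Fin d → ℤ) (ℓ : ℕ) :
    T.cell K ⊆ T.box K ℓ := by
  rw [← T.box_zero]
  have h : (0 : ℝ) ≤ ℓ * T.size := mul_nonneg (Nat.cast_nonneg _) T.size_pos.le
  intro x hx i
  have := hx i
  push_cast at this
  constructor <;> linarith

lemma CartesianMesh.IsInterior.cell_subset_domain (hK : T.IsInterior ℓ K) :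
    T.cell K ⊆ T.domain :=
  (CartesianMesh.cell_subset_box T K ℓ).trans hK.box_subset_domain

lemma dotProduct_loadVec (hK : T.IsInterior ℓ K) {A u : (Fin d → ℝ) → ℝ}
    (hA : BddCoeff T.domain A) (hu : IsLip u) (y : FineIdx d r ℓ → ℝ) :
    energy (T.cell K) A u (fineFun T r hr ℓ K y) = y ⬝ᵥ loadVec T r hr ℓ K A u :=
  (hA.mono hK.cell_subset_domain).energy_sum_right _ _ (fun k => isLip_fineHat k) hu

lemma isElementCorrector_iff (hK : T.IsInterior ℓ K) {A u : (Fin d → ℝ) → ℝ}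
    (hA : BddCoeff T.domain A) (hu : IsLip u) (q : (Fin d → ℝ) → ℝ) :
    IsElementCorrector T (T.refine r hr) A ℓ K u q ↔
      ∃ x, q = fineFun T r hr ℓ K x ∧ (interpMat T r hr ℓ K).mulVec x = 0 ∧
        ∀ y, (interpMat T r hr ℓ K).mulVec y = 0 →
          y ⬝ᵥ (stiffness T r hr ℓ K A).mulVec x = y ⬝ᵥ loadVec T r hr ℓ K A u := by
  unfold IsElementCorrector
  constructor
  · rintro ⟨hq, h⟩
    obtain ⟨x, rfl, hx⟩ := (mem_fineScaleSpace_iff hK q).1 hq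
    refine ⟨x, rfl, hx, fun y hy => ?_⟩
    rw [dotProduct_stiffness hA, energy_comm, ← dotProduct_loadVec hK hA hu]
    exact h _ ((mem_fineScaleSpace_iff hK _).2 ⟨y, rfl, hy⟩)
  · rintro ⟨x, rfl, hx, h⟩
    refine ⟨(mem_fineScaleSpace_iff hK _).2 ⟨x, rfl, hx⟩, fun w hw => ?_⟩
    obtain ⟨y, rfl, hy⟩ := (mem_fineScaleSpace_iff hK w).1 hw
    have := h y hy
    rwa [dotProduct_stiffness hA, energy_comm, ← dotProduct_loadVec hK hA hu] at this

lemma existsUnique_isElementCorrector (hd : 1 ≤ d) (hK : T.IsInterior ℓ K)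
    {A u : (Fin d → ℝ) → ℝ} (hA : BddCoeff T.domain A) {α : ℝ} (hα : 0 < α)
    (h : ∀ᵐ x ∂(volume.restrict T.domain), α ≤ A x) (hu : IsLip u) :
    ∃! q, IsElementCorrector T (T.refine r hr) A ℓ K u q := by
  have hpos : ∀ x : FineIdx d r ℓ → ℝ, x ≠ 0 → 0 < x ⬝ᵥ (stiffness T r hr ℓ K A).mulVec x :=
    fun x hx => by
      rw [dotProduct_stiffness hA]
      exact energy_fineFun_pos hd hK hA hα h hx
  obtain ⟨x, hx, hx'⟩ := exists_constrained_solution hpos (interpMat T r hr ℓ K)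
    (loadVec T r hr ℓ K A u)
  refine ⟨fineFun T r hr ℓ K x, (isElementCorrector_iff hK hA hu _).2 ⟨x, rfl, hx, hx'⟩,
    fun q hq => ?_⟩
  obtain ⟨x', rfl, h1, h2⟩ := (isElementCorrector_iff hK hA hu q).1 hq
  congr 1
  by_contra hne
  have h3 : (interpMat T r hr ℓ K).mulVec (x' - x) = 0 := by
    rw [Matrix.mulVec_sub, h1, hx, sub_zero]
  have h4 := hpos (x' - x) (sub_ne_zero.2 hne)
  rw [Matrix.mulVec_sub, dotProduct_sub, h2 _ h3, hx' _ h3, sub_self] at h4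
  exact lt_irrefl _ h4

lemma isElementCorrector_elementCorrector (hd : 1 ≤ d) (hK : T.IsInterior ℓ K)
    {A u : (Fin d → ℝ) → ℝ} (hA : BddCoeff T.domain A) {α : ℝ} (hα : 0 < α)
    (h : ∀ᵐ x ∂(volume.restrict T.domain), α ≤ A x) (hu : IsLip u) :
    IsElementCorrector T (T.refine r hr) A ℓ K u
      (elementCorrector T (T.refine r hr) A ℓ K u) :=
  Classical.epsilon_spec (existsUnique_isElementCorrector hd hK hA hα h hu).exists

/-! ### Element-wise constant coefficients -/

variable {p : ℕ} {hp : 0 < p}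

/-- The elements of the mesh `T.refine p` in a patch. -/
def coeffCell (T : CartesianMesh d) (p : ℕ) (hp : 0 < p) (ℓ : ℕ) (K : Fin d → ℤ)
    (t : Fin d → Fin ((2 * ℓ + 1) * p)) : Set (Fin d → ℝ) :=
  (T.refine p hp).cell fun i => (p : ℤ) * (K i - ℓ) + (t i : ℤ)

lemma coeffCell_mem_cells (hK : T.IsInterior ℓ K) (t : Fin d → Fin ((2 * ℓ + 1) * p)) :
    (fun i => (p : ℤ) * (K i - ℓ) + (t i : ℤ)) ∈ (T.refine p hp).cells := by
  refine Finset.mem_biUnion.2 ⟨fun i => K i - ℓ + ((t i : ℕ) / p : ℕ), hK _ fun i => ?_,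
    Finset.mem_image.2 ⟨fun i => ⟨(t i : ℕ) % p, Nat.mod_lt _ hp⟩, Finset.mem_univ _,
      funext fun i => ?_⟩⟩
  · have : (t i : ℕ) / p < 2 * ℓ + 1 := (Nat.div_lt_iff_lt_mul hp).2 (t i).2
    generalize (t i : ℕ) / p = k at this ⊢
    rw [abs_le]
    constructor <;> lia
  · have : ((p * ((t i : ℕ) / p) + (t i : ℕ) % p : ℕ) : ℤ) = (t i : ℕ) := by
      rw [Nat.div_add_mod]
    push_cast at this ⊢
    linarith

lemma iUnion_inter_coeffCell {p : ℕ} {hp : 0 < p} {S : Set (Fin d → ℝ)} (hS : S ⊆ T.box K ℓ) :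
    ⋃ t, S ∩ coeffCell T p hp ℓ K t = S := by
  rw [← inter_iUnion, inter_eq_left]
  intro x hx
  have hs := T.size_pos
  have hp0 : (0 : ℝ) < p := by exact_mod_cast hp
  have hp1 : (1 : ℤ) ≤ p := by exact_mod_cast hp
  obtain ⟨z, hz, hxz⟩ := (T.refine p hp).exists_cell_of_mem (a := fun i => (p : ℤ) * (K i - ℓ))
    (b := fun i => (p : ℤ) * (K i - ℓ) + ((2 * ℓ + 1) * p - 1)) (fun i => by nlinarith) (x := x)
    fun i => by
      have h := hS hx i
      rw [CartesianMesh.node_apply] at h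
      rw [refine_node_apply, refine_node_apply, show (T.refine p hp).size = T.size / p from rfl]
      push_cast
      have e1 : T.size / p * (p * ((K i : ℝ) - ℓ)) = T.size * K i - ℓ * T.size := by
        field_simp
      have e2 : T.size / p * (p * ((K i : ℝ) - ℓ) + ((2 * ℓ + 1) * p - 1)) + T.size / p =
          T.size * K i + (ℓ + 1) * T.size := by
        field_simp; ring
      constructor <;> linarith
  refine mem_iUnion.2 ⟨fun i => ⟨(z i - p * (K i - ℓ)).toNat, ?_⟩, ?_⟩
  · have h1 := hz i
    zify
    rw [Int.toNat_of_nonneg (by lia)]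
    lia
  · unfold coeffCell
    have : (fun i => (p : ℤ) * (K i - ℓ) + ((z i - p * (K i - ℓ)).toNat : ℤ)) = z := by
      ext i
      rw [Int.toNat_of_nonneg (by have := hz i; lia)]
      ring
    simpa only [this] using hxz

lemma aedisjoint_cell (T : CartesianMesh d) {z z' : Fin d → ℤ} (h : z ≠ z') :
    AEDisjoint volume (T.cell z) (T.cell z') := by
  obtain ⟨i, hi⟩ := Function.ne_iff.1 h
  have hs := T.size_pos
  have hsub : T.cell z ∩ T.cell z' ⊆ {x | x i = max (T.node z i) (T.node z' i)} := by
    rintro x ⟨h1, h2⟩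
    have h3 := (T.mem_cell_iff _ _).1 h1 i
    have h4 := (T.mem_cell_iff _ _).1 h2 i
    simp only [CartesianMesh.node_apply] at h3 h4
    simp only [mem_ofPred_eq, CartesianMesh.node_apply]
    rcases lt_or_gt_of_ne hi with h | h
    · have : (z i : ℝ) + 1 ≤ z' i := by exact_mod_cast h
      rw [max_eq_right (by nlinarith)]
      nlinarith
    · have : (z' i : ℝ) + 1 ≤ z i := by exact_mod_cast h
      rw [max_eq_left (by nlinarith)]
      nlinarith
  exact measure_mono_null hsub (Measure.pi_hyperplane (fun _ => volume) i _)

lemma coeffVec_eq {A : (Fin d → ℝ) → ℝ} {t : Fin d → Fin ((2 * ℓ + 1) * p)} {c : ℝ}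
    (h : ∀ᵐ x ∂(volume.restrict (coeffCell T p hp ℓ K t)), A x = c) :
    coeffVec T p hp ℓ K A t = c := by
  have hs := (T.refine p hp).size_pos
  have hvol : volume (coeffCell T p hp ℓ K t) ≠ 0 := by
    unfold coeffCell CartesianMesh.cell
    rw [Real.volume_Icc_pi]
    refine Finset.prod_ne_zero_iff.2 fun i _ => ?_
    rw [ENNReal.ofReal_ne_zero_iff, CartesianMesh.node_apply, CartesianMesh.node_apply]
    simp only [Pi.add_apply, Pi.one_apply]
    push_cast
    nlinarith
  have hfin : volume (coeffCell T p hp ℓ K t) ≠ ⊤ := isCompact_Icc.measure_lt_top.ne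
  unfold coeffVec
  have h' := (ae_restrict_iff' ((T.refine p hp).measurableSet_cell _)).1 h
  rw [setAverage_congr_fun (g := fun _ => c) ((T.refine p hp).measurableSet_cell _) h']
  exact setAverage_const hvol hfin c

/-- The energy is linear in the values of an element-wise constant coefficient. -/
lemma energy_eq_sum_coeffVec (hK : T.IsInterior ℓ K) {α β : ℝ} {A : (Fin d → ℝ) → ℝ}
    (hα : 0 < α) (hA : A ∈ coeffs T.domain (T.refine p hp) α β) {S : Set (Fin d → ℝ)}
    (hS : S ⊆ T.box K ℓ) (hSm : MeasurableSet S) {u v : (Fin d → ℝ) → ℝ} (hu : IsLip u)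
    (hv : IsLip v) :
    energy S A u v = ∑ t, coeffVec T p hp ℓ K A t *
      energy (S ∩ coeffCell T p hp ℓ K t) (fun _ => 1) u v := by
  have hb := (bddCoeff_of_mem_coeffs hα hA).mono (hS.trans hK.box_subset_domain)
  have hm : ∀ t, MeasurableSet (coeffCell T p hp ℓ K t) := fun t =>
    (T.refine p hp).measurableSet_cell _
  have hU := iUnion_inter_coeffCell (p := p) (hp := hp) hS
  have h1 := integral_iUnion_ae (μ := volume) (f := fun x => A x * gradDot u v x)
    (s := fun t => S ∩ coeffCell T p hp ℓ K t)
    (fun t => (hSm.inter (hm t)).nullMeasurableSet) (fun t t' htt' => by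
      refine AEDisjoint.mono (aedisjoint_cell (T.refine p hp) fun h => htt' ?_)
        inter_subset_right inter_subset_right
      ext i
      simpa using congrFun h i) (by rw [hU]; exact hb.integrable hu hv)
  rw [hU, tsum_fintype] at h1
  rw [energy_eq, h1]
  refine Finset.sum_congr rfl fun t _ => ?_
  obtain ⟨c, hc⟩ := hA.2.2 _ (coeffCell_mem_cells (hp := hp) hK t)
  have hc' : coeffVec T p hp ℓ K A t = c := coeffVec_eq hc
  rw [hc', energy_eq]
  simp only [one_mul]
  rw [← integral_const_mul]
  refine integral_congr_ae ?_
  filter_upwards [ae_restrict_of_ae_restrict_of_subset inter_subset_right hc] with x hx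
  rw [hx]

/-! ### Translation of patches -/

section Translation

variable {K' : Fin d → ℤ}

variable (T K K') in
/-- The translation that maps the element `K` to the element `K'`. -/
def shiftVec : Fin d → ℝ := fun i => T.size * ((K' i - K i : ℤ) : ℝ)

lemma hat_shift {z z' : Fin d → ℤ} (h : ∀ i, z' i = z i + (K' i - K i)) (x : Fin d → ℝ) :
    T.hat z' (x + shiftVec T K K') = T.hat z x := by
  have : z' = z + (K' - K) := funext h
  rw [this]
  exact T.hat_add z (K' - K) x

lemma refine_shiftVec : shiftVec T K K' =
    fun i => (T.refine r hr).size * (((fun i => (r : ℤ) * (K' i - K i)) i : ℤ) : ℝ) := by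
  have hr0 : (0 : ℝ) < r := by exact_mod_cast hr
  ext i
  simp only [shiftVec, CartesianMesh.refine]
  push_cast
  field_simp

lemma fineHat_shift (k : FineIdx d r ℓ) (x : Fin d → ℝ) :
    fineHat T r hr ℓ K' k (x + shiftVec T K K') = fineHat T r hr ℓ K k x := by
  unfold fineHat
  rw [refine_shiftVec (hr := hr), ← (T.refine r hr).hat_add (fineNode r ℓ K k)]
  congr 1
  ext i
  simp only [fineNode, Pi.add_apply]
  ring

lemma cell_shift (x : Fin d → ℝ) : x + shiftVec T K K' ∈ T.cell K' ↔ x ∈ T.cell K := by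
  rw [← T.add_mem_cell_iff K (K' - K), add_sub_cancel]
  rfl

lemma box_shift (x : Fin d → ℝ) : x + shiftVec T K K' ∈ T.box K' ℓ ↔ x ∈ T.box K ℓ := by
  simp only [CartesianMesh.box, mem_ofPred_eq, Pi.add_apply, shiftVec, CartesianMesh.node_apply]
  push_cast
  refine forall_congr' fun i => ?_
  constructor <;> rintro ⟨h1, h2⟩ <;> constructor <;> linarith

lemma coeffCell_shift (t : Fin d → Fin ((2 * ℓ + 1) * p)) (x : Fin d → ℝ) :
    x + shiftVec T K K' ∈ coeffCell T p hp ℓ K' t ↔ x ∈ coeffCell T p hp ℓ K t := by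
  unfold coeffCell
  have : (fun i => (p : ℤ) * (K i - ℓ) + ((t i : ℕ) : ℤ)) + (fun i => (p : ℤ) * (K' i - K i)) =
      fun i => (p : ℤ) * (K' i - ℓ) + ((t i : ℕ) : ℤ) := by
    ext i
    simp only [Pi.add_apply]
    ring
  rw [refine_shiftVec (hr := hp), ← this]
  exact (T.refine p hp).add_mem_cell_iff _ (fun i => (p : ℤ) * (K' i - K i)) x

lemma cellsAt_coarseNode (hK : T.IsInterior ℓ K) (i : Fin d → Fin (2 * ℓ + 2)) :
    cellsAt T (coarseNode ℓ K i) = Finset.Icc (coarseNode ℓ K i - 1) (coarseNode ℓ K i) := by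
  ext K'
  rw [mem_cellsAt, Finset.mem_Icc, Pi.le_def, Pi.le_def, ← forall_and]
  constructor
  · rintro ⟨-, h⟩ a
    have := h a
    simp only [Pi.sub_apply, Pi.one_apply]
    lia
  · intro h
    refine ⟨hK _ fun a => ?_, fun a => ?_⟩
    · have h1 := h a
      simp only [Pi.sub_apply, Pi.one_apply, coarseNode] at h1
      have h2 : ((i a : ℕ) : ℤ) < 2 * ℓ + 2 := by exact_mod_cast (i a).2
      have h3 : (0 : ℤ) ≤ ((i a : ℕ) : ℤ) := Int.natCast_nonneg _
      rw [abs_le]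
      constructor <;> linarith [h1.1, h1.2]
    · have := h a
      simp only [Pi.sub_apply, Pi.one_apply] at this
      lia

/-- At each coarse node of an interior patch all adjacent elements belong to the mesh, so the
averages are translates of each other. The projection onto the kernel can therefore be built into
the weights of one network for all interior elements. -/
lemma interpMat_eq_of_isInterior (hK : T.IsInterior ℓ K) (hK' : T.IsInterior ℓ K') :
    interpMat T r hr ℓ K' = interpMat T r hr ℓ K := by
  ext i k
  simp only [interpMat, Matrix.of_apply]
  rw [quasiInterp_node (hK.box_subset_domain (coarseNode_mem_box i)),
    quasiInterp_node (hK'.box_subset_domain (coarseNode_mem_box i))]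
  have hz : coarseNode ℓ K' i = coarseNode ℓ K i + (K' - K) := by
    ext a; simp [coarseNode]; ring
  unfold nodalAverage
  have hcells : cellsAt T (coarseNode ℓ K' i) =
      (cellsAt T (coarseNode ℓ K i)).image (· + (K' - K)) := by
    rw [cellsAt_coarseNode hK, cellsAt_coarseNode hK', hz, Finset.image_add_right_Icc]
    congr 1
    abel
  have hinj : Function.Injective fun z : Fin d → ℤ => z + (K' - K) := add_left_injective _
  rw [hcells, Finset.card_image_of_injective _ hinj, Finset.sum_image fun a _ b _ h => hinj h]
  congr 1
  refine Finset.sum_congr rfl fun K'' _ => ?_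
  rw [hz, T.node_add]
  exact elementProj_translate (CartesianMesh.isLip_hat _ _).continuous
    (CartesianMesh.isLip_hat _ _).continuous (fun x => fineHat_shift k x) _

end Translation

/-! ### The interpolation matrix has full rank -/

lemma coarseNode_injective : Function.Injective (coarseNode ℓ K (d := d)) := fun a b h => by
  ext i
  have := congrFun h i
  simp only [coarseNode] at this
  lia

/-- Fix a coarse node `i₀` and an element K' of the patch with this corner. On fine functions
supported in K', the functional yᵀ I is φ composed with the L²-projection on K', where φ is a
weighted sum of corner values. Let ψ represent φ in L²(K'). Then ψ is orthogonal to all fine hats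
inside K', and since a hat acts on such polynomials like a point mass, ψ vanishes at the inner fine
nodes of K'. Three subdivisions leave two of them in each direction, which forces ψ = 0. Evaluating
φ = 0 at the nodal polynomial of `i₀` gives y i₀ = 0. -/
lemma interpMat_transpose_injective (hr3 : 3 ≤ r) (hK : T.IsInterior ℓ K)
    {y : (Fin d → Fin (2 * ℓ + 2)) → ℝ}
    (hy : (interpMat T r hr ℓ K).transpose.mulVec y = 0) : y = 0 := by
  ext i₀
  have hs := T.size_pos
  have hr0 : (0 : ℝ) < r := by exact_mod_cast hr
  have hq : 0 < T.size / r := by positivity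
  -- The element above the node in each coordinate, except at the upper end of the patch, where
  -- `min` selects the last element.
  set K' : Fin d → ℤ := fun a => K a - ℓ + (min (i₀ a : ℕ) (2 * ℓ) : ℕ) with hK'
  have hK'b : ∀ a, K a - ℓ ≤ K' a ∧ K' a ≤ K a + ℓ := fun a => by
    simp only [hK']; constructor <;> lia
  have hK'z : ∀ a, K' a ≤ coarseNode ℓ K i₀ a ∧ coarseNode ℓ K i₀ a ≤ K' a + 1 := fun a => by
    have := (i₀ a).2
    simp only [hK', coarseNode]; constructor <;> lia
  have hK'T : K' ∈ T.cells := hK _ fun a => abs_le.2 (by have := hK'b a; constructor <;> lia)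
  -- a fine hat function in the interior of `K'` vanishes on all other elements
  have hzero : ∀ z : Fin d → ℤ, (∀ a, (r : ℤ) * K' a < z a ∧ z a < r * (K' a + 1)) →
      ∀ x, x ∉ (univ.pi fun a => Ioo (T.node K' a) (T.node K' a + T.size)) →
      (T.refine r hr).hat z x = 0 := by
    intro z hz x hx
    by_contra h0
    refine hx fun a _ => ?_
    have h1 := abs_lt.1 (((T.refine r hr).hat_ne_zero_iff _ _).1 h0 a)
    rw [show (T.refine r hr).size = T.size / r from rfl, refine_node_apply] at h1
    have h2 : (r : ℝ) * K' a + 1 ≤ z a := by exact_mod_cast (hz a).1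
    have h3 : (z a : ℝ) + 1 ≤ r * (K' a + 1) := by exact_mod_cast (hz a).2
    have e1 : T.size / r * (r * (K' a : ℝ)) = T.size * K' a := by field_simp
    have e2 : T.size / r * (r * ((K' a : ℝ) + 1)) = T.size * K' a + T.size := by field_simp
    simp only [mem_Ioo, CartesianMesh.node_apply] at h1 ⊢
    constructor <;> nlinarith
  set w : (Fin d → Fin (2 * ℓ + 2)) → ℝ := fun i =>
    if K' ∈ cellsAt T (coarseNode ℓ K i) then y i / (cellsAt T (coarseNode ℓ K i)).card else 0
    with hw
  let φ : multiaffine d →ₗ[ℝ] ℝ :=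
    { toFun := fun p => ∑ i, w i * (p : (Fin d → ℝ) → ℝ) (T.node (coarseNode ℓ K i))
      map_add' := fun p q => by
        simp only [Submodule.coe_add, Pi.add_apply, mul_add, Finset.sum_add_distrib]
      map_smul' := fun c p => by
        simp only [Submodule.coe_smul, Pi.smul_apply, smul_eq_mul, Finset.mul_sum,
          RingHom.id_apply, mul_left_comm] }
  obtain ⟨ψ, hψ⟩ := exists_riesz_multiaffine T K' φ
  have hvan : ∀ z : Fin d → ℤ, (∀ a, (r : ℤ) * K' a < z a ∧ z a < r * (K' a + 1)) →
      (ψ : (Fin d → ℝ) → ℝ) ((T.refine r hr).node z) = 0 := by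
    intro z hz
    set u := (T.refine r hr).hat z with hu
    have huc : Continuous u := (CartesianMesh.isLip_hat _ _).continuous
    obtain ⟨k, hk⟩ : ∃ k, fineNode r ℓ K k = z := by
      rw [exists_fineNode_eq_iff (T := T) (hr := hr)]
      intro a
      have h2 : (r : ℝ) * K' a + 1 ≤ z a := by exact_mod_cast (hz a).1
      have h3 : (z a : ℝ) + 1 ≤ r * (K' a + 1) := by exact_mod_cast (hz a).2
      have h4 : (K a : ℝ) - ℓ ≤ K' a := by exact_mod_cast (hK'b a).1
      have h5 : (K' a : ℝ) ≤ K a + ℓ := by exact_mod_cast (hK'b a).2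
      have e1 : T.size / r * (r * (K' a : ℝ)) = T.size * K' a := by field_simp
      have e2 : T.size / r * (r * ((K' a : ℝ) + 1)) = T.size * K' a + T.size := by field_simp
      rw [refine_node_apply, CartesianMesh.node_apply]
      constructor <;> nlinarith
    have hproj : ∀ K'', K'' ≠ K' → elementProj T K'' u = 0 := fun K'' hne => by
      refine elementProj_eq_zero huc fun x hx => hzero z hz x fun hmem => hne ?_
      ext a
      have h1 := (T.mem_cell_iff _ _).1 hx a
      have h2 := hmem a trivial
      simp only [CartesianMesh.node_apply, mem_Ioo] at h1 h2
      have h3 : (K'' a : ℝ) < K' a + 1 := by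
        refine lt_of_mul_lt_mul_left ?_ hs.le
        linarith
      have h4 : (K' a : ℝ) < K'' a + 1 := by
        refine lt_of_mul_lt_mul_left ?_ hs.le
        linarith
      have h5 : K'' a < K' a + 1 := by exact_mod_cast h3
      have h6 : K' a < K'' a + 1 := by exact_mod_cast h4
      lia
    have hIk : ∀ i, interpMat T r hr ℓ K i k * y i =
        w i * elementProj T K' u (T.node (coarseNode ℓ K i)) := fun i => by
      simp only [interpMat, Matrix.of_apply]
      rw [quasiInterp_node (hK.box_subset_domain (coarseNode_mem_box i)), hk]
      unfold nodalAverage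
      simp only [hw]
      split_ifs with hmem
      · rw [Finset.sum_eq_single_of_mem K' hmem fun K'' _ hne => by
          rw [← hu, hproj K'' hne]; rfl]
        ring
      · rw [Finset.sum_eq_zero fun K'' hK'' => by
          rw [← hu, hproj K'' fun h => hmem (h ▸ hK'')]; rfl]
        simp
    have hφ : φ ⟨elementProj T K' u, (isElementProj_elementProj huc).1⟩ = 0 := by
      have := congrFun hy k
      simp only [Matrix.mulVec, dotProduct, Matrix.transpose_apply, hIk, Pi.zero_apply] at this
      exact this
    rw [← hψ] at hφ
    have hψc := continuous_of_mem_multiaffine ψ.2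
    have hpc := continuous_of_mem_multiaffine (isElementProj_elementProj (T := T) (K := K') huc).1
    have h1 := (isElementProj_elementProj (T := T) (K := K') huc).2 ψ ψ.2
    simp only [sub_mul] at h1
    rw [integral_sub (integrableOn_cell_mul T K' huc hψc) (integrableOn_cell_mul T K' hpc hψc)]
      at h1
    simp only [mul_comm (elementProj T K' u _)] at h1
    rw [hφ, sub_zero] at h1
    obtain ⟨m, hm, hmul⟩ := exists_integral_hat_mul (T.refine r hr) z
    have h2 := hmul ψ ψ.2
    rw [← hu, ← setIntegral_eq_integral_of_forall_compl_eq_zero (s := T.cell K'), h1] at h2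
    · exact (mul_eq_zero.1 h2.symm).resolve_left hm.ne'
    · intro x hx
      rw [hu, hzero z hz x fun hmem => hx ((T.mem_cell_iff _ _).2 fun a =>
        ⟨(hmem a trivial).1.le, (hmem a trivial).2.le⟩), zero_mul]
  have hψ0 : (ψ : (Fin d → ℝ) → ℝ) = 0 := by
    -- The first two inner fine nodes of K' in each direction; the second one is inner because r ≥
    -- 3.
    refine eq_zero_of_corners ψ.2 (a := (T.refine r hr).node fun a => r * K' a + 1)
      (b := (T.refine r hr).node fun a => r * K' a + 2) (fun a => ?_) fun x hx => ?_
    · rw [refine_node_apply, refine_node_apply]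
      push_cast
      intro h
      nlinarith
    · classical
      obtain ⟨z, hz, rfl⟩ : ∃ z : Fin d → ℤ, (∀ a, z a = r * K' a + 1 ∨ z a = r * K' a + 2) ∧
          (T.refine r hr).node z = x := by
        refine ⟨fun a => if x a = (T.refine r hr).node (fun a => r * K' a + 1) a
          then r * K' a + 1 else r * K' a + 2, fun a => ?_, ?_⟩
        · simp only; split_ifs <;> simp
        · ext a
          rw [refine_node_apply]
          by_cases h : x a = (T.refine r hr).node (fun a => r * K' a + 1) a
          · rw [if_pos h, h, refine_node_apply]
          · rw [if_neg h, (hx a).resolve_left h, refine_node_apply]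
      refine hvan z fun a => ?_
      have : (3 : ℤ) ≤ r := by exact_mod_cast hr3
      rcases hz a with h | h <;> rw [h] <;> constructor <;> lia
  have hφ0 : ∀ p, φ p = 0 := fun p => by
    rw [← hψ, hψ0]; simp
  -- the nodal basis function of `K'` at the node `i₀`
  set P : (Fin d → ℝ) → ℝ := fun x => ∏ a, (if coarseNode ℓ K i₀ a = K' a
    then -(1 / T.size) * x a + (1 + T.node K' a / T.size)
    else 1 / T.size * x a + -(T.node K' a / T.size)) with hP
  have hPm : P ∈ multiaffine d := by
    convert prod_affine_mem_multiaffine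
      (fun a => if coarseNode ℓ K i₀ a = K' a then -(1 / T.size) else 1 / T.size)
      (fun a => if coarseNode ℓ K i₀ a = K' a then 1 + T.node K' a / T.size
        else -(T.node K' a / T.size)) using 1
    ext x
    simp only [hP]
    refine Finset.prod_congr rfl fun a _ => ?_
    split_ifs <;> rfl
  have hPv : ∀ z : Fin d → ℤ, (∀ a, K' a ≤ z a ∧ z a ≤ K' a + 1) →
      P (T.node z) = if z = coarseNode ℓ K i₀ then 1 else 0 := by
    intro z hz
    have hfac : ∀ a, (if coarseNode ℓ K i₀ a = K' a
        then -(1 / T.size) * T.node z a + (1 + T.node K' a / T.size)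
        else 1 / T.size * T.node z a + -(T.node K' a / T.size)) =
        if z a = coarseNode ℓ K i₀ a then (1 : ℝ) else 0 := fun a => by
      have e : 1 / T.size * T.node z a - T.node K' a / T.size = z a - K' a := by
        simp only [CartesianMesh.node_apply]; field_simp; ring
      have h1 := hz a
      have h2 := hK'z a
      have h3 : z a = K' a ∨ z a = K' a + 1 := by lia
      have h4 : coarseNode ℓ K i₀ a = K' a ∨ coarseNode ℓ K i₀ a = K' a + 1 := by lia
      rcases h4 with h4 | h4
      · rw [if_pos h4, h4]
        rcases h3 with h3 | h3
        · rw [if_pos h3]; rw [h3] at e; linarith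
        · rw [if_neg (by lia)]; rw [h3] at e; push_cast at e; linarith
      · rw [if_neg (by lia), h4]
        rcases h3 with h3 | h3
        · rw [if_neg (by lia)]; rw [h3] at e; linarith
        · rw [if_pos h3]; rw [h3] at e; push_cast at e; linarith
    simp only [hP, hfac]
    rw [Finset.prod_ite_zero]
    simp only [Finset.mem_univ, true_imp_iff, Finset.prod_const_one, funext_iff]
  have hfinal := hφ0 ⟨P, hPm⟩
  have hsum : φ ⟨P, hPm⟩ = w i₀ := by
    change ∑ i, w i * P (T.node (coarseNode ℓ K i)) = w i₀
    rw [Finset.sum_eq_single i₀]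
    · rw [hPv _ hK'z, if_pos rfl, mul_one]
    · intro i _ hne
      by_cases hmem : K' ∈ cellsAt T (coarseNode ℓ K i)
      · rw [hPv _ (mem_cellsAt.1 hmem).2, if_neg fun h => hne (coarseNode_injective h), mul_zero]
      · simp only [hw, if_neg hmem, zero_mul]
    · simp
  have hmem : K' ∈ cellsAt T (coarseNode ℓ K i₀) := mem_cellsAt.2 ⟨hK'T, hK'z⟩
  rw [hsum] at hfinal
  simp only [hw, if_pos hmem] at hfinal
  have hcard : ((cellsAt T (coarseNode ℓ K i₀)).card : ℝ) ≠ 0 := by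
    exact_mod_cast (Finset.card_pos.2 ⟨K', hmem⟩).ne'
  exact (div_eq_zero_iff.1 hfinal).resolve_right hcard

end PatchMatrices

/-! ### Extreme eigenvalues of symmetric matrices -/

section Eigenvalues

variable {n m : Type} [Fintype n] [DecidableEq n] [Fintype m] [DecidableEq m]

lemma exists_mulVec_eq_smul_of_mem_spectrum {M : Matrix n n ℝ} {μ : ℝ} (h : μ ∈ spectrum ℝ M) :
    ∃ v, v ≠ 0 ∧ M.mulVec v = μ • v := by
  rw [spectrum.mem_iff, Matrix.isUnit_iff_isUnit_det, isUnit_iff_ne_zero, not_not,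
    ← Matrix.exists_mulVec_eq_zero_iff] at h
  obtain ⟨v, hv, h⟩ := h
  refine ⟨v, hv, ?_⟩
  rw [Matrix.sub_mulVec, sub_eq_zero, Algebra.algebraMap_eq_smul_one, Matrix.smul_mulVec,
    Matrix.one_mulVec] at h
  exact h.symm

lemma isHermitian_of_isSymm {M : Matrix n n ℝ} (hM : M.IsSymm) : M.IsHermitian := by
  rw [Matrix.IsHermitian, Matrix.conjTranspose_eq_transpose_of_trivial]; exact hM

lemma spectrum_finite_nonempty [Nonempty n] {M : Matrix n n ℝ} (hM : M.IsSymm) :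
    (spectrum ℝ M).Finite ∧ (spectrum ℝ M).Nonempty := by
  rw [(isHermitian_of_isSymm hM).spectrum_real_eq_range_eigenvalues]
  exact ⟨finite_range _, range_nonempty _⟩

lemma nonneg_of_spectrum_nonneg {M : Matrix n n ℝ} (hM : M.IsSymm)
    (h : ∀ μ ∈ spectrum ℝ M, 0 ≤ μ) (v : n → ℝ) : 0 ≤ v ⬝ᵥ M.mulVec v := by
  have hH := isHermitian_of_isSymm hM
  have : M.PosSemidef := hH.posSemidef_iff_eigenvalues_nonneg.2 fun i =>
    h _ (hH.spectrum_real_eq_range_eigenvalues ▸ mem_range_self i)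
  simpa using this.dotProduct_mulVec_nonneg v

lemma isSymm_algebraMap (a : ℝ) : (algebraMap ℝ (Matrix n n ℝ) a).IsSymm := by
  rw [Algebra.algebraMap_eq_smul_one]
  exact Matrix.isSymm_one.smul a

/-- The matrices M − λ_min and λ_max − M have non-negative spectrum. -/
lemma spectralBounds_lam [Nonempty n] {M : Matrix n n ℝ} (hM : M.IsSymm) :
    SpectralBounds M (lamMin M) (lamMax M) := by
  obtain ⟨hf, -⟩ := spectrum_finite_nonempty hM
  intro v
  constructor
  · have := nonneg_of_spectrum_nonneg (hM.sub (isSymm_algebraMap (lamMin M))) (fun μ hμ => by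
      rw [← spectrum.sub_singleton_eq] at hμ
      obtain ⟨x, hx, y, rfl, rfl⟩ := hμ
      exact sub_nonneg.2 (csInf_le hf.bddBelow hx)) v
    rw [Matrix.sub_mulVec, dotProduct_sub, Algebra.algebraMap_eq_smul_one, Matrix.smul_mulVec,
      Matrix.one_mulVec, dotProduct_smul, smul_eq_mul] at this
    linarith
  · have := nonneg_of_spectrum_nonneg ((isSymm_algebraMap (lamMax M)).sub hM) (fun μ hμ => by
      rw [← spectrum.singleton_sub_eq] at hμ
      obtain ⟨x, rfl, y, hy, rfl⟩ := hμ
      exact sub_nonneg.2 (le_csSup hf.bddAbove hy)) v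
    rw [Matrix.sub_mulVec, dotProduct_sub, Algebra.algebraMap_eq_smul_one, Matrix.smul_mulVec,
      Matrix.one_mulVec, dotProduct_smul, smul_eq_mul] at this
    linarith

lemma le_lamMin [Nonempty n] {M : Matrix n n ℝ} (hM : M.IsSymm) {a : ℝ}
    (h : ∀ v, a * (v ⬝ᵥ v) ≤ v ⬝ᵥ M.mulVec v) : a ≤ lamMin M := by
  refine le_csInf (spectrum_finite_nonempty hM).2 fun μ hμ => ?_
  obtain ⟨v, hv, hMv⟩ := exists_mulVec_eq_smul_of_mem_spectrum hμ
  have := h v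
  rw [hMv, dotProduct_smul, smul_eq_mul] at this
  exact le_of_mul_le_mul_right this (dotProduct_self_pos hv)

lemma lamMax_le [Nonempty n] {M : Matrix n n ℝ} (hM : M.IsSymm) {b : ℝ}
    (h : ∀ v, v ⬝ᵥ M.mulVec v ≤ b * (v ⬝ᵥ v)) : lamMax M ≤ b := by
  refine csSup_le (spectrum_finite_nonempty hM).2 fun μ hμ => ?_
  obtain ⟨v, hv, hMv⟩ := exists_mulVec_eq_smul_of_mem_spectrum hμ
  have := h v
  rw [hMv, dotProduct_smul, smul_eq_mul] at this
  exact le_of_mul_le_mul_right this (dotProduct_self_pos hv)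

lemma lamMin_pos [Nonempty n] {M : Matrix n n ℝ} (hM : M.IsSymm)
    (h : ∀ v, v ≠ 0 → 0 < v ⬝ᵥ M.mulVec v) : 0 < lamMin M := by
  obtain ⟨hf, hne⟩ := spectrum_finite_nonempty hM
  obtain ⟨v, hv, hMv⟩ := exists_mulVec_eq_smul_of_mem_spectrum (hne.csInf_mem hf)
  have := h v hv
  rw [hMv, dotProduct_smul, smul_eq_mul] at this
  exact pos_of_mul_pos_left this (dotProduct_self_nonneg' v)

lemma lamMin_le_lamMax [Nonempty n] {M : Matrix n n ℝ} (hM : M.IsSymm) : lamMin M ≤ lamMax M := by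
  obtain ⟨hf, hne⟩ := spectrum_finite_nonempty hM
  exact csInf_le_csSup hne hf.bddBelow hf.bddAbove

lemma lamMin_le_mul [Nonempty n] {M M' : Matrix n n ℝ} (hM : M.IsSymm) (hM' : M'.IsSymm) {c : ℝ}
    (hc : 0 < c) (h : ∀ v, v ⬝ᵥ M.mulVec v ≤ c * (v ⬝ᵥ M'.mulVec v)) :
    lamMin M ≤ c * lamMin M' := by
  have : lamMin M / c ≤ lamMin M' := le_lamMin hM' fun v => by
    have h1 := (spectralBounds_lam hM v).1.trans (h v)
    rw [div_mul_eq_mul_div, div_le_iff₀ hc]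
    linarith
  rw [div_le_iff₀ hc] at this
  linarith

lemma lamMax_le_mul [Nonempty n] {M M' : Matrix n n ℝ} (hM : M.IsSymm) (hM' : M'.IsSymm) {c : ℝ}
    (hc : 0 ≤ c) (h : ∀ v, v ⬝ᵥ M.mulVec v ≤ c * (v ⬝ᵥ M'.mulVec v)) :
    lamMax M ≤ c * lamMax M' :=
  lamMax_le hM fun v => by
    have := mul_le_mul_of_nonneg_left (spectralBounds_lam hM' v).2 hc
    linarith [h v]

lemma isUnit_det_of_pos {S : Matrix n n ℝ} (hS : ∀ v, v ≠ 0 → 0 < v ⬝ᵥ S.mulVec v) :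
    IsUnit S.det := by
  rw [isUnit_iff_ne_zero]
  intro h
  obtain ⟨v, hv, h⟩ := Matrix.exists_mulVec_eq_zero_iff.2 h
  have := hS v hv
  rw [h, dotProduct_zero] at this
  exact lt_irrefl _ this

lemma mulVec_inv_mulVec {S : Matrix n n ℝ} (hS : IsUnit S.det) (w : n → ℝ) :
    S.mulVec (S⁻¹.mulVec w) = w := by
  rw [Matrix.mulVec_mulVec, Matrix.mul_nonsing_inv _ hS, Matrix.one_mulVec]

lemma dotProduct_inv_pos {S : Matrix n n ℝ} (hS : ∀ v, v ≠ 0 → 0 < v ⬝ᵥ S.mulVec v) {w : n → ℝ}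
    (hw : w ≠ 0) : 0 < w ⬝ᵥ S⁻¹.mulVec w := by
  have h := mulVec_inv_mulVec (isUnit_det_of_pos hS) w
  have hne : S⁻¹.mulVec w ≠ 0 := fun h0 => hw (by rw [← h, h0, Matrix.mulVec_zero])
  have := hS _ hne
  rwa [h, dotProduct_comm] at this

/-- Inversion reverses the order of positive definite matrices. -/
lemma dotProduct_inv_le {S S' : Matrix n n ℝ} (hS : S.IsSymm)
    (hpos : ∀ v, v ≠ 0 → 0 < v ⬝ᵥ S.mulVec v) (hpos' : ∀ v, v ≠ 0 → 0 < v ⬝ᵥ S'.mulVec v)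
    {c : ℝ} (h : ∀ v, v ⬝ᵥ S.mulVec v ≤ c * (v ⬝ᵥ S'.mulVec v)) (w : n → ℝ) :
    w ⬝ᵥ S'⁻¹.mulVec w ≤ c * (w ⬝ᵥ S⁻¹.mulVec w) := by
  rcases eq_or_ne w 0 with rfl | hw
  · simp
  have h0 : ∀ v, 0 ≤ v ⬝ᵥ S.mulVec v := fun v => by
    rcases eq_or_ne v 0 with rfl | hv
    · simp
    · exact (hpos v hv).le
  have e := mulVec_inv_mulVec (isUnit_det_of_pos hpos) w
  have e' := mulVec_inv_mulVec (isUnit_det_of_pos hpos') w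
  -- Cauchy–Schwarz in the form S for S'⁻¹ w and S⁻¹ w. The left-hand side is (w · S'⁻¹ w)², and the
  -- factor with S'⁻¹ w is at most c (w · S'⁻¹ w), so one power cancels.
  have h1 := bilin_sq_le hS h0 (S'⁻¹.mulVec w) (S⁻¹.mulVec w)
  have h2 := h (S'⁻¹.mulVec w)
  rw [e] at h1
  rw [e'] at h2
  rw [dotProduct_comm _ w] at h1 h2
  rw [dotProduct_comm _ w] at h1
  have hb := dotProduct_inv_pos hpos' hw
  have ha := dotProduct_inv_pos hpos hw
  refine le_of_mul_le_mul_left ?_ hb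
  nlinarith

lemma dotProduct_conj (I : Matrix m n ℝ) (X : Matrix n n ℝ) (v : m → ℝ) :
    v ⬝ᵥ (I * X * I.transpose).mulVec v =
      I.transpose.mulVec v ⬝ᵥ X.mulVec (I.transpose.mulVec v) := by
  rw [← Matrix.mulVec_mulVec, ← Matrix.mulVec_mulVec, Matrix.dotProduct_mulVec,
    ← Matrix.mulVec_transpose]

lemma isSymm_conj {X : Matrix n n ℝ} (hX : X.IsSymm) (I : Matrix m n ℝ) :
    (I * X * I.transpose).IsSymm := by
  rw [Matrix.IsSymm, Matrix.transpose_mul, Matrix.transpose_mul, Matrix.transpose_transpose,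
    hX.eq, Matrix.mul_assoc]

lemma isSymm_inv {S : Matrix n n ℝ} (hS : S.IsSymm) : S⁻¹.IsSymm := by
  rw [Matrix.IsSymm, Matrix.transpose_nonsing_inv, hS.eq]

lemma abs_dotProduct_mulVec_le (E : Matrix n n ℝ) (w : n → ℝ) :
    |w ⬝ᵥ E.mulVec w| ≤ specNorm E * (w ⬝ᵥ w) := by
  have hE := specNorm_nonneg E
  have hw := dotProduct_self_nonneg' w
  refine abs_le_of_sq_le_sq ?_ (mul_nonneg hE hw)
  have h1 := dotProduct_mul_dotProduct_le w (E.mulVec w)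
  have h2 := mul_le_mul_of_nonneg_left (dotProduct_mulVec_self_le E w) hw
  nlinarith

end Eigenvalues

/-! ### Comparison with the coefficient one -/

section Existence

variable {d : ℕ} {T : CartesianMesh d} {r : ℕ} {hr : 0 < r} {ℓ : ℕ} {K K' : Fin d → ℤ}

/-- Because of this, spectral bounds that come from a single interior element hold uniformly in K;
the coefficient only costs the factors α and β. -/
lemma stiffness_one_eq (hK : T.IsInterior ℓ K) (hK' : T.IsInterior ℓ K') :
    stiffness T r hr ℓ K' (fun _ => 1) = stiffness T r hr ℓ K (fun _ => 1) := by
  ext k l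
  change energy T.domain _ (fineHat T r hr ℓ K' k) (fineHat T r hr ℓ K' l) =
    energy T.domain _ (fineHat T r hr ℓ K k) (fineHat T r hr ℓ K l)
  rw [energy_eq_of_subset (T.isClosed_box K' ℓ) hK'.box_subset_domain
      T.isOpen_domain.measurableSet fun x hx => fineHat_eq_zero_of_notMem k hx,
    energy_eq_of_subset (T.isClosed_box K ℓ) hK.box_subset_domain
      T.isOpen_domain.measurableSet fun x hx => fineHat_eq_zero_of_notMem k hx]
  exact energy_translate (fun x => fineHat_shift k x) (fun x => fineHat_shift l x)
    (fun x => box_shift x) (T.isClosed_box K ℓ).measurableSet (T.isClosed_box K' ℓ).measurableSet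

variable {Tε : CartesianMesh d} {α β : ℝ} {A : (Fin d → ℝ) → ℝ}

lemma stiffness_pos (hd : 1 ≤ d) (hK : T.IsInterior ℓ K) (hα : 0 < α)
    (hA : A ∈ coeffs T.domain Tε α β) {v : FineIdx d r ℓ → ℝ} (hv : v ≠ 0) :
    0 < v ⬝ᵥ (stiffness T r hr ℓ K A).mulVec v := by
  have hb := bddCoeff_of_mem_coeffs hα hA
  rw [dotProduct_stiffness hb]
  exact energy_fineFun_pos hd hK hb hα (hA.2.1.mono fun x h => h.1) hv

lemma stiffness_one_pos (hd : 1 ≤ d) (hK : T.IsInterior ℓ K) {v : FineIdx d r ℓ → ℝ} (hv : v ≠ 0) :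
    0 < v ⬝ᵥ (stiffness T r hr ℓ K fun _ => 1).mulVec v :=
  stiffness_pos (Tε := T) hd hK one_pos (mem_coeffs_const le_rfl le_rfl) hv

lemma stiffness_le_mul (hα : 0 < α) (hA : A ∈ coeffs T.domain Tε α β) (v : FineIdx d r ℓ → ℝ) :
    v ⬝ᵥ (stiffness T r hr ℓ K A).mulVec v ≤
      β * (v ⬝ᵥ (stiffness T r hr ℓ K fun _ => 1).mulVec v) := by
  have hb := bddCoeff_of_mem_coeffs hα hA
  rw [dotProduct_stiffness hb, dotProduct_stiffness (bddCoeff_const hb.1 1), ← energy_const]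
  exact energy_mono_coeff hb (bddCoeff_const hb.1 β) (isLip_fineFun v) (hA.2.1.mono fun x h => h.2)

lemma mul_le_stiffness (hα : 0 < α) (hA : A ∈ coeffs T.domain Tε α β) (v : FineIdx d r ℓ → ℝ) :
    α * (v ⬝ᵥ (stiffness T r hr ℓ K fun _ => 1).mulVec v) ≤
      v ⬝ᵥ (stiffness T r hr ℓ K A).mulVec v := by
  have hb := bddCoeff_of_mem_coeffs hα hA
  rw [dotProduct_stiffness hb, dotProduct_stiffness (bddCoeff_const hb.1 1), ← energy_const]
  exact energy_mono_coeff (bddCoeff_const hb.1 α) hb (isLip_fineFun v) (hA.2.1.mono fun x h => h.1)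

lemma schur_isSymm (A : (Fin d → ℝ) → ℝ) : (schur T r hr ℓ K A).IsSymm :=
  isSymm_conj (isSymm_inv (stiffness_isSymm A)) _

lemma dotProduct_schur (v : (Fin d → Fin (2 * ℓ + 2)) → ℝ) :
    v ⬝ᵥ (schur T r hr ℓ K A).mulVec v = (interpMat T r hr ℓ K).transpose.mulVec v ⬝ᵥ
      (stiffness T r hr ℓ K A)⁻¹.mulVec ((interpMat T r hr ℓ K).transpose.mulVec v) :=
  dotProduct_conj _ _ _

lemma schur_one_eq (hK : T.IsInterior ℓ K) (hK' : T.IsInterior ℓ K') :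
    schur T r hr ℓ K' (fun _ => 1) = schur T r hr ℓ K (fun _ => 1) := by
  unfold schur
  rw [stiffness_one_eq hK hK', interpMat_eq_of_isInterior hK hK']

lemma schur_one_pos (hd : 1 ≤ d) (hr3 : 3 ≤ r) (hK : T.IsInterior ℓ K)
    {v : (Fin d → Fin (2 * ℓ + 2)) → ℝ} (hv : v ≠ 0) :
    0 < v ⬝ᵥ (schur T r hr ℓ K fun _ => 1).mulVec v := by
  rw [dotProduct_schur]
  exact dotProduct_inv_pos (fun w hw => stiffness_one_pos hd hK hw)
    fun h => hv (interpMat_transpose_injective hr3 hK h)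

/-- Y contains S⁻¹, so the lower bound α S₁ ≤ S becomes an upper bound with α⁻¹. -/
lemma schur_le_mul (hd : 1 ≤ d) (hK : T.IsInterior ℓ K) (hα : 0 < α)
    (hA : A ∈ coeffs T.domain Tε α β) (v : (Fin d → Fin (2 * ℓ + 2)) → ℝ) :
    v ⬝ᵥ (schur T r hr ℓ K A).mulVec v ≤
      α⁻¹ * (v ⬝ᵥ (schur T r hr ℓ K fun _ => 1).mulVec v) := by
  rw [dotProduct_schur, dotProduct_schur]
  refine dotProduct_inv_le (stiffness_isSymm _) (fun w hw => stiffness_one_pos hd hK hw)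
    (fun w hw => stiffness_pos hd hK hα hA hw) (fun w => ?_) _
  rw [inv_mul_eq_div, le_div_iff₀ hα, mul_comm]
  exact mul_le_stiffness hα hA w

lemma schur_one_le_mul (hd : 1 ≤ d) (hK : T.IsInterior ℓ K) (hα : 0 < α)
    (hA : A ∈ coeffs T.domain Tε α β) (v : (Fin d → Fin (2 * ℓ + 2)) → ℝ) :
    v ⬝ᵥ (schur T r hr ℓ K fun _ => 1).mulVec v ≤ β * (v ⬝ᵥ (schur T r hr ℓ K A).mulVec v) := by
  rw [dotProduct_schur, dotProduct_schur]
  exact dotProduct_inv_le (stiffness_isSymm _) (fun w hw => stiffness_pos hd hK hα hA hw)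
    (fun w hw => stiffness_one_pos hd hK hw) (fun w => stiffness_le_mul hα hA w) _

end Existence

/-! ### Admissible parameters -/

lemma Comparable.of_le {a b c x y : ℝ} (hx : 0 ≤ x) (hy : 0 ≤ y) (hac : a ≤ c) (hbc : b ≤ c)
    (h1 : x ≤ a * y) (h2 : y ≤ b * x) : Comparable c x y :=
  ⟨h1.trans (mul_le_mul_of_nonneg_right hac hy), h2.trans (mul_le_mul_of_nonneg_right hbc hx)⟩

/-- With X = (σ S)⁻¹ the matrix σ I X Iᵀ is exactly Y. An error θ in X changes the quadratic form at
v by at most σ θ ‖Iᵀ‖² |v|². -/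
lemma spectralBounds_conj_approx {n m : Type} [Fintype n] [DecidableEq n] [Fintype m]
    [DecidableEq m] {S X : Matrix n n ℝ} {I : Matrix m n ℝ} {σ θ a b e : ℝ} (hσ : 0 < σ)
    (hS : IsUnit S.det) (hX : specNorm ((σ • S)⁻¹ - X) ≤ θ)
    (hY : SpectralBounds (I * S⁻¹ * I.transpose) a b)
    (he : σ * (θ * specNorm I.transpose ^ 2) ≤ e) :
    SpectralBounds (σ • (I * X * I.transpose)) (a - e) (b + e) := by
  intro v
  obtain ⟨h1, h2⟩ := hY v
  have hv := dotProduct_self_nonneg' v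
  rw [dotProduct_conj] at h1 h2
  rw [Matrix.smul_mulVec, dotProduct_smul, smul_eq_mul, dotProduct_conj]
  set w := I.transpose.mulVec v with hw
  have hinv : (σ • S)⁻¹ = σ⁻¹ • S⁻¹ := by
    have := invertibleOfNonzero hσ.ne'
    rw [Matrix.inv_smul S σ hS, invOf_eq_inv]
  have h3 := abs_le.1 (abs_dotProduct_mulVec_le ((σ • S)⁻¹ - X) w)
  have hw1 : w ⬝ᵥ w ≤ specNorm I.transpose ^ 2 * (v ⬝ᵥ v) := dotProduct_mulVec_self_le _ _
  have h4 : specNorm ((σ • S)⁻¹ - X) * (w ⬝ᵥ w) ≤ θ * (specNorm I.transpose ^ 2 * (v ⬝ᵥ v)) :=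
    mul_le_mul hX hw1 (dotProduct_self_nonneg' w) ((specNorm_nonneg _).trans hX)
  rw [Matrix.sub_mulVec, dotProduct_sub, hinv, Matrix.smul_mulVec, dotProduct_smul, smul_eq_mul]
    at h3
  rw [hinv] at h4
  have h5 := mul_le_mul_of_nonneg_right he hv
  have h6 : σ * (σ⁻¹ * (w ⬝ᵥ S⁻¹.mulVec w)) = w ⬝ᵥ S⁻¹.mulVec w := by
    rw [← mul_assoc, mul_inv_cancel₀ hσ.ne', one_mul]
  have h7 := mul_le_mul_of_nonneg_left (h3.2.trans h4) hσ.le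
  have h8 := mul_le_mul_of_nonneg_left (h3.1.trans' (neg_le_neg h4)) hσ.le
  constructor <;> linarith

section Existence

variable {d : ℕ} {T : CartesianMesh d} {r : ℕ} {hr : 0 < r} {ℓ : ℕ} {K K' : Fin d → ℤ}

lemma CartesianMesh.hat_le_one (T : CartesianMesh d) (z : Fin d → ℤ) (x : Fin d → ℝ) :
    T.hat z x ≤ 1 := by
  rw [T.hat_eq_prod]
  exact Finset.prod_le_one (fun _ _ => tent_nonneg _) fun _ _ =>
    max_le zero_le_one (sub_le_self _ (abs_nonneg _))

lemma exists_specNorm_prolong_le (T : CartesianMesh d) (r : ℕ) (hr : 0 < r) (ℓ : ℕ) :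
    ∃ s : ℝ, 0 ≤ s ∧ ∀ K, specNorm (prolong T r hr ℓ K) ≤ s ∧ specNorm (prolongElt T r hr ℓ K) ≤ s := by
  have habs : ∀ z x, |T.hat z x| ≤ 1 := fun z x => by
    rw [abs_of_nonneg (T.hat_nonneg z x)]; exact T.hat_le_one z x
  have h0 : (0 : ℝ) ≤ (Fintype.card (FineIdx d r ℓ) : ℕ) := Nat.cast_nonneg _
  have h1 : (0 : ℝ) ≤ (Fintype.card (Fin d → Fin (2 * ℓ + 2)) : ℕ) := Nat.cast_nonneg _
  have h2 : (0 : ℝ) ≤ (Fintype.card (Fin d → Fin 2) : ℕ) := Nat.cast_nonneg _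
  refine ⟨Fintype.card (FineIdx d r ℓ) + Fintype.card (Fin d → Fin (2 * ℓ + 2)) +
    Fintype.card (Fin d → Fin 2), by positivity, fun K => ⟨?_, ?_⟩⟩
  · rw [← mul_one (_ + _ + _)]
    exact specNorm_le_of_entry_le zero_le_one (fun k i => habs _ _) (by linarith) (by linarith)
  · rw [← mul_one (_ + _ + _)]
    refine specNorm_le_of_entry_le zero_le_one (fun k j => ?_) (by linarith) (by linarith)
    simp only [prolongElt, Matrix.of_apply]
    split_ifs
    · exact habs _ _
    · simp

variable {Tε : CartesianMesh d} {α β : ℝ}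

lemma lam_stiffness_bounds [Nonempty (Fin ((2 * ℓ + 1) * r - 1))] (hα : 0 < α) (hβ : 0 < β)
    {A : (Fin d → ℝ) → ℝ} (hA : A ∈ coeffs T.domain Tε α β) {K₀ : Fin d → ℤ}
    (hK₀ : T.IsInterior ℓ K₀) (hK : T.IsInterior ℓ K) :
    (α * lamMin (stiffness T r hr ℓ K₀ fun _ => 1) ≤ lamMin (stiffness T r hr ℓ K A) ∧
        lamMin (stiffness T r hr ℓ K A) ≤ β * lamMin (stiffness T r hr ℓ K₀ fun _ => 1)) ∧
      (α * lamMax (stiffness T r hr ℓ K₀ fun _ => 1) ≤ lamMax (stiffness T r hr ℓ K A) ∧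
        lamMax (stiffness T r hr ℓ K A) ≤ β * lamMax (stiffness T r hr ℓ K₀ fun _ => 1)) := by
  set X := (stiffness T r hr ℓ K₀ fun _ => 1)
  have hS₁s : X.IsSymm := stiffness_isSymm _
  have e : X = stiffness T r hr ℓ K fun _ => 1 := (stiffness_one_eq hK₀ hK).symm
  have hl : ∀ v, v ⬝ᵥ X.mulVec v ≤ α⁻¹ * (v ⬝ᵥ (stiffness T r hr ℓ K A).mulVec v) := fun v => by
    rw [inv_mul_eq_div, le_div_iff₀ hα, mul_comm, e]
    exact mul_le_stiffness hα hA v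
  have hu : ∀ v, v ⬝ᵥ (stiffness T r hr ℓ K A).mulVec v ≤ β * (v ⬝ᵥ X.mulVec v) := fun v => by
    rw [e]; exact stiffness_le_mul hα hA v
  have h1 := lamMin_le_mul hS₁s (stiffness_isSymm A) (inv_pos.2 hα) hl
  have h2 := lamMax_le_mul hS₁s (stiffness_isSymm A) (inv_pos.2 hα).le hl
  rw [inv_mul_eq_div, le_div_iff₀ hα, mul_comm] at h1 h2
  exact ⟨⟨h1, lamMin_le_mul (stiffness_isSymm A) hS₁s hβ hu⟩,
    ⟨h2, lamMax_le_mul (stiffness_isSymm A) hS₁s hβ.le hu⟩⟩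
lemma lam_schur_bounds (hd : 1 ≤ d) (hα : 0 < α) (hβ : 0 < β)
    {A : (Fin d → ℝ) → ℝ} (hA : A ∈ coeffs T.domain Tε α β) {K₀ : Fin d → ℤ}
    (hK₀ : T.IsInterior ℓ K₀) (hK : T.IsInterior ℓ K) :
    (lamMin (schur T r hr ℓ K₀ fun _ => 1) / β ≤ lamMin (schur T r hr ℓ K A) ∧
        lamMin (schur T r hr ℓ K A) ≤ lamMin (schur T r hr ℓ K₀ fun _ => 1) / α) ∧
      (lamMax (schur T r hr ℓ K₀ fun _ => 1) / β ≤ lamMax (schur T r hr ℓ K A) ∧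
        lamMax (schur T r hr ℓ K A) ≤ lamMax (schur T r hr ℓ K₀ fun _ => 1) / α) := by
  set X := (schur T r hr ℓ K₀ fun _ => 1)
  have hY₁s : X.IsSymm := schur_isSymm _
  have e : X = schur T r hr ℓ K fun _ => 1 := (schur_one_eq hK₀ hK).symm
  have hu : ∀ v, v ⬝ᵥ (schur T r hr ℓ K A).mulVec v ≤ α⁻¹ * (v ⬝ᵥ X.mulVec v) := fun v => by
    rw [e]; exact schur_le_mul hd hK hα hA v
  have hl : ∀ v, v ⬝ᵥ X.mulVec v ≤ β * (v ⬝ᵥ (schur T r hr ℓ K A).mulVec v) := fun v => by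
    rw [e]; exact schur_one_le_mul hd hK hα hA v
  have h1 := lamMin_le_mul hY₁s (schur_isSymm A) hβ hl
  have h2 := lamMax_le_mul hY₁s (schur_isSymm A) hβ.le hl
  have h3 := lamMin_le_mul (schur_isSymm A) hY₁s (inv_pos.2 hα) hu
  have h4 := lamMax_le_mul (schur_isSymm A) hY₁s (inv_pos.2 hα).le hu
  rw [inv_mul_eq_div] at h3 h4
  exact ⟨⟨(div_le_iff₀' hβ).2 h1, h3⟩, ⟨(div_le_iff₀' hβ).2 h2, h4⟩⟩
-- The parameters are the bounds for the coefficient one times α or β, and each rescaling factor is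
-- half of its supremum. The bounds with a hat leave room for the perturbation X: half of the lower
-- bound y0/β, and 3/2 of the upper bound y1/α. The constant is the loss in `δHat`: the ratio of
-- (y0/α)(β/y1) to α y0 / (6 β y1) is 6 (β/α)².
lemma sharp_of_bounds {𝒜 : Set ((Fin d → ℝ) → ℝ)} {s0 s1 y0 y1 : ℝ} (hα : 0 < α) (hαβ : α ≤ β)
    (hs0 : 0 < s0) (hs1 : 0 < s1) (hy0 : 0 < y0) (hy1 : 0 < y1)
    (hSS : ∀ A ∈ 𝒜, ∀ K, T.IsInterior ℓ K →
      (α * s0 ≤ lamMin (stiffness T r hr ℓ K A) ∧ lamMin (stiffness T r hr ℓ K A) ≤ β * s0) ∧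
      (α * s1 ≤ lamMax (stiffness T r hr ℓ K A) ∧ lamMax (stiffness T r hr ℓ K A) ≤ β * s1))
    (hYY : ∀ A ∈ 𝒜, ∀ K, T.IsInterior ℓ K →
      (y0 / β ≤ lamMin (schur T r hr ℓ K A) ∧ lamMin (schur T r hr ℓ K A) ≤ y0 / α) ∧
      (y1 / β ≤ lamMax (schur T r hr ℓ K A) ∧ lamMax (schur T r hr ℓ K A) ≤ y1 / α)) (θ γ : ℝ) :
    Sharp T r hr ℓ 𝒜 (6 * (β / α) ^ 2) ⟨α * s0, β * s1, (2 * (β * s1))⁻¹, y0 / (2 * β),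
      3 * (y1 / (2 * α)), (6 * (y1 / (2 * α)))⁻¹, θ, γ⟩ := by
  have hβ : 0 < β := hα.trans_le hαβ
  have hσ0 : 0 < (2 * (β * s1))⁻¹ := by positivity
  have e1 : y0 / β = 2 * (y0 / (2 * β)) := by field_simp
  have e2 : y1 / α = 2 * (y1 / (2 * α)) := by field_simp
  have hp1 : 0 < y0 / (2 * β) := by positivity
  have hp2 : 0 < y1 / (2 * α) := by positivity
  have hκ : 1 ≤ β / α := (one_le_div hα).2 hαβ
  have hκ2 : β / α ≤ (β / α) ^ 2 := by nlinarith
  have hc1 : (1 : ℝ) ≤ 6 * (β / α) ^ 2 := by linarith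
  have hc2 : 2 * (β / α) ≤ 6 * (β / α) ^ 2 := by linarith
  have hc3 : 2 * (β / α) ^ 2 ≤ 6 * (β / α) ^ 2 := by linarith
  refine ⟨fun A hA K hK => ?_, fun A hA K hK => ?_, fun A hA K hK => ?_, fun A hA K hK => ?_⟩
  · obtain ⟨-, h3, h4⟩ := hSS A hA K hK
    have h5 : 0 < lamMax (stiffness T r hr ℓ K A) := lt_of_lt_of_le (by positivity) h3
    refine Comparable.of_le hσ0.le (inv_pos.2 h5).le hc1 hc2 ?_ ?_
    · rw [one_mul]
      exact inv_anti₀ h5 (h4.trans (by linarith [mul_pos hβ hs1]))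
    · refine (inv_anti₀ (by positivity) h3).trans (le_of_eq ?_)
      field_simp
  · obtain ⟨⟨h1, h2⟩, h3, h4⟩ := hSS A hA K hK
    have h5 : 0 < lamMax (stiffness T r hr ℓ K A) := lt_of_lt_of_le (by positivity) h3
    have h6 : 0 < lamMin (stiffness T r hr ℓ K A) := lt_of_lt_of_le (by positivity) h1
    refine Comparable.of_le (mul_pos hσ0 (by positivity)).le (by positivity) hc1 hc3 ?_ ?_
    · rw [one_mul, Params.δ]
      refine le_trans ?_ (mul_le_mul h1 (inv_anti₀ h5 h4) (by positivity) h6.le)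
      rw [mul_comm]
      refine mul_le_mul_of_nonneg_left ?_ (by positivity)
      exact inv_anti₀ (by positivity) (by linarith [mul_pos hβ hs1])
    · refine (mul_le_mul h2 (inv_anti₀ (by positivity) h3) (by positivity)
        (by positivity)).trans (le_of_eq ?_)
      simp only [Params.δ]; field_simp
  · obtain ⟨⟨h1, h2⟩, -⟩ := hYY A hA K hK
    refine Comparable.of_le hp1.le (le_trans (by positivity) h1) hc1 hc2 ?_ ?_
    · simp only; linarith
    · refine h2.trans (le_of_eq ?_)
      simp only; field_simp
  · obtain ⟨⟨h1, h2⟩, h3, h4⟩ := hYY A hA K hK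
    have h5 : 0 < lamMax (schur T r hr ℓ K A) := lt_of_lt_of_le (by positivity) h3
    have h6 : 0 < lamMin (schur T r hr ℓ K A) := lt_of_lt_of_le (by positivity) h1
    refine Comparable.of_le (by simp only [Params.δHat]; positivity) (by positivity)
      hc1 le_rfl ?_ ?_
    · rw [one_mul, Params.δHat]
      refine le_trans ?_ (mul_le_mul h1 (inv_anti₀ h5 h4) (by positivity) h6.le)
      rw [mul_comm]
      refine mul_le_mul (by linarith) ?_ (by positivity) (by positivity)
      exact inv_anti₀ (by positivity) (by linarith)
    · refine (mul_le_mul h2 (inv_anti₀ (by positivity) h3) (by positivity)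
        (by positivity)).trans (le_of_eq ?_)
      simp only [Params.δHat]; field_simp

lemma exists_tolerances {η y a1 a2 c : ℝ} (hη : 0 < η) (hy : 0 < y) (ha1 : 0 ≤ a1) (ha2 : 0 ≤ a2)
    (hc : 0 < c) : ∃ θ γ : ℝ, θ ∈ Ioo 0 η ∧ γ ∈ Ioo 0 η ∧ θ < y ∧ θ < y / c ∧
      a1 * θ + a2 * γ ≤ η := by
  have h : 0 < min (min η y) (min (y / c) (η / (2 * (a1 + 1)))) :=
    lt_min (lt_min hη hy) (lt_min (by positivity) (by positivity))
  obtain ⟨θ, h1, h2⟩ := exists_between h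
  obtain ⟨γ, h3, h4⟩ := exists_between (lt_min hη (show 0 < η / (2 * (a2 + 1)) by positivity))
  simp only [lt_min_iff] at h2 h4
  refine ⟨θ, γ, ⟨h1, h2.1.1⟩, ⟨h3, h4.1⟩, h2.1.2, h2.2.1, ?_⟩
  have h5 := h2.2.2
  have h6 := h4.2
  rw [lt_div_iff₀ (by positivity)] at h5 h6
  linarith

lemma admissible_of_bounds (hd : 1 ≤ d) {η s0 s1 y0 y1 c sP θ γ : ℝ} (hα : 0 < α) (hαβ : α ≤ β)
    (hs0 : 0 < s0) (hs01 : s0 ≤ s1) (hy0 : 0 < y0) (hy01 : y0 ≤ y1) (hc : 0 < c)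
    (hI : ∀ K, T.IsInterior ℓ K → specNorm (interpMat T r hr ℓ K) = c)
    (hP : ∀ K, specNorm (prolong T r hr ℓ K) ≤ sP ∧ specNorm (prolongElt T r hr ℓ K) ≤ sP)
    (hS : ∀ A ∈ coeffs T.domain Tε α β, ∀ K, T.IsInterior ℓ K →
      SpectralBounds (stiffness T r hr ℓ K A) (α * s0) (β * s1))
    (hY : ∀ A ∈ coeffs T.domain Tε α β, ∀ K, T.IsInterior ℓ K →
      SpectralBounds (schur T r hr ℓ K A) (y0 / β) (y1 / α))
    (hYm : ∀ A ∈ coeffs T.domain Tε α β, ∀ K, T.IsInterior ℓ K →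
      y0 / β ≤ lamMin (schur T r hr ℓ K A))
    (hθ : θ ∈ Ioo 0 η) (hγ : γ ∈ Ioo 0 η) (hθ1 : θ < y0 / β)
    (hθ2 : θ < y0 / β / (2 * (2 * (β * s1))⁻¹ * c ^ 2))
    (htol : (2 * (β * s1))⁻¹ * sP * sP * c ^ 4 / (y0 / (2 * β)) ^ 2 * θ + sP * sP * c ^ 2 * γ ≤ η) :
    Admissible T r hr ℓ (coeffs T.domain Tε α β) η ⟨α * s0, β * s1, (2 * (β * s1))⁻¹, y0 / (2 * β),
      3 * (y1 / (2 * α)), (6 * (y1 / (2 * α)))⁻¹, θ, γ⟩ := by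
  have hβ : 0 < β := hα.trans_le hαβ
  have hs1 := hs0.trans_le hs01
  have hy1 := hy0.trans_le hy01
  have hσ0 : 0 < (2 * (β * s1))⁻¹ := by positivity
  have hcmp : y0 / (2 * β) ≤ y1 / (2 * α) :=
    div_le_div₀ hy1.le hy01 (by positivity) (by linarith)
  have e1 : y0 / β = 2 * (y0 / (2 * β)) := by field_simp
  have e2 : y1 / α = 2 * (y1 / (2 * α)) := by field_simp
  have hp1 : 0 < y0 / (2 * β) := by positivity
  have hp2 : 0 < y1 / (2 * α) := by positivity
  -- The third admissibility condition says that the perturbation of Y is below half of the lower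
  -- bound of its spectrum.
  have hθe : (2 * (β * s1))⁻¹ * (θ * c ^ 2) ≤ y0 / (2 * β) := by
    rw [lt_div_iff₀ (by positivity)] at hθ2
    linarith
  refine
    { Vinf_pos := mul_pos hα hs0
      Vinf_le := mul_le_mul hαβ hs01 hs0.le hβ.le
      bounds := hS
      vresc_mem := ⟨hσ0, inv_strictAnti₀ (by positivity) (by linarith [mul_pos hβ hs1])⟩
      θ_mem := hθ
      γ_mem := hγ
      θ_lt := fun A hA K hK => ?_
      VinfHat_pos := hp1
      VinfHat_le := by simp only; linarith
      bounds_schur := fun A hA K hK v => ?_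
      bounds_schur_approx := fun A hA K hK X _ hX v => ?_
      vrescHat_mem := ⟨by positivity, inv_strictAnti₀ (by positivity) (by linarith)⟩
      tolerance := fun K hK => ?_ }
  · rw [specNorm_transpose, hI K hK]
    have h := hYm A hA K hK
    exact lt_min (hθ1.trans_le h) (hθ2.trans_le (div_le_div_of_nonneg_right h (by positivity)))
  · obtain ⟨h1, h2⟩ := hY A hA K hK v
    have hv := dotProduct_self_nonneg' v
    refine ⟨(mul_le_mul_of_nonneg_right ?_ hv).trans h1,
      h2.trans (mul_le_mul_of_nonneg_right ?_ hv)⟩ <;> simp only <;> linarith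
  · obtain ⟨h1, h2⟩ := spectralBounds_conj_approx hσ0
      (isUnit_det_of_pos fun w hw => stiffness_pos (r := r) (hr := hr) hd hK hα hA hw) hX
      (hY A hA K hK) (e := y0 / (2 * β)) (by rw [specNorm_transpose, hI K hK]; exact hθe) v
    have hv := dotProduct_self_nonneg' v
    refine ⟨(mul_le_mul_of_nonneg_right ?_ hv).trans h1,
      h2.trans (mul_le_mul_of_nonneg_right ?_ hv)⟩ <;> simp only <;> linarith
  · obtain ⟨h1, h2⟩ := hP K
    have h3 := specNorm_nonneg (prolong T r hr ℓ K)
    have h4 := specNorm_nonneg (prolongElt T r hr ℓ K)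
    have h5 := hθ.1
    have h6 := hγ.1
    have hsP := h3.trans h1
    rw [hI K hK]
    refine le_trans ?_ htol
    simp only
    gcongr

lemma exists_admissible_sharp (hd : 1 ≤ d) (hr3 : 3 ≤ r) {η : ℝ}
    (hα : 0 < α) (hαβ : α ≤ β) (hη : 0 < η) :
    ∃ P, Admissible T r hr ℓ (coeffs T.domain Tε α β) η P ∧
      Sharp T r hr ℓ (coeffs T.domain Tε α β) (6 * (β / α) ^ 2) P := by
  by_cases hex : ∃ K, T.IsInterior ℓ K
  swap
  -- Without interior elements only the sign and range conditions remain.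
  · have hno : ∀ K, ¬ T.IsInterior ℓ K := not_exists.1 hex
    have hη2 : η / 2 ∈ Ioo 0 η := ⟨by positivity, by linarith⟩
    have hres : (1 / 2 : ℝ) ∈ Ioo 0 (1 : ℝ)⁻¹ := ⟨by norm_num, by norm_num⟩
    exact ⟨⟨1, 1, 1 / 2, 1, 1, 1 / 2, η / 2, η / 2⟩,
      ⟨one_pos, le_rfl, fun _ _ K hK => (hno K hK).elim, hres, hη2, hη2,
        fun _ _ K hK => (hno K hK).elim, one_pos, le_rfl, fun _ _ K hK => (hno K hK).elim,
        fun _ _ K hK => (hno K hK).elim, hres, fun K hK => (hno K hK).elim⟩,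
      ⟨fun _ _ K hK => (hno K hK).elim, fun _ _ K hK => (hno K hK).elim,
        fun _ _ K hK => (hno K hK).elim, fun _ _ K hK => (hno K hK).elim⟩⟩
  obtain ⟨K₀, hK₀⟩ := hex
  have hβ : 0 < β := hα.trans_le hαβ
  have hpos : 0 < (2 * ℓ + 1) * r - 1 := by
    have : 1 * r ≤ (2 * ℓ + 1) * r := Nat.mul_le_mul_right r (by lia)
    lia
  have : Nonempty (Fin ((2 * ℓ + 1) * r - 1)) := ⟨⟨0, hpos⟩⟩
  have hS₁s : (stiffness T r hr ℓ K₀ fun _ => 1).IsSymm := stiffness_isSymm _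
  have hY₁s : (schur T r hr ℓ K₀ fun _ => 1).IsSymm := schur_isSymm _
  have hs0 := lamMin_pos hS₁s fun v hv => stiffness_one_pos hd hK₀ hv
  have hy0 := lamMin_pos hY₁s fun v hv => schur_one_pos hd hr3 hK₀ hv
  have hs01 := lamMin_le_lamMax hS₁s
  have hy01 := lamMin_le_lamMax hY₁s
  have hSS := fun A (hA : A ∈ coeffs T.domain Tε α β) K (hK : T.IsInterior ℓ K) =>
    lam_stiffness_bounds (r := r) (hr := hr) hα hβ hA hK₀ hK
  have hYY := fun A (hA : A ∈ coeffs T.domain Tε α β) K (hK : T.IsInterior ℓ K) =>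
    lam_schur_bounds (r := r) (hr := hr) hd hα hβ hA hK₀ hK
  -- The norm of I is a divisor in the condition on θ; I is non-zero since its transpose is
  -- injective.
  have hc0 : 0 < specNorm (interpMat T r hr ℓ K₀) := by
    rw [← specNorm_transpose]
    refine (specNorm_nonneg _).lt_of_ne fun h0 => ?_
    have h1 := dotProduct_mulVec_self_le (interpMat T r hr ℓ K₀).transpose 1
    rw [← h0, zero_pow two_ne_zero, zero_mul] at h1
    have h2 : (interpMat T r hr ℓ K₀).transpose.mulVec 1 = 0 :=
      dotProduct_self_eq_zero.1 (le_antisymm h1 (dotProduct_self_nonneg' _))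
    exact one_ne_zero (interpMat_transpose_injective hr3 hK₀ h2)
  obtain ⟨sP, hsP, hprol⟩ := exists_specNorm_prolong_le T r hr ℓ
  generalize lamMin (stiffness T r hr ℓ K₀ fun _ => 1) = s0 at *
  generalize lamMax (stiffness T r hr ℓ K₀ fun _ => 1) = s1 at *
  generalize lamMin (schur T r hr ℓ K₀ fun _ => 1) = y0 at *
  generalize lamMax (schur T r hr ℓ K₀ fun _ => 1) = y1 at *
  have hs1 := hs0.trans_le hs01
  obtain ⟨θ, γ, hθ, hγ, hθ1, hθ2, htol⟩ := exists_tolerances hη (div_pos hy0 hβ)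
    (a1 := (2 * (β * s1))⁻¹ * sP * sP * specNorm (interpMat T r hr ℓ K₀) ^ 4 /
      (y0 / (2 * β)) ^ 2)
    (a2 := sP * sP * specNorm (interpMat T r hr ℓ K₀) ^ 2)
    (c := 2 * (2 * (β * s1))⁻¹ * specNorm (interpMat T r hr ℓ K₀) ^ 2)
    (by positivity) (by positivity) (by positivity)
  refine ⟨_, admissible_of_bounds hd hα hαβ hs0 hs01 hy0 hy01 hc0
    (fun K hK => by rw [interpMat_eq_of_isInterior hK₀ hK]) hprol (fun A hA K hK v => ?_)
    (fun A hA K hK v => ?_) (fun A hA K hK => (hYY A hA K hK).1.1) hθ hγ hθ1 hθ2 htol,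
    sharp_of_bounds hα hαβ hs0 hs1 hy0 (hy0.trans_le hy01) hSS hYY θ γ⟩
  · have h := spectralBounds_lam (stiffness_isSymm (T := T) (r := r) (hr := hr) (K := K) A) v
    have hv := dotProduct_self_nonneg' v
    exact ⟨(mul_le_mul_of_nonneg_right (hSS A hA K hK).1.1 hv).trans h.1,
      h.2.trans (mul_le_mul_of_nonneg_right (hSS A hA K hK).2.2 hv)⟩
  · have h := spectralBounds_lam (schur_isSymm (T := T) (r := r) (hr := hr) (K := K) A) v
    have hv := dotProduct_self_nonneg' v
    exact ⟨(mul_le_mul_of_nonneg_right (hYY A hA K hK).1.1 hv).trans h.1,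
      h.2.trans (mul_le_mul_of_nonneg_right (hYY A hA K hK).2.2 hv)⟩

end Existence

/-! ### A fixed-point iteration for constrained linear systems -/

section Constrained

variable {N n J m : Type} [Fintype N] [Fintype n] [Fintype J] [Fintype m] [DecidableEq N]
  [DecidableEq n] [DecidableEq J] [DecidableEq m]

/-- The orthogonal projection onto the kernel of `I` (if `I` has full row rank). -/
def kerProj (I : Matrix m n ℝ) : Matrix n n ℝ := 1 - I.transpose * (I * I.transpose)⁻¹ * I

/-- The iteration matrix of a gradient method on the kernel of `I`. -/
def projIter (I : Matrix m n ℝ) (S : Matrix n n ℝ) (σ : ℝ) : Matrix n n ℝ :=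
  kerProj I - σ • (kerProj I * S * kerProj I)

lemma dotProduct_mulVec_comm_of_isSymm {M : Matrix n n ℝ} (hM : M.IsSymm) (v w : n → ℝ) :
    v ⬝ᵥ M.mulVec w = M.mulVec v ⬝ᵥ w := by
  rw [Matrix.dotProduct_mulVec, ← Matrix.mulVec_transpose, hM.eq]

lemma kerProj_isSymm (I : Matrix m n ℝ) : (kerProj I).IsSymm := by
  refine Matrix.isSymm_one.sub ?_
  have h : (I * I.transpose).IsSymm := by
    rw [Matrix.IsSymm, Matrix.transpose_mul, Matrix.transpose_transpose]
  simpa using isSymm_conj (isSymm_inv h) I.transpose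

lemma kerProj_mulVec_of_eq_zero {I : Matrix m n ℝ} {x : n → ℝ} (hx : I.mulVec x = 0) :
    (kerProj I).mulVec x = x := by
  rw [kerProj, Matrix.sub_mulVec, Matrix.one_mulVec, ← Matrix.mulVec_mulVec, hx,
    Matrix.mulVec_zero, sub_zero]

variable {I : Matrix m n ℝ} (hI : ∀ y, I.transpose.mulVec y = 0 → y = 0)
include hI

lemma mulVec_kerProj (v : n → ℝ) : I.mulVec ((kerProj I).mulVec v) = 0 := by
  have hdet : IsUnit (I * I.transpose).det := isUnit_det_of_pos fun y hy => by
    have := dotProduct_self_pos fun h => hy (hI y h)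
    rwa [← Matrix.mulVec_mulVec, Matrix.dotProduct_mulVec, ← Matrix.mulVec_transpose]
  rw [Matrix.mulVec_mulVec, kerProj, Matrix.mul_sub, Matrix.mul_one, ← Matrix.mul_assoc,
    ← Matrix.mul_assoc, Matrix.mul_nonsing_inv _ hdet, Matrix.one_mul, sub_self,
    Matrix.zero_mulVec]

lemma kerProj_mulVec_kerProj (v : n → ℝ) :
    (kerProj I).mulVec ((kerProj I).mulVec v) = (kerProj I).mulVec v :=
  kerProj_mulVec_of_eq_zero (mulVec_kerProj hI v)

lemma dotProduct_kerProj (v : n → ℝ) :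
    v ⬝ᵥ (kerProj I).mulVec v = (kerProj I).mulVec v ⬝ᵥ (kerProj I).mulVec v := by
  conv_lhs => rw [← kerProj_mulVec_kerProj hI v]
  exact dotProduct_mulVec_comm_of_isSymm (kerProj_isSymm I) _ _

lemma dotProduct_kerProj_le (v : n → ℝ) :
    (kerProj I).mulVec v ⬝ᵥ (kerProj I).mulVec v ≤ v ⬝ᵥ v := by
  have h := dotProduct_self_nonneg' (v - (kerProj I).mulVec v)
  have h1 := dotProduct_kerProj hI v
  rw [sub_dotProduct, dotProduct_sub, dotProduct_sub, dotProduct_comm ((kerProj I).mulVec v) v, h1] at h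
  linarith

variable {S : Matrix n n ℝ} {σ δ : ℝ}

omit hI in
lemma projIter_isSymm (hS : S.IsSymm) : (projIter I S σ).IsSymm := by
  refine (kerProj_isSymm I).sub (Matrix.IsSymm.smul ?_ _)
  have := isSymm_conj hS (kerProj I)
  rwa [(kerProj_isSymm I).eq] at this

lemma dotProduct_projIter (v : n → ℝ) : v ⬝ᵥ (projIter I S σ).mulVec v =
    (kerProj I).mulVec v ⬝ᵥ (kerProj I).mulVec v -
      σ * ((kerProj I).mulVec v ⬝ᵥ S.mulVec ((kerProj I).mulVec v)) := by
  rw [projIter, Matrix.sub_mulVec, dotProduct_sub, dotProduct_kerProj hI, Matrix.smul_mulVec,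
    dotProduct_smul, smul_eq_mul, ← Matrix.mulVec_mulVec, ← Matrix.mulVec_mulVec,
    dotProduct_mulVec_comm_of_isSymm (kerProj_isSymm I) v (S.mulVec _)]

variable (hδ : ∀ v, δ * (v ⬝ᵥ v) ≤ σ * (v ⬝ᵥ S.mulVec v))
  (hσS : ∀ v, σ * (v ⬝ᵥ S.mulVec v) ≤ v ⬝ᵥ v)

omit hδ in
include hσS in
lemma projIter_nonneg (v : n → ℝ) : 0 ≤ v ⬝ᵥ (projIter I S σ).mulVec v := by
  rw [dotProduct_projIter hI]
  linarith [hσS ((kerProj I).mulVec v)]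

-- On ker I the form is |v|² − σ v · S v, and it vanishes on the orthogonal complement. The spectrum
-- is thus at most 1 − δ, although E is not the full gradient step 1 − σ S.
include hδ in
lemma projIter_le (hδ1 : δ ≤ 1) (v : n → ℝ) :
    v ⬝ᵥ (projIter I S σ).mulVec v ≤ (1 - δ) * (v ⬝ᵥ v) := by
  rw [dotProduct_projIter hI]
  have h1 := hδ ((kerProj I).mulVec v)
  have h2 := mul_le_mul_of_nonneg_left (dotProduct_kerProj_le hI v) (sub_nonneg.2 hδ1)
  linarith

variable {b x : n → ℝ} (hx : I.mulVec x = 0)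
  (hx' : ∀ y, I.mulVec y = 0 → y ⬝ᵥ S.mulVec x = y ⬝ᵥ b)
include hx hx'

/-- Testing with Π v turns the constrained equations into Π S x = Π b, and Π x = x. -/
lemma eq_projIter_mulVec_add :
    x = (projIter I S σ).mulVec x + σ • (kerProj I).mulVec b := by
  have h : (kerProj I).mulVec (S.mulVec x) = (kerProj I).mulVec b := by
    refine dotProduct_eq _ _ fun v => ?_
    rw [dotProduct_comm, dotProduct_comm _ v, dotProduct_mulVec_comm_of_isSymm (kerProj_isSymm I),
      dotProduct_mulVec_comm_of_isSymm (kerProj_isSymm I), hx' _ (mulVec_kerProj hI v)]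
  rw [projIter, Matrix.sub_mulVec, Matrix.smul_mulVec, ← Matrix.mulVec_mulVec,
    ← Matrix.mulVec_mulVec, kerProj_mulVec_of_eq_zero hx, h, sub_add_cancel]

-- The solution is its own test vector: δ |x|² ≤ σ x · S x = x · (σ b) ≤ |x| |σ b|.
omit hI in
include hδ in
lemma dotProduct_solution_le (hδ0 : 0 ≤ δ) : δ ^ 2 * (x ⬝ᵥ x) ≤ (σ • b) ⬝ᵥ (σ • b) := by
  have h1 := hδ x
  rw [hx' x hx] at h1
  have h2 := dotProduct_mul_dotProduct_le x (σ • b)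
  rw [dotProduct_smul, smul_eq_mul] at h2
  have h3 := dotProduct_self_nonneg' x
  have h4 := dotProduct_self_nonneg' (σ • b)
  rcases h3.eq_or_lt with h0 | h0
  · rw [← h0, mul_zero]; exact h4
  have h5 : (δ * (x ⬝ᵥ x)) ^ 2 ≤ (σ * (x ⬝ᵥ b)) ^ 2 := pow_le_pow_left₀ (by positivity) h1 2
  refine le_of_mul_le_mul_left ?_ h0
  linarith

end Constrained

/-! ### Correctors in the powers of one matrix -/

section Encoding

variable {N n J m : Type} [Fintype N] [Fintype n] [Fintype J] [Fintype m] [DecidableEq N]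
  [DecidableEq n] [DecidableEq J] [DecidableEq m]

/-- A matrix whose powers contain approximations of `G - B X`, where the columns of `X` solve the
linear system with the matrix `S` and the right-hand sides `b` on the kernel of `I`. -/
def encMat (I : Matrix m n ℝ) (σ ρ : ℝ) (S : Matrix n n ℝ) (B : Matrix N n ℝ) (b : Matrix n J ℝ)
    (G : Matrix N J ℝ) : Matrix (N ⊕ (n ⊕ J)) (N ⊕ (n ⊕ J)) ℝ :=
  augmented ((ρ * σ) • B) (-(ρ ^ 2 * σ) • G) (projIter I S σ) ((ρ * σ) • (kerProj I * b))

variable {I : Matrix m n ℝ} {σ ρ δ c s : ℝ} {S : Matrix n n ℝ} {B : Matrix N n ℝ}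
  {b : Matrix n J ℝ} {G : Matrix N J ℝ}

lemma dotProduct_le_of_abs_le (hs : Fintype.card n ≤ s) {v : n → ℝ} (hv : ∀ k, |v k| ≤ c) :
    v ⬝ᵥ v ≤ s * c ^ 2 := by
  calc v ⬝ᵥ v ≤ ∑ _k : n, c ^ 2 := Finset.sum_le_sum fun k _ => by
        have := pow_le_pow_left₀ (abs_nonneg _) (hv k) 2
        rwa [sq_abs, sq] at this
    _ ≤ s * c ^ 2 := by
        rw [Finset.sum_const, nsmul_eq_mul]
        exact mul_le_mul_of_nonneg_right hs (sq_nonneg c)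

/-- With the right-hand side scaled by ρ the fixed point is ρ x, and B carries another ρ σ. Scaling
G by −ρ² σ gives all terms the common factor −ρ² σ, which the output layer removes. The last term is
the remainder of the Neumann series. The factor σ normalizes the entries; ρ makes the off-diagonal
blocks small. -/
lemma encMat_pow_apply (hI : ∀ y, I.transpose.mulVec y = 0 → y = 0) {j : J} {x : n → ℝ}
    (hx : I.mulVec x = 0) (hx' : ∀ y, I.mulVec y = 0 → y ⬝ᵥ S.mulVec x = y ⬝ᵥ b.col j) (k : ℕ)
    (i : N) : (encMat I σ ρ S B b G ^ (k + 1)) (.inl i) (.inr (.inr j)) =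
      -(ρ ^ 2 * σ) * (G i j - B.mulVec x i + B.mulVec ((projIter I S σ ^ k).mulVec x) i) := by
  have h := eq_projIter_mulVec_add (σ := σ) hI hx hx'
  rw [encMat, augmented_pow_apply (x := ρ • x)]
  · simp only [Matrix.smul_mulVec, Matrix.mulVec_smul, Pi.smul_apply, Matrix.smul_apply,
      smul_eq_mul]
    ring
  · conv_lhs => rw [h]
    rw [Matrix.mulVec_smul, smul_add, smul_smul]
    rfl

/-- The projection does not increase Euclidean lengths, but it may increase entries: those of σ Π b
are at most √s c, which is estimated by s c. -/
lemma specNorm_encMat_le (hI : ∀ y, I.transpose.mulVec y = 0 → y = 0) (hS : S.IsSymm)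
    (hδ0 : 0 ≤ δ)
    (hδ : ∀ v, δ * (v ⬝ᵥ v) ≤ σ * (v ⬝ᵥ S.mulVec v)) (hδ1 : δ ≤ 1)
    (hσS : ∀ v, σ * (v ⬝ᵥ S.mulVec v) ≤ v ⬝ᵥ v) (hρ : 0 ≤ ρ) (hρ1 : ρ ≤ 1) (hc : 0 ≤ c)
    (hB : ∀ i k, |σ * B i k| ≤ c) (hb : ∀ k j, |σ * b k j| ≤ c) (hG : ∀ i j, |σ * G i j| ≤ c)
    (hs1 : 1 ≤ s) (hn : Fintype.card n ≤ s) {s' : ℝ}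
    (hcard : Fintype.card (N ⊕ (n ⊕ J)) ≤ s') :
    specNorm (encMat I σ ρ S B b G) ≤ 1 + s' * (ρ * (s * c)) := by
  have hcs : c ≤ s * c := le_mul_of_one_le_left hc hs1
  refine specNorm_augmented_le (projIter_isSymm hS) (projIter_nonneg hI hσS) (fun v => ?_)
    (by positivity) (fun i k => ?_) (fun i j => ?_) (fun k j => ?_) hcard
  · refine (projIter_le hI hδ hδ1 v).trans ?_
    have := dotProduct_self_nonneg' v
    nlinarith
  · rw [Matrix.smul_apply, smul_eq_mul, mul_assoc, abs_mul, abs_of_nonneg hρ]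
    exact mul_le_mul_of_nonneg_left ((hB i k).trans hcs) hρ
  · rw [Matrix.smul_apply, smul_eq_mul, neg_mul, abs_neg, mul_assoc, abs_mul,
      abs_of_nonneg (by positivity)]
    exact mul_le_mul (by nlinarith) ((hG i j).trans hcs) (abs_nonneg _) hρ
  · rw [Matrix.smul_apply, smul_eq_mul, mul_assoc, abs_mul, abs_of_nonneg hρ]
    refine mul_le_mul_of_nonneg_left (abs_le_of_sq_le_sq ?_ (by positivity)) hρ
    have h1 := dotProduct_kerProj_le hI (σ • b.col j)
    have h2 : (σ • b.col j) ⬝ᵥ (σ • b.col j) ≤ s * c ^ 2 :=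
      dotProduct_le_of_abs_le hn fun k => hb k j
    have h3 : (σ * (kerProj I * b) k j) = (kerProj I).mulVec (σ • b.col j) k := by
      rw [Matrix.mulVec_smul]; rfl
    have h4 : (kerProj I).mulVec (σ • b.col j) k ^ 2 ≤
        (kerProj I).mulVec (σ • b.col j) ⬝ᵥ (kerProj I).mulVec (σ • b.col j) := by
      rw [sq]
      exact Finset.single_le_sum (f := fun i => (kerProj I).mulVec (σ • b.col j) i *
        (kerProj I).mulVec (σ • b.col j) i) (fun i _ => mul_self_nonneg _) (Finset.mem_univ k)
    rw [h3]
    nlinarith [mul_nonneg (sq_nonneg c) (mul_nonneg (zero_le_one.trans hs1) (sub_nonneg.2 hs1))]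

/-- The product of three bounds: |E ^ k x| ≤ (1 − δ) ^ k |x|, δ |x| ≤ √s c, and length at most √s c
for a row of σ B. -/
lemma abs_mulVec_pow_projIter_le (hI : ∀ y, I.transpose.mulVec y = 0 → y = 0) (hS : S.IsSymm)
    (hσ : 0 < σ) (hδ0 : 0 < δ)
    (hδ : ∀ v, δ * (v ⬝ᵥ v) ≤ σ * (v ⬝ᵥ S.mulVec v)) (hδ1 : δ ≤ 1)
    (hσS : ∀ v, σ * (v ⬝ᵥ S.mulVec v) ≤ v ⬝ᵥ v)
    (hB : ∀ i k, |σ * B i k| ≤ c) (hb : ∀ k j, |σ * b k j| ≤ c)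
    (hn : Fintype.card n ≤ s) {j : J} {x : n → ℝ}
    (hx : I.mulVec x = 0) (hx' : ∀ y, I.mulVec y = 0 → y ⬝ᵥ S.mulVec x = y ⬝ᵥ b.col j) (k : ℕ)
    (i : N) :
    |B.mulVec ((projIter I S σ ^ k).mulVec x) i| ≤ σ⁻¹ * (s * c ^ 2 / δ * (1 - δ) ^ k) := by
  have hs0 : 0 ≤ s := (Nat.cast_nonneg _).trans hn
  have hδ' := sub_nonneg.2 hδ1
  set u := (projIter I S σ ^ k).mulVec x
  have h1 : u ⬝ᵥ u ≤ ((1 - δ) ^ k) ^ 2 * (x ⬝ᵥ x) := specNorm_pow_le _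
    (specNorm_le_of_bilin_le hδ' (projIter_isSymm hS) (projIter_nonneg hI hσS)
      (projIter_le hI hδ hδ1)) x k
  have h2 : δ ^ 2 * (x ⬝ᵥ x) ≤ s * c ^ 2 := (dotProduct_solution_le hδ hx hx' hδ0.le).trans
    (dotProduct_le_of_abs_le hn fun k => hb k j)
  have h3 : (σ • B i) ⬝ᵥ (σ • B i) ≤ s * c ^ 2 := dotProduct_le_of_abs_le hn fun k => hB i k
  have h4 := dotProduct_mul_dotProduct_le (σ • B i) u
  rw [smul_dotProduct, smul_eq_mul] at h4
  change |B i ⬝ᵥ u| ≤ _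
  rw [inv_mul_eq_div, le_div_iff₀ hσ, div_mul_eq_mul_div, le_div_iff₀ hδ0]
  have h5 : |B i ⬝ᵥ u| * σ * δ = |σ * (B i ⬝ᵥ u) * δ| := by
    rw [abs_mul, abs_mul, abs_of_pos hσ, abs_of_pos hδ0]; ring
  rw [h5]
  refine abs_le_of_sq_le_sq ?_ (by positivity)
  have hu := dotProduct_self_nonneg' u
  calc (σ * (B i ⬝ᵥ u) * δ) ^ 2 = (σ * (B i ⬝ᵥ u)) ^ 2 * δ ^ 2 := by ring
    _ ≤ ((s * c ^ 2) * (((1 - δ) ^ k) ^ 2 * (x ⬝ᵥ x))) * δ ^ 2 := by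
        refine mul_le_mul_of_nonneg_right (h4.trans ?_) (sq_nonneg δ)
        exact mul_le_mul h3 h1 hu (by positivity)
    _ = (s * c ^ 2) * ((1 - δ) ^ k) ^ 2 * (δ ^ 2 * (x ⬝ᵥ x)) := by ring
    _ ≤ (s * c ^ 2) * ((1 - δ) ^ k) ^ 2 * (s * c ^ 2) :=
        mul_le_mul_of_nonneg_left h2 (by positivity)
    _ = (s * c ^ 2 * (1 - δ) ^ k) ^ 2 := by ring

end Encoding

/-! ### The encoding is affine in the coefficient -/

section Affine

variable {μ : Type} [Fintype μ]

/-- An affine function on `ℝ^μ`. -/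
def IsAffineFun (f : (μ → ℝ) → ℝ) : Prop := ∃ (w : μ → ℝ) (c : ℝ), ∀ a, f a = w ⬝ᵥ a + c

lemma isAffineFun_const (c : ℝ) : IsAffineFun fun _ : μ → ℝ => c := ⟨0, c, fun a => by simp⟩

lemma IsAffineFun.const_mul {f : (μ → ℝ) → ℝ} (hf : IsAffineFun f) (r : ℝ) :
    IsAffineFun fun a => r * f a := by
  obtain ⟨w, c, h⟩ := hf
  exact ⟨r • w, r * c, fun a => by simp only [h, smul_dotProduct, smul_eq_mul]; ring⟩

lemma IsAffineFun.mul_const {f : (μ → ℝ) → ℝ} (hf : IsAffineFun f) (r : ℝ) :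
    IsAffineFun fun a => f a * r := by
  simpa only [mul_comm] using hf.const_mul r

lemma IsAffineFun.add {f g : (μ → ℝ) → ℝ} (hf : IsAffineFun f) (hg : IsAffineFun g) :
    IsAffineFun fun a => f a + g a := by
  obtain ⟨w, c, h⟩ := hf
  obtain ⟨w', c', h'⟩ := hg
  exact ⟨w + w', c + c', fun a => by simp only [h, h', add_dotProduct]; ring⟩

lemma IsAffineFun.sum {ι : Type} (s : Finset ι) {f : ι → (μ → ℝ) → ℝ}
    (hf : ∀ i, IsAffineFun (f i)) : IsAffineFun fun a => ∑ i ∈ s, f i a := by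
  classical
  induction s using Finset.induction_on with
  | empty => simpa using isAffineFun_const (μ := μ) 0
  | insert i s hi ih => simpa only [Finset.sum_insert hi] using (hf i).add ih

/-- A matrix that depends affinely on a vector. -/
def IsAffineMat {m n : Type} (F : (μ → ℝ) → Matrix m n ℝ) : Prop :=
  ∀ i j, IsAffineFun fun a => F a i j

lemma isAffineMat_sum_smul {m n : Type} (X : μ → Matrix m n ℝ) :
    IsAffineMat fun a : μ → ℝ => Matrix.of fun i j => ∑ t, a t * X t i j := fun i j =>
  ⟨fun t => X t i j, 0, fun a => by
    simp only [Matrix.of_apply, dotProduct, add_zero, mul_comm]⟩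

lemma IsAffineMat.const_mul {m n l : Type} [Fintype m] {F : (μ → ℝ) → Matrix m n ℝ}
    (hF : IsAffineMat F) (M : Matrix l m ℝ) : IsAffineMat fun a => M * F a := fun i j => by
  simp only [Matrix.mul_apply]
  exact IsAffineFun.sum _ fun k => (hF k j).const_mul _

lemma IsAffineMat.mul_const {m n l : Type} [Fintype n] {F : (μ → ℝ) → Matrix m n ℝ}
    (hF : IsAffineMat F) (M : Matrix n l ℝ) : IsAffineMat fun a => F a * M := fun i j => by
  simp only [Matrix.mul_apply]
  exact IsAffineFun.sum _ fun k => (hF i k).mul_const _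

lemma isAffineMat_encMat {N n J m : Type} [Fintype n] [Fintype J] [Fintype m]
    [DecidableEq n] [DecidableEq J] [DecidableEq m] (I : Matrix m n ℝ) (σ ρ : ℝ)
    {S : (μ → ℝ) → Matrix n n ℝ} {B : (μ → ℝ) → Matrix N n ℝ} {b : (μ → ℝ) → Matrix n J ℝ}
    {G : (μ → ℝ) → Matrix N J ℝ} (hS : IsAffineMat S) (hB : IsAffineMat B) (hb : IsAffineMat b)
    (hG : IsAffineMat G) : IsAffineMat fun a => encMat I σ ρ (S a) (B a) (b a) (G a) := by
  rintro (i | i | i) (j | j | j)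
  · exact isAffineFun_const 0
  · exact (hB i j).const_mul _
  · exact (hG i j).const_mul _
  · exact isAffineFun_const 0
  -- The only block in which S occurs; the projections around it are constant.
  · have h := (((hS.const_mul (kerProj I)).mul_const (kerProj I)) i j).const_mul (-σ)
    refine Exists.imp (fun w => Exists.imp fun c h a => ?_)
      (h.add (isAffineFun_const (kerProj I i j)))
    rw [← h a]
    change (kerProj I - σ • (kerProj I * S a * kerProj I)) i j = _
    rw [Matrix.sub_apply, Matrix.smul_apply, smul_eq_mul]
    ring
  · exact ((hb.const_mul (kerProj I)) i j).const_mul _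
  · exact isAffineFun_const 0
  · exact isAffineFun_const 0
  · exact isAffineFun_const _

lemma IsAffineMat.netComputes_iterate_approxMatSq {ι κ : Type} [Fintype ι] [DecidableEq ι]
    [Fintype κ] [DecidableEq κ] [DecidableEq μ] {F : (μ → ℝ) → Matrix ι ι ℝ} (hF : IsAffineMat F)
    (c : ℝ) (pos : κ → ι × ι) (D t : ℕ) :
    NetComputes (fun (a : μ → ℝ) k => c * (approxMatSq D)^[t] (F a) (pos k).1 (pos k).2)
      (t * (D + 2) + 2)
      (Fintype.card ι ^ 2 * 2 * (Fintype.card μ + 1) +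
        (t * (Fintype.card ι ^ 3 * (24 * D + 38)) + Fintype.card κ * 3)) := by
  choose w b h using hF
  have key := LODNet.netComputes_iterate_approxMatSq (Matrix.of fun (ij : ι × ι) => w ij.1 ij.2)
    (fun ij => b ij.1 ij.2) c pos D t
  have e : ∀ a : μ → ℝ, (Matrix.of fun i j => ((Matrix.of fun (ij : ι × ι) => w ij.1 ij.2).mulVec a +
      fun ij : ι × ι => b ij.1 ij.2) (i, j)) = F a := fun a => by
    ext i j
    exact (h i j a).symm
  simpa only [e] using key

end Affine

section Local

variable {d : ℕ} {T : CartesianMesh d} {r : ℕ} {hr : 0 < r} {ℓ : ℕ} {K K₀ : Fin d → ℤ}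

/-! ### The local matrices of the Petrov–Galerkin method -/

variable (T r hr ℓ K) in
/-- The couplings of the coarse with the fine basis functions. -/
def coarseFine (A : (Fin d → ℝ) → ℝ) : Matrix (Fin d → Fin (2 * ℓ + 2)) (FineIdx d r ℓ) ℝ :=
  Matrix.of fun i k => energy T.domain A (T.hat (coarseNode ℓ K i)) (fineHat T r hr ℓ K k)

variable (T ℓ K) in
/-- The couplings of the coarse basis functions on one element. -/
def coarseElt (A : (Fin d → ℝ) → ℝ) : Matrix (Fin d → Fin (2 * ℓ + 2)) (Fin d → Fin 2) ℝ :=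
  Matrix.of fun i j =>
    energy (T.cell K) A (T.hat (coarseNode ℓ K i)) (T.hat (elementNode K j))

variable (T r hr ℓ K) in
/-- The right-hand sides of the corrector problems. -/
def loadMat (A : (Fin d → ℝ) → ℝ) : Matrix (FineIdx d r ℓ) (Fin d → Fin 2) ℝ :=
  Matrix.of fun k j => loadVec T r hr ℓ K A (T.hat (elementNode K j)) k

/-- The shape G − B x that the powers of `encMat` reproduce, with the coordinates x of the corrector
as constrained solution. -/
lemma exists_pgLOD_eq (hd : 1 ≤ d) (hK : T.IsInterior ℓ K) {Tε : CartesianMesh d} {α β : ℝ}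
    (hα : 0 < α) {A : (Fin d → ℝ) → ℝ} (hA : A ∈ coeffs T.domain Tε α β) (j : Fin d → Fin 2) :
    ∃ x, (interpMat T r hr ℓ K).mulVec x = 0 ∧
      (∀ y, (interpMat T r hr ℓ K).mulVec y = 0 → y ⬝ᵥ (stiffness T r hr ℓ K A).mulVec x =
        y ⬝ᵥ (loadMat T r hr ℓ K A).col j) ∧
      ∀ i, pgLOD T (T.refine r hr) A ℓ K i j =
        coarseElt T ℓ K A i j - (coarseFine T r hr ℓ K A).mulVec x i := by
  have hb := bddCoeff_of_mem_coeffs hα hA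
  have hu : IsLip (T.hat (elementNode K j)) := CartesianMesh.isLip_hat _ _
  have h := isElementCorrector_elementCorrector (r := r) (hr := hr) hd hK hb hα
    (hA.2.1.mono fun x h => h.1) hu
  obtain ⟨x, hx, h1, h2⟩ := (isElementCorrector_iff hK hb hu _).1 h
  refine ⟨x, h1, h2, fun i => ?_⟩
  simp only [pgLOD, coarseElt, Matrix.of_apply]
  rw [hx, fineFun, hb.energy_sum_right _ _ (fun k => isLip_fineHat k) (CartesianMesh.isLip_hat _ _)]
  congr 1
  exact Finset.sum_congr rfl fun k _ => mul_comm _ _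

/-! ### Dependence on the coefficient -/

section Coefficient

variable {p : ℕ} {hp : 0 < p} {α β : ℝ} {A : (Fin d → ℝ) → ℝ}

/-- The weights are integrals over the patch of the reference element `K₀`, so the same linear map
of the coefficient vector serves all interior elements. -/
lemma energy_eq_sum_coeffVec_translate (hK : T.IsInterior ℓ K) (hα : 0 < α)
    (hA : A ∈ coeffs T.domain (T.refine p hp) α β) {S S₀ : Set (Fin d → ℝ)}
    (hS : S ⊆ T.box K ℓ) (hSm : MeasurableSet S) (hSm₀ : MeasurableSet S₀)
    (hSS : ∀ x, x + shiftVec T K₀ K ∈ S ↔ x ∈ S₀) {u v u₀ v₀ : (Fin d → ℝ) → ℝ} (hu : IsLip u)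
    (hv : IsLip v) (huu : ∀ x, u (x + shiftVec T K₀ K) = u₀ x)
    (hvv : ∀ x, v (x + shiftVec T K₀ K) = v₀ x) :
    energy S A u v = ∑ t, coeffVec T p hp ℓ K A t *
      energy (S₀ ∩ coeffCell T p hp ℓ K₀ t) (fun _ => 1) u₀ v₀ := by
  rw [energy_eq_sum_coeffVec hK hα hA hS hSm hu hv]
  refine Finset.sum_congr rfl fun t _ => ?_
  congr 1
  exact energy_translate huu hvv (fun x => and_congr (hSS x) (coeffCell_shift t x))
    (hSm₀.inter ((T.refine p hp).measurableSet_cell _))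
    (hSm.inter ((T.refine p hp).measurableSet_cell _))

lemma coarseNode_hat_shift (i : Fin d → Fin (2 * ℓ + 2)) (x : Fin d → ℝ) :
    T.hat (coarseNode ℓ K i) (x + shiftVec T K₀ K) = T.hat (coarseNode ℓ K₀ i) x :=
  hat_shift (fun a => by simp only [coarseNode]; ring) x

lemma elementNode_hat_shift (j : Fin d → Fin 2) (x : Fin d → ℝ) :
    T.hat (elementNode K j) (x + shiftVec T K₀ K) = T.hat (elementNode K₀ j) x :=
  hat_shift (fun a => by simp only [elementNode]; ring) x

/-- The domain is not invariant under translation. The integral is first restricted to the patch,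
outside of which the fine functions vanish. -/
lemma exists_stiffness_eq_sum (T : CartesianMesh d) (r : ℕ) (hr : 0 < r) (ℓ p : ℕ) (hp : 0 < p)
    (hα : 0 < α) (K₀ : Fin d → ℤ) :
    ∃ X : (Fin d → Fin ((2 * ℓ + 1) * p)) → Matrix (FineIdx d r ℓ) (FineIdx d r ℓ) ℝ,
      ∀ A ∈ coeffs T.domain (T.refine p hp) α β, ∀ K, T.IsInterior ℓ K →
        stiffness T r hr ℓ K A =
          Matrix.of fun k l => ∑ t, coeffVec T p hp ℓ K A t * X t k l := by
  refine ⟨fun t => Matrix.of fun k l => energy (T.box K₀ ℓ ∩ coeffCell T p hp ℓ K₀ t) (fun _ => 1)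
    (fineHat T r hr ℓ K₀ k) (fineHat T r hr ℓ K₀ l), fun A hA K hK => ?_⟩
  ext k l
  change energy T.domain A (fineHat T r hr ℓ K k) (fineHat T r hr ℓ K l) = _
  rw [energy_eq_of_subset (T.isClosed_box K ℓ) hK.box_subset_domain
      T.isOpen_domain.measurableSet fun x hx => fineHat_eq_zero_of_notMem k hx]
  exact energy_eq_sum_coeffVec_translate hK hα hA subset_rfl (T.isClosed_box K ℓ).measurableSet
    (T.isClosed_box K₀ ℓ).measurableSet (fun x => box_shift x) (isLip_fineHat k) (isLip_fineHat l)
    (fun x => fineHat_shift k x) (fun x => fineHat_shift l x)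

lemma exists_coarseFine_eq_sum (T : CartesianMesh d) (r : ℕ) (hr : 0 < r) (ℓ p : ℕ) (hp : 0 < p)
    (hα : 0 < α) (K₀ : Fin d → ℤ) :
    ∃ X : (Fin d → Fin ((2 * ℓ + 1) * p)) → Matrix (Fin d → Fin (2 * ℓ + 2)) (FineIdx d r ℓ) ℝ,
      ∀ A ∈ coeffs T.domain (T.refine p hp) α β, ∀ K, T.IsInterior ℓ K →
        coarseFine T r hr ℓ K A =
          Matrix.of fun i k => ∑ t, coeffVec T p hp ℓ K A t * X t i k := by
  refine ⟨fun t => Matrix.of fun i k => energy (T.box K₀ ℓ ∩ coeffCell T p hp ℓ K₀ t) (fun _ => 1)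
    (T.hat (coarseNode ℓ K₀ i)) (fineHat T r hr ℓ K₀ k), fun A hA K hK => ?_⟩
  ext i k
  rw [coarseFine, Matrix.of_apply, energy_comm,
    energy_eq_of_subset (T.isClosed_box K ℓ) hK.box_subset_domain
      T.isOpen_domain.measurableSet fun x hx => fineHat_eq_zero_of_notMem k hx, energy_comm]
  exact energy_eq_sum_coeffVec_translate hK hα hA subset_rfl (T.isClosed_box K ℓ).measurableSet
    (T.isClosed_box K₀ ℓ).measurableSet (fun x => box_shift x) (CartesianMesh.isLip_hat _ _)
    (isLip_fineHat k) (fun x => coarseNode_hat_shift i x) (fun x => fineHat_shift k x)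

lemma exists_loadMat_eq_sum (T : CartesianMesh d) (r : ℕ) (hr : 0 < r) (ℓ p : ℕ) (hp : 0 < p)
    (hα : 0 < α) (K₀ : Fin d → ℤ) :
    ∃ X : (Fin d → Fin ((2 * ℓ + 1) * p)) → Matrix (FineIdx d r ℓ) (Fin d → Fin 2) ℝ,
      ∀ A ∈ coeffs T.domain (T.refine p hp) α β, ∀ K, T.IsInterior ℓ K →
        loadMat T r hr ℓ K A =
          Matrix.of fun k j => ∑ t, coeffVec T p hp ℓ K A t * X t k j := by
  refine ⟨fun t => Matrix.of fun k j => energy (T.cell K₀ ∩ coeffCell T p hp ℓ K₀ t) (fun _ => 1)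
    (T.hat (elementNode K₀ j)) (fineHat T r hr ℓ K₀ k), fun A hA K hK => ?_⟩
  ext k j
  exact energy_eq_sum_coeffVec_translate hK hα hA (CartesianMesh.cell_subset_box T K ℓ)
    (T.measurableSet_cell _) (T.measurableSet_cell _) (fun x => cell_shift x)
    (CartesianMesh.isLip_hat _ _) (isLip_fineHat k) (fun x => elementNode_hat_shift j x)
    (fun x => fineHat_shift k x)

lemma exists_coarseElt_eq_sum (T : CartesianMesh d) (ℓ p : ℕ) (hp : 0 < p)
    (hα : 0 < α) (K₀ : Fin d → ℤ) :
    ∃ X : (Fin d → Fin ((2 * ℓ + 1) * p)) → Matrix (Fin d → Fin (2 * ℓ + 2)) (Fin d → Fin 2) ℝ,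
      ∀ A ∈ coeffs T.domain (T.refine p hp) α β, ∀ K, T.IsInterior ℓ K →
        coarseElt T ℓ K A = Matrix.of fun i j => ∑ t, coeffVec T p hp ℓ K A t * X t i j := by
  refine ⟨fun t => Matrix.of fun i j => energy (T.cell K₀ ∩ coeffCell T p hp ℓ K₀ t) (fun _ => 1)
    (T.hat (coarseNode ℓ K₀ i)) (T.hat (elementNode K₀ j)), fun A hA K hK => ?_⟩
  ext i j
  exact energy_eq_sum_coeffVec_translate hK hα hA (CartesianMesh.cell_subset_box T K ℓ)
    (T.measurableSet_cell _) (T.measurableSet_cell _) (fun x => cell_shift x)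
    (CartesianMesh.isLip_hat _ _) (CartesianMesh.isLip_hat _ _)
    (fun x => coarseNode_hat_shift i x) (fun x => elementNode_hat_shift j x)

end Coefficient

/-! ### Dirichlet energies of basis functions -/

lemma dirichlet_hat (T : CartesianMesh d) (z : Fin d → ℤ) :
    dirichlet (T.hat z) = T.size ^ d * (T.size⁻¹) ^ 2 * dirichlet (refHat (d := d)) := by
  rw [T.hat_eq_refHat]
  exact dirichlet_scale _ _ T.size_pos

lemma dirichlet_nonneg (u : (Fin d → ℝ) → ℝ) : 0 ≤ dirichlet u :=
  integral_nonneg fun x => gradDot_self_nonneg u x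

/-- The true ratio of the energies is r ^ (d − 2). The cruder r ^ d is at least one for every d and
is still at most n. -/
lemma dirichlet_hat_le (z : Fin d → ℤ) (k : FineIdx d r ℓ) :
    dirichlet (T.hat z) ≤ (r : ℝ) ^ d * dirichlet (fineHat T r hr ℓ K k) := by
  have hs := T.size_pos
  have hr0 : (1 : ℝ) ≤ r := by exact_mod_cast hr
  rw [dirichlet_hat, fineHat, dirichlet_hat]
  have h0 := dirichlet_nonneg (refHat (d := d))
  rw [← mul_assoc]
  refine mul_le_mul_of_nonneg_right ?_ h0
  simp only [CartesianMesh.refine]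
  have e : (r : ℝ) ^ d * ((T.size / r) ^ d * ((T.size / r)⁻¹) ^ 2) =
      T.size ^ d * (T.size⁻¹) ^ 2 * r ^ 2 := by
    rw [div_pow, inv_div, div_pow, inv_pow]
    field_simp
  rw [e]
  exact le_mul_of_one_le_right (by positivity) (one_le_pow₀ hr0)

lemma dirichlet_fineHat_eq (K' : Fin d → ℤ) (k k' : FineIdx d r ℓ) :
    dirichlet (fineHat T r hr ℓ K k) = dirichlet (fineHat T r hr ℓ K' k') := by
  rw [fineHat, dirichlet_hat, fineHat, dirichlet_hat]

lemma dirichlet_fineHat_le (k k' : FineIdx d r ℓ) :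
    dirichlet (fineHat T r hr ℓ K k) ≤ (r : ℝ) ^ d * dirichlet (fineHat T r hr ℓ K k') := by
  have hr0 : (1 : ℝ) ≤ r := by exact_mod_cast hr
  rw [dirichlet_fineHat_eq K k k']
  exact le_mul_of_one_le_left (dirichlet_nonneg _) (one_le_pow₀ hr0)

lemma dotProduct_stiffness_const (hK : T.IsInterior ℓ K) (β : ℝ) (v : FineIdx d r ℓ → ℝ) :
    v ⬝ᵥ (stiffness T r hr ℓ K fun _ => β).mulVec v = β * dirichlet (fineFun T r hr ℓ K v) := by
  rw [dotProduct_stiffness (bddCoeff_const T.volume_domain_ne_top β), energy_const,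
    energy_eq_of_subset (T.isClosed_box K ℓ) hK.box_subset_domain T.isOpen_domain.measurableSet
      fun x hx => fineFun_eq_zero_of_notMem v hx,
    ← energy_eq_of_subset (T.isClosed_box K ℓ) (subset_univ _) MeasurableSet.univ
      fun x hx => fineFun_eq_zero_of_notMem v hx]
  simp only [energy_eq, one_mul, Measure.restrict_univ, dirichlet]

lemma fineFun_single (k : FineIdx d r ℓ) :
    fineFun T r hr ℓ K (Pi.single k 1) = fineHat T r hr ℓ K k := by
  rw [fineFun, Finset.sum_eq_single k]
  · simp
  · intro l _ hl; simp [hl]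
  · simp

/-- A hat function of width `s h` is a linear combination of the fine basis functions. -/
lemma exists_wide_hat {s : ℕ} (hs : 1 ≤ s) (hm : 2 * s ≤ ((2 * ℓ + 1) * r - 1) + 1)
    (k : FineIdx d r ℓ) : ∃ v : FineIdx d r ℓ → ℝ, ((s : ℝ) / 3) ^ d ≤ v ⬝ᵥ v ∧
      dirichlet (fineFun T r hr ℓ K v) =
        (s : ℝ) ^ d * ((s : ℝ)⁻¹) ^ 2 * dirichlet (fineHat T r hr ℓ K k) := by
  have hs0 : (0 : ℝ) < s := by exact_mod_cast hs
  have hsz := (T.refine r hr).size_pos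
  refine ⟨fun k => ∏ i, tent ((((k i : ℕ) : ℝ) + 1 - s) / s), ?_, ?_⟩
  · simp only [dotProduct, ← Finset.prod_mul_distrib]
    rw [← Fintype.piFinset_univ, ← Finset.prod_univ_sum (fun _ => Finset.univ)
      (fun _ (j : Fin ((2 * ℓ + 1) * r - 1)) => tent ((((j : ℕ) : ℝ) + 1 - s) / s) *
        tent ((((j : ℕ) : ℝ) + 1 - s) / s)), Finset.prod_const, Finset.card_univ, Fintype.card_fin]
    refine pow_le_pow_left₀ (by positivity) ((sum_tent_sq_ge hs hm).trans (le_of_eq ?_)) d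
    exact Finset.sum_congr rfl fun j _ => sq _
  · set h := (T.refine r hr).size with hh
    -- The centre is s fine steps above the lower corner of the patch, so the support starts at that
    -- corner; index k is the node k + 1 steps above it.
    set y : Fin d → ℝ := (T.refine r hr).node fun i => (r : ℤ) * (K i - ℓ) + s with hy
    have hfun : fineFun T r hr ℓ K (fun k => ∏ i, tent ((((k i : ℕ) : ℝ) + 1 - s) / s)) =
        fun x => refHat fun i => (x i - y i) / (s * h) := by
      ext x
      rw [fineFun_apply]
      have e : (fun i => (x i - y i) / (s * h)) = fun i => ((fun i => (x i - y i) / h) i) / s := by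
        ext i; field_simp
      rw [e, refHat_div_eq_sum hs hm]
      refine Finset.sum_congr rfl fun k _ => ?_
      rw [fineHat, (T.refine r hr).hat_eq_refHat]
      congr 1
      refine congrArg refHat (funext fun i => ?_)
      rw [hy, refine_node_apply, refine_node_apply, show T.size / r = h from rfl, ← hh]
      simp only [fineNode]
      push_cast
      field_simp
      ring
    rw [hfun, dirichlet_scale _ _ (by positivity), fineHat, dirichlet_hat, ← hh, mul_pow, mul_inv,
      mul_pow]
    ring

end Local

/-! ### Consequences of admissibility -/

section Consequences

variable {d : ℕ} {T : CartesianMesh d} {r : ℕ} {hr : 0 < r} {ℓ : ℕ} {K : Fin d → ℤ}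
  {Tε : CartesianMesh d} {α β η : ℝ} {P : Params}

namespace Admissible

lemma vresc_mul_Vsup_le {𝒜 : Set ((Fin d → ℝ) → ℝ)} (hP : Admissible T r hr ℓ 𝒜 η P) :
    P.vresc * P.Vsup ≤ 1 := by
  have h := hP.Vinf_pos.trans_le hP.Vinf_le
  have := (lt_inv_comm₀ hP.vresc_mem.1 h).1 hP.vresc_mem.2
  rw [← le_inv_mul_iff₀ hP.vresc_mem.1, mul_one]
  exact this.le

lemma δ_pos {𝒜 : Set ((Fin d → ℝ) → ℝ)} (hP : Admissible T r hr ℓ 𝒜 η P) : 0 < P.δ :=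
  mul_pos hP.vresc_mem.1 hP.Vinf_pos

lemma vresc_mul_stiffness_le {𝒜 : Set ((Fin d → ℝ) → ℝ)} (hP : Admissible T r hr ℓ 𝒜 η P)
    {A : (Fin d → ℝ) → ℝ} (hA : A ∈ 𝒜) (hK : T.IsInterior ℓ K) (v : FineIdx d r ℓ → ℝ) :
    P.vresc * (v ⬝ᵥ (stiffness T r hr ℓ K A).mulVec v) ≤ v ⬝ᵥ v := by
  have h := mul_le_mul_of_nonneg_left (hP.bounds A hA K hK v).2 hP.vresc_mem.1.le
  have h1 := mul_le_mul_of_nonneg_right hP.vresc_mul_Vsup_le (dotProduct_self_nonneg' v)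
  linarith

lemma δ_mul_le {𝒜 : Set ((Fin d → ℝ) → ℝ)} (hP : Admissible T r hr ℓ 𝒜 η P)
    {A : (Fin d → ℝ) → ℝ} (hA : A ∈ 𝒜) (hK : T.IsInterior ℓ K) (v : FineIdx d r ℓ → ℝ) :
    P.δ * (v ⬝ᵥ v) ≤ P.vresc * (v ⬝ᵥ (stiffness T r hr ℓ K A).mulVec v) := by
  rw [Params.δ, mul_assoc]
  exact mul_le_mul_of_nonneg_left (hP.bounds A hA K hK v).1 hP.vresc_mem.1.le

variable (hP : Admissible T r hr ℓ (coeffs T.domain Tε α β) η P) (hα : 0 < α) (hαβ : α ≤ β)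
  (hK : T.IsInterior ℓ K)
include hP hαβ hK

/-- The constant coefficient β belongs to the class; its Rayleigh quotient at a unit vector is the
energy of one fine hat. -/
lemma vresc_mul_dirichlet_le (k : FineIdx d r ℓ) :
    P.vresc * (β * dirichlet (fineHat T r hr ℓ K k)) ≤ 1 := by
  have h := hP.vresc_mul_stiffness_le (mem_coeffs_const hαβ le_rfl) hK (Pi.single k 1)
  rwa [dotProduct_stiffness_const hK, fineFun_single, dotProduct_single, Pi.single_eq_same,
    mul_one] at h

/-- Rescaling by `P.vresc` normalizes all local matrices at once: whatever α, β and the mesh size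
are, the entries are at most r ^ d. -/
lemma abs_vresc_mul_energy_le (hα : 0 < α) (k : FineIdx d r ℓ) {A : (Fin d → ℝ) → ℝ}
    (hA : A ∈ coeffs T.domain Tε α β) {S : Set (Fin d → ℝ)} (hS : S ⊆ T.domain)
    {u v : (Fin d → ℝ) → ℝ} (hu : IsLip u) (hv : IsLip v) (hcu : HasCompactSupport u)
    (hcv : HasCompactSupport v)
    (hdu : dirichlet u ≤ (r : ℝ) ^ d * dirichlet (fineHat T r hr ℓ K k))
    (hdv : dirichlet v ≤ (r : ℝ) ^ d * dirichlet (fineHat T r hr ℓ K k)) :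
    |P.vresc * energy S A u v| ≤ (r : ℝ) ^ d := by
  have hβ := hα.trans_le hαβ
  have h := abs_energy_le ((bddCoeff_of_mem_coeffs hα hA).mono hS) hu hv hβ.le
    (ae_restrict_of_ae_restrict_of_subset hS (hA.2.1.mono fun x h => ⟨hα.le.trans h.1, h.2⟩))
    hcu hcv
  have hσ := hP.vresc_mem.1
  rw [abs_mul, abs_of_pos hσ]
  have h1 := hP.vresc_mul_dirichlet_le hαβ hK k
  calc P.vresc * |energy S A u v|
      ≤ P.vresc * (β * ((r : ℝ) ^ d * dirichlet (fineHat T r hr ℓ K k))) := by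
        refine mul_le_mul_of_nonneg_left (h.trans ?_) hσ.le
        exact mul_le_mul_of_nonneg_left (by linarith) hβ.le
    _ = (r : ℝ) ^ d * (P.vresc * (β * dirichlet (fineHat T r hr ℓ K k))) := by ring
    _ ≤ (r : ℝ) ^ d := mul_le_of_le_one_right (by positivity) h1

/-- A hat of width s h has s ^ (d − 2) times the energy of a fine hat, but coefficients of squared
length at least (s/3) ^ d. The lower spectral bound is therefore smaller than the upper one by the
order s ^ (−2), so n is controlled by powers of 1/δ. -/
lemma δ_mul_sq_le (k : FineIdx d r ℓ) {s : ℕ} (hs : 1 ≤ s)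
    (hm : 2 * s ≤ ((2 * ℓ + 1) * r - 1) + 1) : P.δ * (s : ℝ) ^ 2 ≤ 3 ^ d := by
  have hs0 : (0 : ℝ) < s := by exact_mod_cast hs
  obtain ⟨v, hv, hv'⟩ := exists_wide_hat (T := T) (hr := hr) (K := K) hs hm k
  have h := hP.δ_mul_le (mem_coeffs_const hαβ le_rfl) hK v
  rw [dotProduct_stiffness_const hK, hv'] at h
  have h1 := hP.vresc_mul_dirichlet_le hαβ hK k
  have h2 := mul_le_mul_of_nonneg_left hv hP.δ_pos.le
  have h3 : P.δ * ((s : ℝ) / 3) ^ d ≤ (s : ℝ) ^ d * ((s : ℝ)⁻¹) ^ 2 := by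
    calc P.δ * ((s : ℝ) / 3) ^ d ≤ _ := h2.trans h
      _ = (s : ℝ) ^ d * ((s : ℝ)⁻¹) ^ 2 * (P.vresc * (β * dirichlet (fineHat T r hr ℓ K k))) := by
          ring
      _ ≤ _ := mul_le_of_le_one_right (by positivity) h1
  have h4 : 0 < (s : ℝ) ^ d / 3 ^ d / s ^ 2 := by positivity
  refine le_of_mul_le_mul_right ?_ h4
  calc P.δ * (s : ℝ) ^ 2 * ((s : ℝ) ^ d / 3 ^ d / s ^ 2) = P.δ * ((s : ℝ) / 3) ^ d := by
        rw [div_pow]; field_simp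
    _ ≤ (s : ℝ) ^ d * ((s : ℝ)⁻¹) ^ 2 := h3
    _ = 3 ^ d * ((s : ℝ) ^ d / 3 ^ d / s ^ 2) := by field_simp

omit hP hαβ hK in
lemma exists_center_idx (hr2 : 2 ≤ r) (hℓ : 1 ≤ ℓ) (K : Fin d → ℤ) :
    ∃ k : FineIdx d r ℓ, (T.refine r hr).node (fineNode r ℓ K k) = T.node K := by
  have h1 : 2 ≤ r * ℓ := by nlinarith
  -- The lower corner of K is r ℓ fine steps away from that of the patch; `fineNode` starts to count
  -- at the first inner node. It is inner since ℓ ≥ 1.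
  refine ⟨fun _ => ⟨r * ℓ - 1, ?_⟩, ?_⟩
  · have : (2 * ℓ + 1) * r = 2 * (r * ℓ) + r := by ring
    lia
  · have hr0 : (r : ℝ) ≠ 0 := by exact_mod_cast hr.ne'
    ext i
    rw [refine_node_apply, T.node_apply]
    simp only [fineNode]
    push_cast [Nat.cast_sub (show 1 ≤ r * ℓ by lia)]
    field_simp
    ring

-- Both matrices have an entry equal to one, at a coarse node that is an inner fine node. This
-- allows to drop their norms from the tolerance condition.
omit hP hαβ hK in
lemma one_le_specNorm_prolong (hr2 : 2 ≤ r) (hℓ : 1 ≤ ℓ) (K : Fin d → ℤ) :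
    1 ≤ specNorm (prolong T r hr ℓ K) ∧ 1 ≤ specNorm (prolongElt T r hr ℓ K) := by
  obtain ⟨k, hk⟩ := exists_center_idx (T := T) (hr := hr) hr2 hℓ K
  constructor
  · refine le_trans ?_ (abs_entry_le_specNorm _ k fun _ => ⟨ℓ, by lia⟩)
    have : coarseNode ℓ K (fun _ => ⟨ℓ, by lia⟩) = K := by ext a; simp [coarseNode]
    rw [prolong, Matrix.of_apply, hk, this, T.hat_node, if_pos rfl, abs_one]
  · refine le_trans ?_ (abs_entry_le_specNorm _ k 0)
    have : elementNode K 0 = K := by ext a; simp [elementNode]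
    rw [prolongElt, Matrix.of_apply, hk, this, T.hat_node, if_pos rfl, if_pos, abs_one]
    rw [T.node_mem_cell_iff]
    intro i; constructor <;> lia

/-- For w = Iᵀ v: VinfHat |v|² ≤ w · S⁻¹ w ≤ |w|² / Vinf ≤ ‖I‖² |v|² / Vinf. -/
lemma Vinf_mul_VinfHat_le (hd : 1 ≤ d) (hα : 0 < α) :
    P.Vinf * P.VinfHat ≤ specNorm (interpMat T r hr ℓ K) ^ 2 := by
  have hA := mem_coeffs_const (D := T.domain) (Tε := Tε) hαβ le_rfl
  have hpos := fun w hw => stiffness_pos (r := r) (hr := hr) (v := w) hd hK hα hA hw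
  set v : (Fin d → Fin (2 * ℓ + 2)) → ℝ := 1 with hv
  have hv0 : 0 < v ⬝ᵥ v := dotProduct_self_pos one_ne_zero
  have h1 := (hP.bounds_schur _ hA K hK v).1
  rw [dotProduct_schur] at h1
  set w := (interpMat T r hr ℓ K).transpose.mulVec v with hw
  set u := (stiffness T r hr ℓ K fun _ => β)⁻¹.mulVec w with hu
  have h2 : w ⬝ᵥ w ≤ specNorm (interpMat T r hr ℓ K) ^ 2 * (v ⬝ᵥ v) := by
    rw [← specNorm_transpose]; exact dotProduct_mulVec_self_le _ _
  have h3 := (hP.bounds _ hA K hK u).1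
  rw [mulVec_inv_mulVec (isUnit_det_of_pos hpos), dotProduct_comm u w] at h3
  have h4 := dotProduct_mul_dotProduct_le w u
  have hVh := hP.VinfHat_pos
  have hV := hP.Vinf_pos
  have hwu : 0 < w ⬝ᵥ u := lt_of_lt_of_le (mul_pos hVh hv0) h1
  have h5 : P.Vinf * (w ⬝ᵥ u) ≤ w ⬝ᵥ w := by
    refine le_of_mul_le_mul_right ?_ hwu
    nlinarith [mul_le_mul_of_nonneg_left h3 (dotProduct_self_nonneg' w)]
  refine le_of_mul_le_mul_right ?_ hv0
  nlinarith

/-- The absolute tolerance η has to control errors that are divided by the scaling σ = `P.vresc`. In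
the first summand of the tolerance condition ‖I‖⁴ / VinfHat² is at least Vinf², and the
prolongations have norm at least one. Hence σ Vinf² θ ≤ η, and multiplication by σ gives θ δ² ≤ σ η.
-/
lemma inv_vresc_le (hd : 1 ≤ d) (hα : 0 < α) (hr2 : 2 ≤ r) (hℓ : 1 ≤ ℓ) :
    P.vresc⁻¹ ≤ η / (P.θ * P.δ ^ 2) := by
  have hσ := hP.vresc_mem.1
  have hθ := hP.θ_mem.1
  have hγ := hP.γ_mem.1
  have hδ := hP.δ_pos
  have hV := hP.Vinf_pos
  have hVh := hP.VinfHat_pos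
  have htol := hP.tolerance K hK
  obtain ⟨h1, h2⟩ := one_le_specNorm_prolong (T := T) (hr := hr) hr2 hℓ K
  have h3 := hP.Vinf_mul_VinfHat_le hαβ hK hd hα
  have hI := specNorm_nonneg (interpMat T r hr ℓ K)
  generalize specNorm (interpMat T r hr ℓ K) = c at *
  generalize specNorm (prolong T r hr ℓ K) = a at *
  generalize specNorm (prolongElt T r hr ℓ K) = b at *
  have h4 : P.vresc * P.Vinf ^ 2 * P.θ ≤ η := by
    refine le_trans ?_ ((le_add_of_nonneg_right (by positivity)).trans htol)
    refine mul_le_mul_of_nonneg_right ?_ hθ.le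
    rw [le_div_iff₀ (by positivity)]
    calc P.vresc * P.Vinf ^ 2 * P.VinfHat ^ 2 = P.vresc * (P.Vinf * P.VinfHat) ^ 2 := by ring
      _ ≤ P.vresc * (c ^ 2) ^ 2 := by gcongr
      _ = P.vresc * 1 * 1 * c ^ 4 := by ring
      _ ≤ P.vresc * b * a * c ^ 4 := by gcongr
  rw [le_div_iff₀ (by positivity), inv_mul_le_iff₀ hσ]
  calc P.θ * P.δ ^ 2 = P.vresc * (P.vresc * P.Vinf ^ 2 * P.θ) := by rw [Params.δ]; ring
    _ ≤ P.vresc * η := mul_le_mul_of_nonneg_left h4 hσ.le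

end Admissible

end Consequences

/-! ### The size of the network -/

section Counting

variable {θ δ : ℝ} {n : ℕ}

lemma log_half_mul_lt (hθ : θ ∈ Ioo (0 : ℝ) (1 / 4)) (hδ : 0 < δ) (hδ1 : δ ≤ 3 / 4) :
    Real.log (0.5 * θ * δ) < Real.log (1 - δ) ∧ Real.log (1 - δ) < 0 := by
  have h1 := hθ.1
  have h2 := hθ.2
  refine ⟨Real.log_lt_log (by positivity) ?_, Real.log_neg (by linarith) (by linarith)⟩
  nlinarith

lemma neg_log_le_mul_neumannLength (hθ : θ ∈ Ioo (0 : ℝ) (1 / 4)) (hδ : 0 < δ)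
    (hδ1 : δ ≤ 3 / 4) :
    -Real.log (0.5 * θ * δ) ≤ neumannLength θ δ * -Real.log (1 - δ) := by
  obtain ⟨-, h2⟩ := log_half_mul_lt hθ hδ hδ1
  have h : Real.log (0.5 * θ * δ) / Real.log (1 - δ) ≤ neumannLength θ δ := Nat.le_ceil _
  rw [div_le_iff_of_neg h2] at h
  linarith

/-- Both logarithms are negative and their quotient exceeds one. This keeps log m away from zero, so
that constants can be absorbed in it. -/
lemma two_le_neumannLength (hθ : θ ∈ Ioo (0 : ℝ) (1 / 4)) (hδ : 0 < δ) (hδ1 : δ ≤ 3 / 4) :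
    2 ≤ neumannLength θ δ := by
  obtain ⟨h1, h2⟩ := log_half_mul_lt hθ hδ hδ1
  refine Nat.lt_ceil.2 ?_
  rw [lt_div_iff_of_neg h2]
  simpa using h1

lemma pow_neumannLength_le (hθ : θ ∈ Ioo (0 : ℝ) (1 / 4)) (hδ : 0 < δ) (hδ1 : δ ≤ 3 / 4) :
    (1 - δ) ^ neumannLength θ δ ≤ θ * δ / 2 := by
  have h := neg_log_le_mul_neumannLength hθ hδ hδ1
  have h1 := hθ.1
  have h3 : 0 < 1 - δ := by linarith
  rw [show θ * δ / 2 = 0.5 * θ * δ by ring, ← Real.log_le_log_iff (by positivity) (by positivity),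
    Real.log_pow]
  linarith

/-- This bounds log(1/δ) by log(2m), so δ need not appear in the size of the network. -/
lemma one_le_mul_neumannLength (hθ : θ ∈ Ioo (0 : ℝ) (1 / 4)) (hδ : 0 < δ) (hδ1 : δ ≤ 3 / 4) :
    1 ≤ 2 * δ * neumannLength θ δ := by
  have h := neg_log_le_mul_neumannLength hθ hδ hδ1
  have h1 := hθ.1
  have h2 := hθ.2
  have h3 : 0 < 1 - δ := by linarith
  -- `2 ≤ log (2 / (θ δ))` and `-log (1 - δ) ≤ 4 δ`
  have h4 : 2 ≤ -Real.log (0.5 * θ * δ) := by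
    rw [le_neg, Real.log_le_iff_le_exp (by positivity)]
    have h5 : Real.exp 2 ≤ 8 := by
      rw [show (2 : ℝ) = 1 + 1 by norm_num, Real.exp_add]
      have := Real.exp_one_lt_d9
      nlinarith [Real.exp_pos 1]
    have h6 : 0.5 * θ * δ ≤ 1 / 8 := by nlinarith
    refine h6.trans ?_
    rw [Real.exp_neg, one_div]
    exact inv_anti₀ (Real.exp_pos 2) h5
  have h7 : -Real.log (1 - δ) ≤ 4 * δ := by
    have := Real.one_sub_inv_le_log_of_pos h3
    have h8 : (1 - δ)⁻¹ - 1 ≤ 4 * δ := by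
      rw [sub_le_iff_le_add, inv_le_iff_one_le_mul₀ h3]
      nlinarith
    linarith
  have h9 := mul_le_mul_of_nonneg_left h7 (Nat.cast_nonneg (α := ℝ) (neumannLength θ δ))
  nlinarith

/-- The number of squarings that is used for Neumann series of length `m`. -/
def numSquarings (m : ℕ) : ℕ := Nat.log 2 m + 7

/-- The seven additional squarings lengthen the Neumann series by a factor of 64. The remainder
becomes (θ δ / 2) ^ 64, which outweighs all polynomial factors. -/
lemma mul_lt_two_pow_numSquarings (m : ℕ) : 64 * m + 64 ≤ 2 ^ numSquarings m := by
  have h : m < 2 ^ (Nat.log 2 m + 1) := Nat.lt_pow_succ_log_self (by norm_num) m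
  rw [numSquarings, show Nat.log 2 m + 7 = (Nat.log 2 m + 1) + 6 by ring, pow_add]
  lia

lemma lower_bound_log_two : (0.69 : ℝ) ≤ Real.log 2 := by linarith [Real.log_two_gt_d9]

lemma numSquarings_le {m : ℕ} (hm : 2 ≤ m) : (numSquarings m : ℝ) ≤ 12 * Real.log m := by
  have h1 : Real.log 2 ≤ Real.log m := Real.log_le_log two_pos (by exact_mod_cast hm)
  have h2 : (Nat.log 2 m : ℝ) * Real.log 2 ≤ Real.log m := by
    rw [← Real.log_pow]
    exact Real.log_le_log (by positivity) (by exact_mod_cast Nat.pow_log_le_self 2 (by lia))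
  have h3 := lower_bound_log_two
  have h4 : (Nat.log 2 m : ℝ) * 0.69 ≤ Real.log m :=
    (mul_le_mul_of_nonneg_left h3 (Nat.cast_nonneg _)).trans h2
  rw [numSquarings]
  push_cast
  have h6 := h3.trans h1
  norm_num at h4 h6
  linarith

/-- The number of bits that is used for the approximate multiplication. -/
def numBits (θ δ : ℝ) (n t : ℕ) : ℕ := ⌈Real.log (2592 * n ^ 9 * 32 ^ t / (θ * δ ^ 2))⌉₊

lemma le_four_pow_numBits {t : ℕ} (hn : 1 ≤ n) (hθ0 : 0 < θ) (hδ : 0 < δ) :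
    2592 * (n : ℝ) ^ 9 * 32 ^ t / (θ * δ ^ 2) ≤ 4 ^ numBits θ δ n t := by
  have hn0 : (0 : ℝ) < n := by exact_mod_cast hn
  have hX : 0 < 2592 * (n : ℝ) ^ 9 * 32 ^ t / (θ * δ ^ 2) := by positivity
  rw [← Real.log_le_log_iff hX (by positivity), Real.log_pow]
  refine (Nat.le_ceil _).trans ?_
  refine le_mul_of_one_le_right (Nat.cast_nonneg _) ?_
  rw [Real.le_log_iff_exp_le (by norm_num)]
  linarith [Real.exp_one_lt_d9]

variable (hθ : θ ∈ Ioo (0 : ℝ) (1 / 4)) (hδ : 0 < δ) (hδ1 : δ ≤ 3 / 4)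
include hθ hδ hδ1

/-- Each part of log(2592 n⁹ 32 ^ t / (θ δ²)) is a multiple of a term of `logFactor`: t ≤ 12 log m
and −log δ ≤ 2 log m; constants go into log m ≥ log 2. -/
lemma numBits_add_two_le (hn : 1 ≤ n) :
    (numBits θ δ n (numSquarings (neumannLength θ δ)) : ℝ) + 2 ≤ 64 * logFactor θ δ n := by
  set m := neumannLength θ δ with hmdef
  have hm : 2 ≤ m := two_le_neumannLength hθ hδ hδ1
  have hm0 : (0 : ℝ) < m := by positivity
  set t := numSquarings m
  have hn0 : (0 : ℝ) < n := by exact_mod_cast hn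
  have hθ0 := hθ.1
  have hl2 := lower_bound_log_two
  have hlm : Real.log 2 ≤ Real.log m := Real.log_le_log two_pos (by exact_mod_cast hm)
  have hln : 0 ≤ Real.log n := Real.log_natCast_nonneg n
  have hlθ : 0 ≤ Real.log (1 / θ) := Real.log_nonneg (by
    rw [le_div_iff₀ hθ0]; linarith [hθ.2])
  have hlδ : -Real.log δ ≤ 2 * Real.log m := by
    have h := one_le_mul_neumannLength hθ hδ hδ1
    have h1 : Real.log 1 ≤ Real.log (2 * δ * m) := Real.log_le_log one_pos h
    rw [Real.log_one, Real.log_mul (by positivity) hm0.ne', Real.log_mul two_ne_zero hδ.ne'] at h1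
    linarith
  have ht : (t : ℝ) ≤ 12 * Real.log m := numSquarings_le hm
  have h32 : Real.log 32 = 5 * Real.log 2 := by
    rw [show (32 : ℝ) = 2 ^ 5 by norm_num, Real.log_pow]; norm_num
  have hl2' : Real.log 2 ≤ 0.7 := by linarith [Real.log_two_lt_d9]
  have h2592 : Real.log 2592 ≤ 12 * Real.log 2 := by
    have : Real.log 2592 ≤ Real.log (2 ^ 12) := Real.log_le_log (by norm_num) (by norm_num)
    rwa [Real.log_pow] at this
  have ht32 : (t : ℝ) * Real.log 32 ≤ 42 * Real.log m := by
    calc (t : ℝ) * Real.log 32 ≤ 12 * Real.log m * 3.5 :=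
          mul_le_mul ht (by linarith) (by linarith) (by linarith)
      _ = _ := by ring
  have hX : Real.log (2592 * (n : ℝ) ^ 9 * 32 ^ t / (θ * δ ^ 2)) =
      Real.log 2592 + 9 * Real.log n + t * Real.log 32 + Real.log (1 / θ) - 2 * Real.log δ := by
    rw [Real.log_div (by positivity) (by positivity), Real.log_mul (by positivity) (by positivity),
      Real.log_mul (by positivity) (by positivity), Real.log_mul hθ0.ne' (by positivity),
      Real.log_pow, Real.log_pow, Real.log_pow, one_div, Real.log_inv]
    push_cast; ring
  have hδl : Real.log δ ≤ 0 := Real.log_nonpos hδ.le (by linarith)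
  have h0 : 0 ≤ Real.log (2592 * (n : ℝ) ^ 9 * 32 ^ t / (θ * δ ^ 2)) := by
    rw [hX]
    have : 0 ≤ (t : ℝ) * Real.log 32 := mul_nonneg (Nat.cast_nonneg _) (by linarith)
    have : 0 ≤ Real.log 2592 := Real.log_nonneg (by norm_num)
    linarith
  have hD := Nat.ceil_lt_add_one h0
  change (numBits θ δ n t : ℝ) < _ at hD
  rw [hX] at hD
  rw [logFactor, ← hmdef]
  linarith

lemma depth_le (hn : 1 ≤ n) : ((numSquarings (neumannLength θ δ) *
    (numBits θ δ n (numSquarings (neumannLength θ δ)) + 2) : ℕ) : ℝ) ≤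
      768 * (Real.log (neumannLength θ δ) * logFactor θ δ n) := by
  have h1 := numBits_add_two_le hθ hδ hδ1 hn
  have h2 := numSquarings_le (two_le_neumannLength hθ hδ hδ1)
  push_cast
  have h3 := mul_le_mul h2 h1 (by positivity) (by positivity)
  linarith

lemma one_le_logFactor (n : ℕ) : 1 ≤ logFactor θ δ n := by
  have h1 : Real.log 4 ≤ Real.log (1 / θ) := Real.log_le_log (by norm_num) (by
    rw [le_div_iff₀ hθ.1]; linarith [hθ.2])
  have h2 : Real.log 4 = 2 * Real.log 2 := by
    rw [show (4 : ℝ) = 2 ^ 2 by norm_num, Real.log_pow]; norm_num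
  have h3 := lower_bound_log_two
  have h4 := Real.log_natCast_nonneg n
  have h5 := Real.log_natCast_nonneg (neumannLength θ δ)
  rw [logFactor]
  linarith

/-- Here `a` is the size of the encoding matrix, `b` the input dimension and `c` the number of
outputs. The squarings need only the factor log m, which is at most m log² m because m log m ≥ 1. -/
lemma params_le (hn : 1 ≤ n) {a b c : ℕ} (ha : a ≤ 3 * n) (hb : b ≤ n) (hc : c ≤ n ^ 2) :
    ((a ^ 2 * 2 * (b + 1) + (numSquarings (neumannLength θ δ) *
      (a ^ 3 * (24 * numBits θ δ n (numSquarings (neumannLength θ δ)) + 38)) + c * 3) : ℕ) : ℝ) ≤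
    10 ^ 6 * (neumannLength θ δ * Real.log (neumannLength θ δ) ^ 2 * (n : ℝ) ^ 3 *
      logFactor θ δ n) := by
  have h1 := depth_le hθ hδ hδ1 hn
  have hm := two_le_neumannLength hθ hδ hδ1
  have hL := one_le_logFactor hθ hδ hδ1 n
  set m := neumannLength θ δ
  set t := numSquarings m
  set D := numBits θ δ n t
  set L := logFactor θ δ n
  have hnat : a ^ 2 * 2 * (b + 1) + (t * (a ^ 3 * (24 * D + 38)) + c * 3) ≤
      39 * n ^ 3 + 648 * (n ^ 3 * (t * (D + 2))) := by
    have e1 : a ^ 2 * 2 * (b + 1) ≤ (3 * n) ^ 2 * 2 * (n + n) := by gcongr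
    have e2 : t * (a ^ 3 * (24 * D + 38)) ≤ t * ((3 * n) ^ 3 * (24 * (D + 2))) := by
      gcongr; lia
    have e3 : c * 3 ≤ n ^ 2 * n * 3 := by
      have := Nat.mul_le_mul hc hn
      lia
    calc _ ≤ (3 * n) ^ 2 * 2 * (n + n) + (t * ((3 * n) ^ 3 * (24 * (D + 2))) + n ^ 2 * n * 3) := by
          lia
      _ = _ := by ring
  refine (Nat.cast_le.2 hnat).trans ?_
  rw [Nat.cast_add, Nat.cast_mul, Nat.cast_mul, Nat.cast_mul, Nat.cast_pow]
  have hm' : (2 : ℝ) ≤ m := by exact_mod_cast hm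
  have hlm : 0.69 ≤ Real.log m := lower_bound_log_two.trans (Real.log_le_log two_pos hm')
  have e4 : 1 ≤ m * Real.log m := by nlinarith
  have hn3 : (0 : ℝ) ≤ (n : ℝ) ^ 3 := by positivity
  have e5 : Real.log m * L ≤ m * Real.log m ^ 2 * L := by
    refine mul_le_mul_of_nonneg_right ?_ (by linarith)
    nlinarith
  have e6 : 0.69 ≤ m * Real.log m ^ 2 * L := by nlinarith
  have e7 := h1.trans (mul_le_mul_of_nonneg_left e5 (by norm_num))
  have e8 := mul_le_mul_of_nonneg_left e7 hn3
  have e9 := mul_le_mul_of_nonneg_left e6 hn3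
  push_cast at e8 ⊢
  nlinarith

-- The origin of the number of bits: ρ⁻² = 4 ^ t · 9 n⁶ and the squaring error 8 ^ t · 9 n² · 16 · 4
-- ^ (−D) combine to 1296 n⁸ 32 ^ t. The scaling contributes σ⁻¹ ≤ η / (θ δ²) and the target
-- accuracy η / (2n) another 2n.
omit hδ1 in
lemma squaring_accuracy {σ η : ℝ} {t : ℕ} (hn : 1 ≤ n) (hη : 0 < η) (hσ : 0 < σ)
    (h : σ⁻¹ ≤ η / (θ * δ ^ 2)) :
    (σ * (((2 : ℝ) ^ t * (3 * n ^ 3))⁻¹) ^ 2)⁻¹ *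
      (8 ^ t * ((3 * n) ^ 2 * (16 * (1 / 4) ^ numBits θ δ n t))) ≤ η / (2 * n) := by
  have hn0 : (0 : ℝ) < n := by exact_mod_cast hn
  have hθ0 := hθ.1
  have h4 := le_four_pow_numBits (t := t) hn hθ0 hδ
  set D := numBits θ δ n t
  have h32 : (32 : ℝ) ^ t = (2 ^ t) ^ 2 * 8 ^ t := by
    rw [← pow_mul, mul_comm t 2, pow_mul, ← mul_pow]; norm_num
  have e1 : (σ * (((2 : ℝ) ^ t * (3 * n ^ 3))⁻¹) ^ 2)⁻¹ *
      (8 ^ t * ((3 * n) ^ 2 * (16 * (1 / 4) ^ D))) =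
      σ⁻¹ * (1296 * (n : ℝ) ^ 8 * 32 ^ t) / 4 ^ D := by
    rw [h32, show ((1 : ℝ) / 4) ^ D = (4 ^ D)⁻¹ by rw [one_div, inv_pow]]
    field_simp
    ring
  rw [e1, div_le_iff₀ (by positivity)]
  calc σ⁻¹ * (1296 * (n : ℝ) ^ 8 * 32 ^ t)
      ≤ η / (θ * δ ^ 2) * (1296 * (n : ℝ) ^ 8 * 32 ^ t) := by gcongr
    _ = η / (2 * n) * (2592 * (n : ℝ) ^ 9 * 32 ^ t / (θ * δ ^ 2)) := by field_simp; ring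
    _ ≤ η / (2 * n) * 4 ^ D := by gcongr

lemma squaring_stable {t : ℕ} (hn : 1 ≤ n) :
    (8 : ℝ) ^ t * ((3 * n) ^ 2 * (16 * (1 / 4) ^ numBits θ δ n t)) ≤ 1 := by
  have hn1 : (1 : ℝ) ≤ n := by exact_mod_cast hn
  have hθ0 := hθ.1
  have h4 := le_four_pow_numBits (t := t) hn hθ0 hδ
  set D := numBits θ δ n t
  rw [one_div, inv_pow, ← mul_assoc, ← mul_assoc, ← div_eq_mul_inv, div_le_one (by positivity)]
  refine le_trans ?_ h4
  rw [le_div_iff₀ (by positivity)]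
  have e1 : θ * δ ^ 2 ≤ 1 := by
    have := hθ.2
    nlinarith
  have e2 : (n : ℝ) ^ 2 ≤ n ^ 9 := pow_le_pow_right₀ hn1 (by norm_num)
  have e3 : (8 : ℝ) ^ t ≤ 32 ^ t := pow_le_pow_left₀ (by norm_num) (by norm_num) t
  calc (8 : ℝ) ^ t * (3 * n) ^ 2 * 16 * (θ * δ ^ 2) ≤ (8 : ℝ) ^ t * (3 * n) ^ 2 * 16 * 1 := by
        gcongr
    _ = 144 * (n : ℝ) ^ 2 * 8 ^ t := by ring
    _ ≤ 2592 * (n : ℝ) ^ 9 * 32 ^ t := by gcongr; all_goals norm_num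

/-- Of the 64 factors θ δ / 2, the part δ⁶ pays for n⁴ through n⁴ δ⁶ ≤ 2 ^ 42, the part θ δ³ for 1/δ
and for the bound of σ⁻¹, and the powers of two outweigh the constant. -/
lemma neumann_accuracy {σ η : ℝ} (hn : 1 ≤ n) (hη : 0 < η)
    (h : σ⁻¹ ≤ η / (θ * δ ^ 2)) (hnδ : (n : ℝ) ^ 2 * δ ^ 3 ≤ 2 ^ 21) :
    σ⁻¹ * (n * (n : ℝ) ^ 2 / δ * (1 - δ) ^ (2 ^ numSquarings (neumannLength θ δ) - 1)) ≤
      η / (2 * n) := by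
  have hn0 : (0 : ℝ) < n := by exact_mod_cast hn
  have hθ0 := hθ.1
  have hθ1 : θ ≤ 1 := by linarith [hθ.2]
  have hδ' : δ ≤ 1 := by linarith
  have h3 : 0 ≤ 1 - δ := by linarith
  set m := neumannLength θ δ
  have hq : (1 - δ) ^ (2 ^ numSquarings m - 1) ≤ (θ * δ / 2) ^ 64 := by
    calc (1 - δ) ^ (2 ^ numSquarings m - 1) ≤ (1 - δ) ^ (m * 64) :=
          pow_le_pow_of_le_one h3 (by linarith) (by
            have := mul_lt_two_pow_numSquarings m; lia)
      _ = ((1 - δ) ^ m) ^ 64 := pow_mul _ _ _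
      _ ≤ (θ * δ / 2) ^ 64 := pow_le_pow_left₀ (by positivity) (pow_neumannLength_le hθ hδ hδ1) _
  have hn4 : (n : ℝ) ^ 4 * δ ^ 6 ≤ 2 ^ 42 := by
    calc (n : ℝ) ^ 4 * δ ^ 6 = ((n : ℝ) ^ 2 * δ ^ 3) ^ 2 := by ring
      _ ≤ (2 ^ 21) ^ 2 := by gcongr
      _ = _ := by norm_num
  have key : 2 * (n : ℝ) ^ 4 * (θ * δ / 2) ^ 64 ≤ θ * δ ^ 3 := by
    calc 2 * (n : ℝ) ^ 4 * (θ * δ / 2) ^ 64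
        = (n : ℝ) ^ 4 * δ ^ 6 * (θ * δ ^ 3) * (θ ^ 63 * δ ^ 55) / 2 ^ 63 := by ring
      _ ≤ 2 ^ 42 * (θ * δ ^ 3) * (1 * 1) / 2 ^ 63 := by
          gcongr
          · exact pow_le_one₀ hθ0.le hθ1
          · exact pow_le_one₀ hδ.le hδ'
      _ ≤ θ * δ ^ 3 := by
          have : 0 < θ * δ ^ 3 := by positivity
          rw [div_le_iff₀ (by positivity)]
          linarith
  have hpos : 0 ≤ (n : ℝ) * (n : ℝ) ^ 2 / δ * (1 - δ) ^ (2 ^ numSquarings m - 1) := by positivity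
  calc σ⁻¹ * (n * (n : ℝ) ^ 2 / δ * (1 - δ) ^ (2 ^ numSquarings m - 1))
      ≤ η / (θ * δ ^ 2) * (n * (n : ℝ) ^ 2 / δ * (θ * δ / 2) ^ 64) := by
        refine mul_le_mul h ?_ hpos (by positivity)
        gcongr
    _ = η / (2 * n) * (2 * (n : ℝ) ^ 4 * (θ * δ / 2) ^ 64 / (θ * δ ^ 3)) := by
        field_simp
    _ ≤ η / (2 * n) * 1 := by
        gcongr
        exact (div_le_one (by positivity)).2 key
    _ = _ := mul_one _

end Counting

/-! ### The approximating network -/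

section Network

variable {d : ℕ} {T : CartesianMesh d} {r : ℕ} {hr : 0 < r} {ℓ : ℕ} {K : Fin d → ℤ}
  {Tε : CartesianMesh d} {α β η : ℝ} {P : Params}

lemma logFactor_nonneg {θ : ℝ} (hθ : 0 < θ) (hθ1 : θ ≤ 1) (δ : ℝ) (n : ℕ) :
    0 ≤ logFactor θ δ n := by
  have h1 : 0 ≤ Real.log (1 / θ) := Real.log_nonneg (by rwa [le_div_iff₀ hθ, one_mul])
  have h2 := Real.log_natCast_nonneg n
  have h3 := Real.log_natCast_nonneg (neumannLength θ δ)
  rw [logFactor]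
  linarith

/-- A hat that spans the patch has width s ≥ 6 fine steps, as the patch is at least 12 fine steps
wide. From δ s² ≤ 3 ^ d ≤ 27 follow δ ≤ 27/36 and, with n ≤ (2s)³, n² δ³ ≤ 64 · 27³. -/
lemma Admissible.δ_bounds (hd3 : d ≤ 3) (hr4 : 4 ≤ r) (hℓ : 1 ≤ ℓ)
    (hP : Admissible T r hr ℓ (coeffs T.domain Tε α β) η P) (hαβ : α ≤ β)
    (hK : T.IsInterior ℓ K) :
    P.δ ≤ 3 / 4 ∧ ((((2 * ℓ + 1) * r - 1) ^ d : ℕ) : ℝ) ^ 2 * P.δ ^ 3 ≤ 2 ^ 21 := by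
  have h12 : 12 ≤ (2 * ℓ + 1) * r := by nlinarith
  set n₁ := (2 * ℓ + 1) * r - 1 with hn₁
  have hn : 11 ≤ n₁ := by lia
  set s := (n₁ + 1) / 2 with hs
  have hs6 : 6 ≤ s := by lia
  have hns : n₁ ≤ 2 * s := by lia
  have h := hP.δ_mul_sq_le hαβ hK (fun _ => ⟨0, by lia⟩) (s := s) (by lia) (by lia)
  have h3 : (3 : ℝ) ^ d ≤ 27 := by
    calc (3 : ℝ) ^ d ≤ 3 ^ 3 := pow_le_pow_right₀ (by norm_num) hd3
      _ = 27 := by norm_num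
  have hδ := hP.δ_pos
  have hs6' : (6 : ℝ) ≤ s := by exact_mod_cast hs6
  have h4 : P.δ * (s : ℝ) ^ 2 ≤ 27 := h.trans h3
  have h36 : (36 : ℝ) ≤ (s : ℝ) ^ 2 := by nlinarith
  refine ⟨by nlinarith, ?_⟩
  have h5 : ((n₁ ^ d : ℕ) : ℝ) ≤ 8 * (s : ℝ) ^ 3 := by
    have : n₁ ^ d ≤ (2 * s) ^ 3 :=
      (Nat.pow_le_pow_right (by lia) hd3).trans (Nat.pow_le_pow_left hns 3)
    calc ((n₁ ^ d : ℕ) : ℝ) ≤ (((2 * s) ^ 3 : ℕ) : ℝ) := Nat.cast_le.2 this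
      _ = 8 * (s : ℝ) ^ 3 := by push_cast; ring
  calc ((n₁ ^ d : ℕ) : ℝ) ^ 2 * P.δ ^ 3 ≤ (8 * (s : ℝ) ^ 3) ^ 2 * P.δ ^ 3 := by gcongr
    _ = 64 * (P.δ * (s : ℝ) ^ 2) ^ 3 := by ring
    _ ≤ 64 * 27 ^ 3 := by gcongr
    _ ≤ 2 ^ 21 := by norm_num

/-- The scaling factor in the encoding matrix. -/
def encScale (n t : ℕ) : ℝ := ((2 : ℝ) ^ t * (3 * n ^ 3))⁻¹

/-- The accuracy of the approximation of the entries of the local matrices. -/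
lemma abs_pgLOD_sub_le (hd : 1 ≤ d) (hd3 : d ≤ 3) (hr4 : 4 ≤ r) (hℓ : 1 ≤ ℓ) (hα : 0 < α)
    (hαβ : α ≤ β) (hη : η ∈ Ioo (0 : ℝ) (1 / 4))
    (hP : Admissible T r hr ℓ (coeffs T.domain Tε α β) η P) (hK : T.IsInterior ℓ K)
    {A : (Fin d → ℝ) → ℝ} (hA : A ∈ coeffs T.domain Tε α β) {n t D : ℕ}
    (hn : n = ((2 * ℓ + 1) * r - 1) ^ d) (ht : t = numSquarings (neumannLength P.θ P.δ))
    (hD : D = numBits P.θ P.δ n t)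
    (hcard : Fintype.card ((Fin d → Fin (2 * ℓ + 2)) ⊕ (FineIdx d r ℓ ⊕ (Fin d → Fin 2))) ≤ 3 * n)
    (i : Fin d → Fin (2 * ℓ + 2)) (j : Fin d → Fin 2) :
    |pgLOD T (T.refine r hr) A ℓ K i j - -(P.vresc * encScale n t ^ 2)⁻¹ *
      (approxMatSq D)^[t] (encMat (interpMat T r hr ℓ K) P.vresc (encScale n t)
        (stiffness T r hr ℓ K A) (coarseFine T r hr ℓ K A) (loadMat T r hr ℓ K A)
        (coarseElt T ℓ K A)) (.inl i) (.inr (.inr j))| ≤ η / n := by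
  have hσ := hP.vresc_mem.1
  have hδ := hP.δ_pos
  have hθ : P.θ ∈ Ioo (0 : ℝ) (1 / 4) := ⟨hP.θ_mem.1, hP.θ_mem.2.trans hη.2⟩
  obtain ⟨hδ1, hnδ⟩ := hP.δ_bounds hd3 hr4 hℓ hαβ hK
  rw [← hn] at hnδ
  have hrn : r ≤ (2 * ℓ + 1) * r - 1 := by
    have : 3 * r ≤ (2 * ℓ + 1) * r := Nat.mul_le_mul_right r (by lia)
    lia
  have hn1 : 1 ≤ n := by rw [hn]; exact Nat.one_le_pow _ _ (by lia)
  have hn1' : (1 : ℝ) ≤ n := by exact_mod_cast hn1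
  have hrd : (r : ℝ) ^ d ≤ n := by
    rw [hn, Nat.cast_pow]
    exact pow_le_pow_left₀ (Nat.cast_nonneg _) (by exact_mod_cast hrn) d
  let k₀ : FineIdx d r ℓ := fun _ => ⟨0, by lia⟩
  have hhat : ∀ z, IsLip (T.hat z) := fun z => T.isLip_hat z
  have hchat : ∀ z, HasCompactSupport (T.hat z) := fun z => T.hasCompactSupport_hat z
  have hcfine : ∀ k, HasCompactSupport (fineHat T r hr ℓ K k) := fun k =>
    CartesianMesh.hasCompactSupport_hat _ _
  have hdhat : ∀ z, dirichlet (T.hat z) ≤ (r : ℝ) ^ d * dirichlet (fineHat T r hr ℓ K k₀) :=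
    fun z => dirichlet_hat_le z k₀
  have hdfine : ∀ k, dirichlet (fineHat T r hr ℓ K k) ≤
      (r : ℝ) ^ d * dirichlet (fineHat T r hr ℓ K k₀) := fun k => dirichlet_fineHat_le k k₀
  have hB : ∀ i k, |P.vresc * coarseFine T r hr ℓ K A i k| ≤ n := fun i k =>
    (hP.abs_vresc_mul_energy_le hαβ hK hα k₀ hA subset_rfl (hhat _) (isLip_fineHat k) (hchat _)
      (hcfine k) (hdhat _) (hdfine k)).trans hrd
  have hb : ∀ k j, |P.vresc * loadMat T r hr ℓ K A k j| ≤ n := fun k j =>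
    (hP.abs_vresc_mul_energy_le hαβ hK hα k₀ hA hK.cell_subset_domain (hhat _) (isLip_fineHat k)
      (hchat _) (hcfine k) (hdhat _) (hdfine k)).trans hrd
  have hG : ∀ i j, |P.vresc * coarseElt T ℓ K A i j| ≤ n := fun i j =>
    (hP.abs_vresc_mul_energy_le hαβ hK hα k₀ hA hK.cell_subset_domain (hhat _) (hhat _)
      (hchat _) (hchat _) (hdhat _) (hdhat _)).trans hrd
  obtain ⟨x, hx, hx', hpg⟩ := exists_pgLOD_eq (r := r) (hr := hr) hd hK hα hA j
  rw [hpg i]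
  have hI := fun y (hy : (interpMat T r hr ℓ K).transpose.mulVec y = 0) =>
    interpMat_transpose_injective (by lia) hK hy
  have hS := stiffness_isSymm (T := T) (r := r) (hr := hr) (ℓ := ℓ) (K := K) A
  have hδS := hP.δ_mul_le hA hK
  have hσS := hP.vresc_mul_stiffness_le hA hK
  have hcn : (Fintype.card (FineIdx d r ℓ) : ℝ) ≤ n := by simp [hn]
  have hcard' : (Fintype.card ((Fin d → Fin (2 * ℓ + 2)) ⊕ (FineIdx d r ℓ ⊕ (Fin d → Fin 2))) : ℝ) ≤
      3 * n := by exact_mod_cast hcard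
  have hinv := hP.inv_vresc_le hαβ hK hd hα (by lia) hℓ
  have hacc1 := neumann_accuracy hθ hδ hδ1 hn1 hη.1 hinv hnδ
  have hacc2 := squaring_accuracy (t := t) hθ hδ hn1 hη.1 hσ hinv
  have hstab := squaring_stable (t := t) hθ hδ hδ1 hn1
  rw [← ht] at hacc1
  rw [← hD] at hacc2 hstab
  set ρ := encScale n t with hρ
  have hρ0 : 0 < ρ := by rw [hρ, encScale]; positivity
  have hρ1 : ρ ≤ 1 := by
    rw [hρ, encScale]
    refine inv_le_one_of_one_le₀ ?_
    have h1 : (1 : ℝ) ≤ 2 ^ t := one_le_pow₀ (by norm_num)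
    have h2 : (1 : ℝ) ≤ n ^ 3 := one_le_pow₀ hn1'
    nlinarith
  set M := encMat (interpMat T r hr ℓ K) P.vresc ρ (stiffness T r hr ℓ K A)
    (coarseFine T r hr ℓ K A) (loadMat T r hr ℓ K A) (coarseElt T ℓ K A) with hM
  -- The scaling ρ is chosen for this: 3n · ρ · n · n = 2 ^ (−t).
  have hMn : specNorm M ≤ 1 + (1 / 2) ^ t := by
    refine (specNorm_encMat_le hI hS hδ.le hδS (by linarith) hσS hρ0.le hρ1 (Nat.cast_nonneg n)
      hB hb hG hn1' hcn hcard').trans (le_of_eq ?_)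
    rw [hρ, encScale, one_div, inv_pow]
    field_simp
  have herr := iterate_approxMatSq_error hcard' hMn hstab le_rfl
  have hpow := encMat_pow_apply (σ := P.vresc) (ρ := ρ) (B := coarseFine T r hr ℓ K A)
    (G := coarseElt T ℓ K A) hI hx hx' (2 ^ t - 1) i
  rw [Nat.sub_add_cancel Nat.one_le_two_pow, ← hM] at hpow
  have hentry := (abs_entry_le_specNorm _ (.inl i) (.inr (.inr j))).trans herr
  rw [Matrix.sub_apply, hpow] at hentry
  have hneu := (abs_mulVec_pow_projIter_le hI hS hσ hδ hδS (by linarith) hσS hB hb hcn hx hx'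
    (2 ^ t - 1) i).trans hacc1
  set e := (coarseFine T r hr ℓ K A).mulVec
    ((projIter (interpMat T r hr ℓ K) (stiffness T r hr ℓ K A) P.vresc ^ (2 ^ t - 1)).mulVec x) i
  set g := coarseElt T ℓ K A i j - (coarseFine T r hr ℓ K A).mulVec x i
  set Q := (approxMatSq D)^[t] M (.inl i) (.inr (.inr j))
  set q := P.vresc * ρ ^ 2 with hq
  have hq0 : 0 < q := by positivity
  have hsq : |q⁻¹ * (Q - -(ρ ^ 2 * P.vresc) * (g + e))| ≤ η / (2 * n) := by
    rw [abs_mul, abs_of_pos (inv_pos.2 hq0)]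
    exact (mul_le_mul_of_nonneg_left hentry (inv_pos.2 hq0).le).trans hacc2
  -- The total error splits into the squaring error, enlarged by undoing the scaling, and the
  -- remainder e of the Neumann series; each receives η / (2n).
  have hid : g - -q⁻¹ * Q = q⁻¹ * (Q - -(ρ ^ 2 * P.vresc) * (g + e)) - e := by
    rw [show ρ ^ 2 * P.vresc = q from mul_comm _ _]
    field_simp
    ring
  rw [hid]
  refine (abs_sub _ _).trans ?_
  have : η / n = η / (2 * n) + η / (2 * n) := by field_simp; norm_num
  linarith

/-- The encoding matrix is set up on one reference element `K₀`; its weights are right for every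
interior K. The errors of the entries are at most η / n, and a matrix with at most n rows and
columns then has spectral norm at most η. -/
theorem exists_network (hd : 1 ≤ d) (hd3 : d ≤ 3) {p q : ℕ} (hp : 2 ≤ p) (hq : 2 ≤ q)
    (hp0 : 0 < p) (hr : 0 < p * q) (hℓ : 1 ≤ ℓ) (hα : 0 < α) (hαβ : α ≤ β)
    (hη : η ∈ Ioo (0 : ℝ) (1 / 4))
    (hP : Admissible T (p * q) hr ℓ (coeffs T.domain (T.refine p hp0) α β) η P) {n : ℕ}
    (hn : n = ((2 * ℓ + 1) * (p * q) - 1) ^ d)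
    (eε : (Fin d → Fin ((2 * ℓ + 1) * p)) ≃ Fin (((2 * ℓ + 1) * p) ^ d))
    (eN : (Fin d → Fin (2 * ℓ + 2)) ≃ Fin ((2 * ℓ + 2) ^ d))
    (eK : (Fin d → Fin 2) ≃ Fin (2 ^ d)) {K₀ : Fin d → ℤ} (hK₀ : T.IsInterior ℓ K₀) :
    ∃ Ψ : NeuralNetwork (((2 * ℓ + 1) * p) ^ d) (2 ^ d * (2 * ℓ + 2) ^ d),
      (∀ A ∈ coeffs T.domain (T.refine p hp0) α β, ∀ K, T.IsInterior ℓ K →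
        specNorm (Matrix.reindex eN eK (pgLOD T (T.refine (p * q) hr) A ℓ K) -
          mat (Ψ.realize (fun t => coeffVec T p hp0 ℓ K A (eε.symm t)))) ≤ η) ∧
      (Ψ.depth : ℝ) ≤ 768 * (Real.log (neumannLength P.θ P.δ) * logFactor P.θ P.δ n) + 2 ∧
      (Ψ.numParams : ℝ) ≤ 10 ^ 6 * (neumannLength P.θ P.δ *
        Real.log (neumannLength P.θ P.δ) ^ 2 * (n : ℝ) ^ 3 * logFactor P.θ P.δ n) := by
  have hr4 : 4 ≤ p * q := Nat.mul_le_mul hp hq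
  have hn₁ : 4 * (2 * ℓ + 1) ≤ (2 * ℓ + 1) * (p * q) := by
    rw [mul_comm]; exact Nat.mul_le_mul_left _ hr4
  have hn1 : 1 ≤ n := by rw [hn]; exact Nat.one_le_pow _ _ (by lia)
  have hn1' : (1 : ℝ) ≤ n := by exact_mod_cast hn1
  -- Coarse nodes, corners and inputs are no more numerous than the inner fine nodes, so n alone
  -- governs the size; for the inputs this uses q ≥ 2.
  have hcN : (2 * ℓ + 2) ^ d ≤ n := by rw [hn]; exact Nat.pow_le_pow_left (by lia) d
  have hcJ : 2 ^ d ≤ n := by rw [hn]; exact Nat.pow_le_pow_left (by lia) d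
  have hcμ : ((2 * ℓ + 1) * p) ^ d ≤ n := by
    rw [hn]
    refine Nat.pow_le_pow_left ?_ d
    have h1 : (2 * ℓ + 1) * p * 2 ≤ (2 * ℓ + 1) * (p * q) := by
      rw [← mul_assoc]; exact Nat.mul_le_mul_left _ hq
    have h2 : 1 ≤ (2 * ℓ + 1) * p := Nat.mul_pos (by lia) hp0
    lia
  have hcard : Fintype.card
      ((Fin d → Fin (2 * ℓ + 2)) ⊕ (FineIdx d (p * q) ℓ ⊕ (Fin d → Fin 2))) ≤ 3 * n := by
    simp only [Fintype.card_sum, Fintype.card_fun, Fintype.card_fin, ← hn]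
    lia
  have hθ : P.θ ∈ Ioo (0 : ℝ) (1 / 4) := ⟨hP.θ_mem.1, hP.θ_mem.2.trans hη.2⟩
  have hδ := hP.δ_pos
  obtain ⟨hδ1, -⟩ := hP.δ_bounds hd3 hr4 hℓ hαβ hK₀
  obtain ⟨XS, hXS⟩ := exists_stiffness_eq_sum (β := β) T (p * q) hr ℓ p hp0 hα K₀
  obtain ⟨XB, hXB⟩ := exists_coarseFine_eq_sum (β := β) T (p * q) hr ℓ p hp0 hα K₀
  obtain ⟨Xb, hXb⟩ := exists_loadMat_eq_sum (β := β) T (p * q) hr ℓ p hp0 hα K₀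
  obtain ⟨XG, hXG⟩ := exists_coarseElt_eq_sum (β := β) T ℓ p hp0 hα K₀
  set t := numSquarings (neumannLength P.θ P.δ) with ht
  set D := numBits P.θ P.δ n t with hD
  set pos : (Fin d → Fin 2) × (Fin d → Fin (2 * ℓ + 2)) →
      ((Fin d → Fin (2 * ℓ + 2)) ⊕ (FineIdx d (p * q) ℓ ⊕ (Fin d → Fin 2))) ×
        ((Fin d → Fin (2 * ℓ + 2)) ⊕ (FineIdx d (p * q) ℓ ⊕ (Fin d → Fin 2))) :=
    fun x => (.inl x.2, .inr (.inr x.1)) with hpos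
  have hnet := (isAffineMat_encMat (interpMat T (p * q) hr ℓ K₀) P.vresc (encScale n t)
    (isAffineMat_sum_smul XS) (isAffineMat_sum_smul XB) (isAffineMat_sum_smul Xb)
    (isAffineMat_sum_smul XG)).netComputes_iterate_approxMatSq
      (-(P.vresc * encScale n t ^ 2)⁻¹) pos D t
  obtain ⟨Ψ, hΨ, hdepth, hparams⟩ := hnet _ _ eε ((eK.prodCongr eN).trans finProdFinEquiv)
  refine ⟨Ψ, fun A hA K hK => ?_, ?_, ?_⟩
  · have hη0 := hη.1
    have hmain := specNorm_le_of_entry_le (s := (n : ℝ)) (c := η / n)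
      (M := Matrix.reindex eN eK (pgLOD T (T.refine (p * q) hr) A ℓ K) -
          mat (Ψ.realize (fun t => coeffVec T p hp0 ℓ K A (eε.symm t)))) (by positivity)
      (fun i j => ?_) (by simpa using (by exact_mod_cast hcN : (((2 * ℓ + 2) ^ d : ℕ) : ℝ) ≤ n))
      (by simpa using (by exact_mod_cast hcJ : ((2 ^ d : ℕ) : ℝ) ≤ n))
    · rwa [mul_div_cancel₀ _ (by positivity)] at hmain
    · have h := abs_pgLOD_sub_le hd hd3 hr4 hℓ hα hαβ hη hP hK hA hn ht hD hcard
        (eN.symm i) (eK.symm j)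
      rw [hXS A hA K hK, hXB A hA K hK, hXb A hA K hK, hXG A hA K hK,
        interpMat_eq_of_isInterior hK₀ hK] at h
      have hr := congrFun (hΨ (coeffVec T p hp0 ℓ K A)) (finProdFinEquiv (j, i))
      rw [Matrix.sub_apply, Matrix.reindex_apply, Matrix.submatrix_apply, mat, Matrix.of_apply]
      change |_ - Ψ.realize (coeffVec T p hp0 ℓ K A ∘ eε.symm) _| ≤ _
      rw [hr]
      simpa [hpos] using h
  · rw [hdepth]
    have := depth_le hθ hδ hδ1 hn1
    rw [← ht, ← hD] at this
    push_cast at this ⊢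
    linarith
  · refine (Nat.cast_le.2 hparams).trans ?_
    refine params_le hθ hδ hδ1 hn1 hcard (by simpa using hcμ) ?_
    simp only [Fintype.card_prod, Fintype.card_fun, Fintype.card_fin]
    rw [sq]
    exact Nat.mul_le_mul hcJ hcN

end Network

end LODNet

end

/-! ### The main theorem -/

theorem mainTheorem1 (d : ℕ) (hd : 1 ≤ d) (hd3 : d ≤ 3) :
    ∃ C : ℝ, 0 < C ∧ ∀ α β : ℝ, 0 < α → α ≤ β → ∃ c : ℝ, 0 < c ∧
      ∀ (T : LODNet.CartesianMesh d), T.cells.Nonempty → Convex ℝ T.domain →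
      ∀ (p q : ℕ) (hp : 2 ≤ p) (hq : 2 ≤ q) (hp0 : 0 < p) (hr : 0 < p * q)
        (ℓ : ℕ), 1 ≤ ℓ → ∀ η ∈ Set.Ioo (0 : ℝ) (1 / 4),
      -- the correctors are well defined
      (∀ A ∈ LODNet.coeffs T.domain (T.refine p hp0) α β, ∀ K, T.IsInterior ℓ K →
        ∀ j : Fin d → Fin 2, ∃! w : (Fin d → ℝ) → ℝ,
          LODNet.IsElementCorrector T (T.refine (p * q) hr) A ℓ K
            (T.hat (LODNet.elementNode K j)) w) ∧
      -- admissible parameters exist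
      (∃ P : LODNet.Params,
        LODNet.Admissible T (p * q) hr ℓ (LODNet.coeffs T.domain (T.refine p hp0) α β) η P ∧
        LODNet.Sharp T (p * q) hr ℓ (LODNet.coeffs T.domain (T.refine p hp0) α β) c P) ∧
      -- every choice of admissible parameters gives a network
      ∀ P : LODNet.Params,
        LODNet.Admissible T (p * q) hr ℓ (LODNet.coeffs T.domain (T.refine p hp0) α β) η P →
      ∀ (eε : (Fin d → Fin ((2 * ℓ + 1) * p)) ≃ Fin (((2 * ℓ + 1) * p) ^ d))
        (eN : (Fin d → Fin (2 * ℓ + 2)) ≃ Fin ((2 * ℓ + 2) ^ d))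
        (eK : (Fin d → Fin 2) ≃ Fin (2 ^ d)),
      ∃ Ψ : LODNet.NeuralNetwork (((2 * ℓ + 1) * p) ^ d) (2 ^ d * (2 * ℓ + 2) ^ d),
        (∀ A ∈ LODNet.coeffs T.domain (T.refine p hp0) α β, ∀ K, T.IsInterior ℓ K →
          LODNet.specNorm
            (Matrix.reindex eN eK (LODNet.pgLOD T (T.refine (p * q) hr) A ℓ K) -
              LODNet.mat (Ψ.realize
                (fun t => LODNet.coeffVec T p hp0 ℓ K A (eε.symm t)))) ≤ η) ∧
        (Ψ.depth : ℝ) ≤ C *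
          (Real.log (LODNet.neumannLength P.θ P.δ) *
              LODNet.logFactor P.θ P.δ (((2 * ℓ + 1) * (p * q) - 1) ^ d) +
            Real.log (LODNet.neumannLength P.γ P.δHat) *
              LODNet.logFactor P.γ P.δHat ((2 * ℓ + 2) ^ d) + 1) ∧
        (Ψ.numParams : ℝ) ≤ C *
          (LODNet.neumannLength P.θ P.δ * Real.log (LODNet.neumannLength P.θ P.δ) ^ 2 *
              ((((2 * ℓ + 1) * (p * q) - 1) ^ d : ℕ) : ℝ) ^ 3 *
              LODNet.logFactor P.θ P.δ (((2 * ℓ + 1) * (p * q) - 1) ^ d) +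
            LODNet.neumannLength P.γ P.δHat * Real.log (LODNet.neumannLength P.γ P.δHat) ^ 2 *
              (((2 * ℓ + 2) ^ d : ℕ) : ℝ) ^ 3 *
              LODNet.logFactor P.γ P.δHat ((2 * ℓ + 2) ^ d) +
            (ℓ * T.size / (T.refine (p * q) hr).size) ^ (2 * d)) := by
  -- 10 ^ 6 is the constant of `params_le`, larger than the 768 and 2 of the depth; 6 (β/α)² is the
  -- one of `sharp_of_bounds`.
  refine ⟨10 ^ 6, by norm_num, fun α β hα hαβ => ⟨6 * (β / α) ^ 2, ?_, ?_⟩⟩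
  · have hβ := hα.trans_le hαβ
    positivity
  intro T _ _ p q hp hq hp0 hr ℓ hℓ η hη
  have hr4 : 4 ≤ p * q := Nat.mul_le_mul hp hq
  refine ⟨fun A hA K hK j => ?_, ?_, fun P hP eε eN eK => ?_⟩
  · exact LODNet.existsUnique_isElementCorrector hd hK (LODNet.bddCoeff_of_mem_coeffs hα hA) hα
      (hA.2.1.mono fun x h => h.1) (LODNet.CartesianMesh.isLip_hat _ _)
  · exact LODNet.exists_admissible_sharp hd (by lia) hα hαβ hη.1
  have hθ := hP.θ_mem
  have hγ := hP.γ_mem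
  have hη2 := hη.2
  have hL1 := LODNet.logFactor_nonneg hθ.1 (by linarith [hθ.2]) P.δ
    (((2 * ℓ + 1) * (p * q) - 1) ^ d)
  have hL2 := LODNet.logFactor_nonneg hγ.1 (by linarith [hγ.2]) P.δHat ((2 * ℓ + 2) ^ d)
  have hm1 := Real.log_natCast_nonneg (LODNet.neumannLength P.θ P.δ)
  have hm2 := Real.log_natCast_nonneg (LODNet.neumannLength P.γ P.δHat)
  have h1 := mul_nonneg hm1 hL1
  have h2 := mul_nonneg hm2 hL2
  have h3 : 0 ≤ (LODNet.neumannLength P.θ P.δ : ℝ) *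
      Real.log (LODNet.neumannLength P.θ P.δ) ^ 2 *
      ((((2 * ℓ + 1) * (p * q) - 1) ^ d : ℕ) : ℝ) ^ 3 *
      LODNet.logFactor P.θ P.δ (((2 * ℓ + 1) * (p * q) - 1) ^ d) :=
    mul_nonneg (by positivity) hL1
  have h4 : 0 ≤ (LODNet.neumannLength P.γ P.δHat : ℝ) *
      Real.log (LODNet.neumannLength P.γ P.δHat) ^ 2 * (((2 * ℓ + 2) ^ d : ℕ) : ℝ) ^ 3 *
      LODNet.logFactor P.γ P.δHat ((2 * ℓ + 2) ^ d) :=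
    mul_nonneg (by positivity) hL2
  have h5 : 0 ≤ (ℓ * T.size / (T.refine (p * q) hr).size) ^ (2 * d) :=
    (even_two_mul d).pow_nonneg _
  by_cases hex : ∃ K, T.IsInterior ℓ K
  · obtain ⟨K₀, hK₀⟩ := hex
    obtain ⟨Ψ, hΨ, hdepth, hparams⟩ :=
      LODNet.exists_network hd hd3 hp hq hp0 hr hℓ hα hαβ hη hP rfl eε eN eK hK₀
    -- The terms with θ and δ, with the summand 1 for the depth, already suffice; the remaining
    -- summands are only needed to be non-negative.
    exact ⟨Ψ, hΨ, by linarith, by linarith⟩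
  -- Without interior elements nothing is to be approximated, and the bounds on δ are not available.
  -- A zero network of one layer fits into the summand 1.
  · refine ⟨.output 0 0, fun A _ K hK => (hex ⟨K, hK⟩).elim, ?_, ?_⟩
    · simp only [LODNet.NeuralNetwork.depth, Nat.cast_one]
      linarith
    · have : (LODNet.NeuralNetwork.output (0 : Matrix (Fin (2 ^ d * (2 * ℓ + 2) ^ d))
          (Fin (((2 * ℓ + 1) * p) ^ d)) ℝ) 0).numParams = 0 := by
        simp [LODNet.NeuralNetwork.numParams, LODNet.NeuralNetwork.layerParams, hammingNorm]
      rw [this, Nat.cast_zero]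
      linarith
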